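/- **Setting.** Let $M$ be a smooth $n$-dimensional manifold without boundary, Hausdorff and second countable (for instance $\mathbb{R}^n$, or a compact connected manifold). A *Carnot–Carathéodory structure* on $M$ consists of a smooth Euclidean vector bundle $U\to M$ of finite rank, a smooth morphism of vector bundles $f:U\to TM$ over the identity (whose rank may vary) that is bracket-generating, and a smooth positive measure $\omega$ on $M$ (for instance that of a volume form). Bracket-generating means that the smallest Lie algebra of vector fields containing all horizontal fields $f\circ\sigma$, with $\sigma$ a smooth section of $U$, spans $T_pM$ at every $p\in M$. The norm of a vector $v$ in the range of $f$ is $\|v\|=\min\{|u|: f(u)=v\}$; it comes from an inner product $g$. The divergence of a vector field with respect to $\omega$ is written $\mathrm{div}_\omega$. **Piecewise smooth boundary.** An open set has piecewise smooth boundary if its boundary has locally finite $(n-1)$-dimensional measure and, away from a closed set of $(n-1)$-dimensional measure zero, is a smooth hypersurface with the set on one side. **Perimeter and Cheeger constant.** Let $\Omega\subseteq M$ be open and bounded (i.e. with compact closure), with piecewise smooth boundary, and let $\Gamma\subseteq\partial\Omega$ have finitely many connected components. For $A \subseteq \Omega$ the horizontal perimeter of $A$ relative to $\Omega$ is $$P_H(A;\Omega)=\sup_\varphi\int_\Omega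 \chi_A\,\bigl(-\mathrm{div}_\omega(f\circ\varphi)\bigr)\,\omega ,$$ where $\varphi$ ranges over the smooth sections of $U$ with compact support in $\Omega$ and $|\varphi|\le 1$. Thus only the part of $\partial A$ inside $\Omega$ is counted. The mixed Cheeger constant is $$h_Z(\Omega,\Gamma)=\inf_A \frac{P_H(A;\Omega)}{\omega(A)},$$ the infimum over all nonempty open sets $A\subseteq\Omega$ with piecewise smooth boundary and $\partial A\cap\Gamma=\varnothing$. **First eigenvalue.** Let $S^1(\Omega)$ be the space of $u\in L^2(\Omega)$ whose distributional horizontal gradient $\nabla_H u$ is in $L^2(\Omega)$, with norm given by $\|u\|_{S^1}^2=\|u\|^2+\|\nabla_H u\|^2$. Let $S^1_{0,\Gamma}(\Omega)$ be the closure in $S^1(\Omega)$ of the functions $u \in C^\infty(\Omega)\cap S^1(\Omega)$ whose support (the closure of $\{u \neq 0\}$ in $M$) does not meet $\overline\Gamma$. Let $-\Delta_{Z,\Gamma}$ be the operator on $L^2(\Omega)$ associated with the form $q(u,v)=\int_\Omega g(\nabla_H u,\nabla_H v)\,\omega$ on $S^1_{0,\Gamma}(\Omega)$ (Dirichlet condition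 on $\Gamma$, Neumann condition elsewhere), and let $\lambda_1^Z(\Omega,\Gamma)$ be its first (smallest) eigenvalue. **Theorem (Mixed Cheeger inequality).** In this setting, $$\lambda_1^Z(\Omega,\Gamma)\ \ge\ \tfrac14\,h_Z(\Omega,\Gamma)^2 .$$ More precisely, the bound $\tfrac14 h_Z(\Omega,\Gamma)^2$ holds both for every eigenvalue of $-\Delta_{Z,\Gamma}$ and for the infimum of the Rayleigh quotient $\|\nabla_H u\|^2/\|u\|^2$ over $S^1_{0,\Gamma}(\Omega)\setminus\{0\}$ (which equals $\lambda_1^Z(\Omega,\Gamma)$ by the min-max principle when the spectrum is discrete). -/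

import Mathlib

open Set Filter Topology MeasureTheory Bundle Manifold
open scoped ENNReal ContDiff

noncomputable section

set_option linter.unusedSectionVars false

namespace CC

/-! ### Smooth measures, divergence, piecewise smooth boundaries -/

section Manifolds

variable (n : ℕ) (M : Type*) [TopologicalSpace M] [ChartedSpace (EuclideanSpace ℝ (Fin n)) M]
  [MeasurableSpace M]

/-- A smooth positive measure on the `n`-manifold `M` (the measure of a volume form): in the
chart at any point `p` it has the smooth positive density `density p` with respect to Lebesgue
measure. The values of `density p` outside the target of the chart are irrelevant. -/
structure SmoothMeasure where
  /-- the measure -/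
  toMeasure : Measure M
  /-- its density in the preferred chart at `p` -/
  density : M → EuclideanSpace ℝ (Fin n) → ℝ
  contDiffOn_density : ∀ p, ContDiffOn ℝ ∞ (density p) (extChartAt (𝓡 n) p).target
  density_pos : ∀ p, ∀ y ∈ (extChartAt (𝓡 n) p).target, 0 < density p y
  measure_eq : ∀ p (S : Set M), MeasurableSet S → S ⊆ (extChartAt (𝓡 n) p).source →
    toMeasure S = ∫⁻ y in extChartAt (𝓡 n) p '' S, ENNReal.ofReal (density p y)

variable {n M}

/-- The divergence of a vector field `Y` with respect to a smooth measure of density `ρ`: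
in coordinates it is `ρ⁻¹ ∑ i, ∂ᵢ (ρ Yⁱ)`, i.e. the factor in `L_Y ω = div_ω (Y) ω`.
It is evaluated at `x` in the preferred chart at `x`. -/
def SmoothMeasure.divergence (vol : SmoothMeasure n M) (Y : ∀ x : M, TangentSpace (𝓡 n) x)
    (x : M) : ℝ :=
  LinearMap.trace ℝ (EuclideanSpace ℝ (Fin n))
      (fderiv ℝ (fun y : EuclideanSpace ℝ (Fin n) => vol.density x y •
        (VectorField.mpullback 𝓘(ℝ, EuclideanSpace ℝ (Fin n)) (𝓡 n)
          (extChartAt (𝓡 n) x).symm Y y : EuclideanSpace ℝ (Fin n)))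
        (extChartAt (𝓡 n) x x)).toLinearMap
    / vol.density x (extChartAt (𝓡 n) x x)

variable (n) in
/-- `p` is a smooth boundary point of the open set `U`: near `p`, `U = {g < 0}` for a smooth
function `g` with `g p = 0` and nonvanishing differential at `p`. So near `p` the boundary of `U`
is a smooth hypersurface and `U` lies on one side of it. -/
def IsSmoothBoundaryPoint (U : Set M) (p : M) : Prop :=
  ∃ (V : Set M) (g : M → ℝ), IsOpen V ∧ p ∈ V ∧ ContMDiffOn (𝓡 n) 𝓘(ℝ, ℝ) ∞ g V ∧
    g p = 0 ∧ mfderiv (𝓡 n) 𝓘(ℝ, ℝ) g p ≠ 0 ∧ ∀ x ∈ V, (x ∈ U ↔ g x < 0)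

variable (n) in
/-- The open set `U` has piecewise smooth boundary: its boundary has locally finite
`(n-1)`-dimensional measure and is, away from a (closed) singular set of `(n-1)`-dimensional
measure zero (edges, corners, conical points, …), a smooth hypersurface with `U` on one side.
The `(n-1)`-dimensional Hausdorff measure is taken in charts; finiteness and
nullity do not depend on the charts. -/
structure HasPiecewiseSmoothBoundary (U : Set M) : Prop where
  finite_area : ∀ p : M, ∃ V ∈ 𝓝 p,
    Measure.hausdorffMeasure ((n : ℝ) - 1)
      (extChartAt (𝓡 n) p '' (frontier U ∩ V ∩ (extChartAt (𝓡 n) p).source)) < ⊤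
  singular_null : ∀ p : M,
    Measure.hausdorffMeasure ((n : ℝ) - 1)
      (extChartAt (𝓡 n) p ''
        ({q ∈ frontier U | ¬ IsSmoothBoundaryPoint n U q} ∩ (extChartAt (𝓡 n) p).source)) = 0

end Manifolds

/-! ### Carnot-Carathéodory spaces -/

section Spaces

variable {n : ℕ} {M : Type*} [TopologicalSpace M] [ChartedSpace (EuclideanSpace ℝ (Fin n)) M]
  [IsManifold (𝓡 n) ∞ M]
  {F : Type*} [NormedAddCommGroup F] [NormedSpace ℝ F]
  {U : M → Type*} [TopologicalSpace (TotalSpace F U)] [∀ x, NormedAddCommGroup (U x)]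
  [∀ x, InnerProductSpace ℝ (U x)] [FiberBundle F U] [VectorBundle ℝ F U]

/-- The smallest Lie algebra of vector fields on `M` containing the horizontal vector fields
`f ∘ σ`, where `σ` ranges over the smooth sections of `U`. -/
inductive LieHull (f : ∀ x, U x →L[ℝ] TangentSpace (𝓡 n) x) :
    (∀ x : M, TangentSpace (𝓡 n) x) → Prop
  | horizontal (σ : Cₛ^∞⟮𝓡 n; F, U⟯) : LieHull f (fun x => f x (σ x))
  | add {X Y : ∀ x : M, TangentSpace (𝓡 n) x} :
      LieHull f X → LieHull f Y → LieHull f (fun x => X x + Y x)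
  | smul (c : ℝ) {X : ∀ x : M, TangentSpace (𝓡 n) x} :
      LieHull f X → LieHull f (fun x => c • X x)
  | bracket {X Y : ∀ x : M, TangentSpace (𝓡 n) x} :
      LieHull f X → LieHull f Y → LieHull f (VectorField.mlieBracket (𝓡 n) X Y)

variable (n M F U) in
/-- A Carnot-Carathéodory structure on `M` with Euclidean vector bundle `U`: a smooth morphism of
vector bundles `f : U → TM` (over the identity) which is bracket-generating, together with a
smooth measure. The rank of `f` may vary. -/
structure CCSpace [MeasurableSpace M] where
  /-- the bundle morphism `f : U → TM` -/
  anchor : ∀ x, U x →L[ℝ] TangentSpace (𝓡 n) x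
  contMDiff_anchor : ContMDiff ((𝓡 n).prod 𝓘(ℝ, F)) (𝓡 n).tangent ∞
    (fun p : TotalSpace F U =>
      (⟨p.1, anchor p.1 p.2⟩ : TangentBundle (𝓡 n) M))
  bracketGenerating : ∀ (p : M) (v : TangentSpace (𝓡 n) p),
    ∃ X, LieHull (F := F) anchor X ∧ X p = v
  /-- the smooth measure `ω` -/
  vol : SmoothMeasure n M

end Spaces

section Analysis

variable {n : ℕ} {M : Type*} [TopologicalSpace M] [ChartedSpace (EuclideanSpace ℝ (Fin n)) M]
  [IsManifold (𝓡 n) ∞ M] [MeasurableSpace M]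
  {F : Type*} [NormedAddCommGroup F] [NormedSpace ℝ F]
  {U : M → Type*} [TopologicalSpace (TotalSpace F U)] [∀ x, NormedAddCommGroup (U x)]
  [∀ x, InnerProductSpace ℝ (U x)] [FiberBundle F U] [VectorBundle ℝ F U]

namespace CCSpace

variable (C : CCSpace n M F U)

/-- The measure `ω` as a measure on `M`. -/
abbrev μ : Measure M := C.vol.toMeasure

/-- The sub-Riemannian norm `‖v‖ = min {|u| : f u = v}` of a vector `v` in the range of `f`. -/
def ccNorm {x : M} (v : TangentSpace (𝓡 n) x) : ℝ :=
  sInf {r | ∃ u : U x, C.anchor x u = v ∧ ‖u‖ = r}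

/-- If `a` is orthogonal to the kernel of `f`, then `|a|` is the sub-Riemannian norm of `f a`, so
that also `⟪a, b⟫ = g (f a, f b)` for two such vectors. -/
theorem ccNorm_anchor {x : M} (a : U x)
    (ha : ∀ w : U x, C.anchor x w = 0 → inner ℝ a w = 0) : C.ccNorm (C.anchor x a) = ‖a‖ := by
  refine IsLeast.csInf_eq ⟨⟨a, rfl, rfl⟩, ?_⟩
  rintro r ⟨u, hu, rfl⟩
  have h := ha (u - a) (by rw [map_sub, hu, sub_self])
  have h2 := norm_add_sq_real a (u - a)
  rw [h, add_sub_cancel] at h2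
  nlinarith [norm_nonneg a, norm_nonneg u, sq_nonneg ‖u - a‖]

/-- A smooth section of `U` with compact support in `Ω`. -/
def IsTestSection (Ω : Set M) (φ : Cₛ^∞⟮𝓡 n; F, U⟯) : Prop :=
  IsCompact (closure {x | φ x ≠ 0}) ∧ closure {x | φ x ≠ 0} ⊆ Ω

/-- The formal adjoint of the horizontal gradient, `φ ↦ - div_ω (f ∘ φ)`. For a generating family
`X₁, …, X_m` and `φ = (φ₁, …, φ_m)` this is `∑ j, X_j^* φ_j`. -/
def adjointGrad (φ : Cₛ^∞⟮𝓡 n; F, U⟯) (x : M) : ℝ :=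
  - C.vol.divergence (fun y => C.anchor y (φ y)) x

/-- The horizontal variation of `u` in `Ω`. -/
def horizontalVariation (u : M → ℝ) (Ω : Set M) : ℝ≥0∞ :=
  ⨆ (φ : Cₛ^∞⟮𝓡 n; F, U⟯) (_ : IsTestSection Ω φ ∧ ∀ x, ‖φ x‖ ≤ 1),
    ENNReal.ofReal (∫ x in Ω, u x * C.adjointGrad φ x ∂C.μ)

/-- The horizontal perimeter of `A` relative to `Ω`. -/
def horizontalPerimeter (A Ω : Set M) : ℝ≥0∞ :=
  C.horizontalVariation (A.indicator fun _ => 1) Ω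

/-- The mixed Cheeger constant `h_Z(Ω, Γ)`: the infimum of `P_H(A; Ω) / ω(A)` over the nonempty
open sets `A ⊆ Ω` with piecewise smooth boundary and `∂A ∩ Γ = ∅`. -/
def mixedCheegerConstant (Ω Γ : Set M) : ℝ≥0∞ :=
  ⨅ (A : Set M) (_ : IsOpen A ∧ A.Nonempty ∧ A ⊆ Ω ∧ HasPiecewiseSmoothBoundary n A ∧
      frontier A ∩ Γ = ∅),
    C.horizontalPerimeter A Ω / C.μ A

/-- `G` represents the distributional horizontal gradient of `u` on `Ω`, and is
square-integrable: `f ∘ G = ∇_H u`, where `G x` is the lift of `∇_H u (x)` to `U x` of minimal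
norm (so `|G x|` is the sub-Riemannian norm of `∇_H u (x)`). For smooth `u`,
`G x` is the transpose of `f x` applied to the differential of `u`. A section `G` of `U` is
measurable if its inner products with all smooth sections are. -/
structure IsHorizontalGradient (Ω : Set M) (u : M → ℝ) (G : ∀ x, U x) : Prop where
  measurable : ∀ σ : Cₛ^∞⟮𝓡 n; F, U⟯,
    AEStronglyMeasurable (fun x => (inner ℝ (G x) (σ x) : ℝ)) (C.μ.restrict Ω)
  minimal : ∀ᵐ x ∂(C.μ.restrict Ω), ∀ w : U x, C.anchor x w = 0 → (inner ℝ (G x) w : ℝ) = 0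
  sq_integrable : ∫⁻ x in Ω, ‖G x‖ₑ ^ 2 ∂C.μ < ⊤
  weak : ∀ φ : Cₛ^∞⟮𝓡 n; F, U⟯, IsTestSection Ω φ →
    ∫ x in Ω, (inner ℝ (G x) (φ x) : ℝ) ∂C.μ = ∫ x in Ω, u x * C.adjointGrad φ x ∂C.μ

/-- `u ∈ S¹(Ω)`, with horizontal gradient (represented by) `G`. -/
def MemS1 (Ω : Set M) (u : M → ℝ) (G : ∀ x, U x) : Prop :=
  MemLp u 2 (C.μ.restrict Ω) ∧ C.IsHorizontalGradient Ω u G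

variable (n) in
/-- The space `C^∞_{0,Γ}(Ω)` of smooth functions on `Ω` whose support (closure in `M`) does not
meet the closure of `Γ`. -/
def SmoothVanishingNear (Ω Γ : Set M) (u : M → ℝ) : Prop :=
  ContMDiffOn (𝓡 n) 𝓘(ℝ, ℝ) ∞ u Ω ∧ closure {x ∈ Ω | u x ≠ 0} ∩ closure Γ = ∅

/-- `u ∈ S¹_{0,Γ}(Ω)`, the closure of `C^∞_{0,Γ}(Ω)` (its elements of finite `S¹`-norm) in the
`S¹`-norm; `G` is the horizontal gradient of `u`. -/
def MemS1Zero (Ω Γ : Set M) (u : M → ℝ) (G : ∀ x, U x) : Prop :=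
  C.MemS1 Ω u G ∧ ∀ ε : ℝ≥0∞, 0 < ε → ∃ (v : M → ℝ) (H : ∀ x, U x),
    SmoothVanishingNear n Ω Γ v ∧ C.MemS1 Ω v H ∧
    ∫⁻ x in Ω, ‖u x - v x‖ₑ ^ 2 ∂C.μ + ∫⁻ x in Ω, ‖G x - H x‖ₑ ^ 2 ∂C.μ < ε

/-- The graph of the operator `-Δ_{Z,Γ}` associated with the quadratic form
`q(u, v) = ∫_Ω g(∇_H u, ∇_H v) ω` on `S¹_{0,Γ}(Ω)`: `u` is in its domain and is mapped to `w`. -/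
def IsNegMixedSubLaplacian (Ω Γ : Set M) (u w : M → ℝ) : Prop :=
  MemLp w 2 (C.μ.restrict Ω) ∧ ∃ G : ∀ x, U x, C.MemS1Zero Ω Γ u G ∧
    ∀ (v : M → ℝ) (H : ∀ x, U x), C.MemS1Zero Ω Γ v H →
      ∫ x in Ω, (inner ℝ (H x) (G x) : ℝ) ∂C.μ = ∫ x in Ω, v x * w x ∂C.μ

/-- `l` is an eigenvalue of `-Δ_{Z,Γ}`. -/
def IsMixedEigenvalue (Ω Γ : Set M) (l : ℝ) : Prop :=
  ∃ u : M → ℝ, ¬ (∀ᵐ x ∂(C.μ.restrict Ω), u x = 0) ∧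
    C.IsNegMixedSubLaplacian Ω Γ u (fun x => l * u x)

/-- The first eigenvalue `λ₁^Z(Ω, Γ)` of `-Δ_{Z,Γ}`. -/
def firstMixedEigenvalue (Ω Γ : Set M) : ℝ≥0∞ :=
  ⨅ (l : ℝ) (_ : C.IsMixedEigenvalue Ω Γ l), ENNReal.ofReal l

/-- The infimum of the Rayleigh quotient over `S¹_{0,Γ}(Ω) \ {0}`, that is, the bottom of the
spectrum of `-Δ_{Z,Γ}`. -/
def mixedRayleighInf (Ω Γ : Set M) : ℝ≥0∞ :=
  ⨅ (u : M → ℝ) (G : ∀ x, U x)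
    (_ : C.MemS1Zero Ω Γ u G ∧ ¬ (∀ᵐ x ∂(C.μ.restrict Ω), u x = 0)),
    (∫⁻ x in Ω, ‖G x‖ₑ ^ 2 ∂C.μ) / (∫⁻ x in Ω, ‖u x‖ₑ ^ 2 ∂C.μ)

end CCSpace

end Analysis

end CC

end

set_option linter.unusedSectionVars false

/-! Cheeger's argument. Let `c` be a lower bound for the quotients `P_H(A; Ω) / ω(A)`. If `w ≥ 0` is
smooth on `M` with support away from `Γ`, then almost every nonempty superlevel set `Ω ∩ {w > t}`,
`t > 0`, is admissible. The coarea inequality `∫ P_H(Ω ∩ {w > t}; Ω) dt ≤ ∫_Ω |∇_H w|` and the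
layer-cake formula then give `c ∫_Ω w ≤ ∫_Ω |∇_H w|`. For `w = v²`, Cauchy–Schwarz turns this into
`c ‖v‖ ≤ 2 ‖∇_H v‖`, and squaring produces the factor `1/4`. The inequality passes to the closure
`S¹_{0,Γ}(Ω)`. An eigenfunction tested against itself shows that its eigenvalue is a Rayleigh
quotient.

Only one half of the coarea formula is needed (`ae_horizontalPerimeter_le_rnDeriv`). The measure
`|∇_H w| ω` is pushed to the line by `w`; smooth steps approximate the indicator of a superlevel
set, and differentiation of measures bounds its perimeter by the density of the image measure.

Most of the work is regularity. First, superlevel sets must have piecewise smooth boundary, also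
where the level meets `∂Ω`: `HasPiecewiseSmoothBoundary.ae_superlevel`. This follows from a
cell-counting estimate that yields both finite area of almost every level and a weak form of Sard's
theorem.

Second, the functions in the form domain are approximated by functions smooth only inside `Ω`, whose
level sets may be wild at `∂Ω`. They are replaced, with small error in horizontal `W^{1,1}`, by
functions smooth on `M`. The singular part of `∂Ω` has vanishing `(n-1)`-dimensional measure, so it
can be cut off at small cost (`exists_singular_cutoff`); this requires bounded functions, hence a
smooth truncation of `v²`. Near every other boundary point `Ω` is stable under small shifts in an
open set of directions. Mollifying with a kernel supported in these directions uses only interior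
values, and Friedrichs' commutator lemma gives convergence of the derivatives along horizontal
fields, the only derivatives known to be integrable (`exists_global_approx`). -/

noncomputable section

namespace CC

/-! ### Integration against a smooth measure in charts. -/

section ChartIntegrals

variable {n : ℕ} {M : Type*} [TopologicalSpace M] [ChartedSpace (EuclideanSpace ℝ (Fin n)) M]
  [MeasurableSpace M]

namespace SmoothMeasure

variable (vol : SmoothMeasure n M) (p : M)

theorem continuousOn_density : ContinuousOn (vol.density p) (extChartAt (𝓡 n) p).target :=
  (vol.contDiffOn_density p).continuousOn

theorem density_nonneg {y : EuclideanSpace ℝ (Fin n)} (hy : y ∈ (extChartAt (𝓡 n) p).target) :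
    0 ≤ vol.density p y := (vol.density_pos p y hy).le

theorem aemeasurable_density :
    AEMeasurable (fun y => ENNReal.ofReal (vol.density p y))
      (volume.restrict (extChartAt (𝓡 n) p).target) :=
  ((vol.continuousOn_density p).aemeasurable
    (isOpen_extChartAt_target p).measurableSet).ennreal_ofReal

/-- The measure in the chart at `p`. -/
def chartMeasure : Measure (EuclideanSpace ℝ (Fin n)) :=
  (volume.restrict (extChartAt (𝓡 n) p).target).withDensity
    fun y => ENNReal.ofReal (vol.density p y)

variable [BorelSpace M]

omit [MeasurableSpace M] [BorelSpace M] in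
theorem aemeasurable_extChartAt_symm [MeasurableSpace M] [BorelSpace M] :
    AEMeasurable (extChartAt (𝓡 n) p).symm
      (volume.restrict (extChartAt (𝓡 n) p).target) :=
  (continuousOn_extChartAt_symm p).aemeasurable (isOpen_extChartAt_target p).measurableSet

/-- `measure_eq` computes the mass of `S ∩ source` in the chart, so the two measures agree on Borel
sets. Every integral over a chart domain reduces to a Lebesgue integral through this identity. -/
theorem restrict_source_eq_map :
    vol.toMeasure.restrict (extChartAt (𝓡 n) p).source
      = (vol.chartMeasure p).map (extChartAt (𝓡 n) p).symm := by
  have hac : vol.chartMeasure p ≪ volume.restrict (extChartAt (𝓡 n) p).target :=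
    withDensity_absolutelyContinuous _ _
  ext S hS
  rw [Measure.restrict_apply hS,
    Measure.map_apply_of_aemeasurable ((aemeasurable_extChartAt_symm p).mono_ac hac) hS,
    vol.measure_eq p _ (hS.inter (isOpen_extChartAt_source p).measurableSet) inter_subset_right]
  have himg : extChartAt (𝓡 n) p '' (S ∩ (extChartAt (𝓡 n) p).source)
      = (extChartAt (𝓡 n) p).target ∩ (extChartAt (𝓡 n) p).symm ⁻¹' S := by
    rw [inter_comm, PartialEquiv.image_source_inter_eq']
  have hm : NullMeasurableSet ((extChartAt (𝓡 n) p).symm ⁻¹' S)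
      (volume.restrict (extChartAt (𝓡 n) p).target) :=
    (aemeasurable_extChartAt_symm p).nullMeasurable hS
  rw [himg, chartMeasure, withDensity_apply' _ _, Measure.restrict_restrict₀ hm, inter_comm]

theorem lintegral_source {f : M → ℝ≥0∞}
    (hf : AEMeasurable f (vol.toMeasure.restrict (extChartAt (𝓡 n) p).source)) :
    ∫⁻ x in (extChartAt (𝓡 n) p).source, f x ∂vol.toMeasure
      = ∫⁻ y in (extChartAt (𝓡 n) p).target,
        ENNReal.ofReal (vol.density p y) * f ((extChartAt (𝓡 n) p).symm y) := by
  have hac : vol.chartMeasure p ≪ volume.restrict (extChartAt (𝓡 n) p).target :=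
    withDensity_absolutelyContinuous _ _
  rw [restrict_source_eq_map] at hf ⊢
  have hs := (aemeasurable_extChartAt_symm p).mono_ac hac
  rw [lintegral_map' hf hs]
  exact lintegral_withDensity_eq_lintegral_mul₀' (vol.aemeasurable_density p)
    (hf.comp_aemeasurable hs)

theorem integral_source {f : M → ℝ}
    (hf : AEStronglyMeasurable f (vol.toMeasure.restrict (extChartAt (𝓡 n) p).source)) :
    ∫ x in (extChartAt (𝓡 n) p).source, f x ∂vol.toMeasure
      = ∫ y in (extChartAt (𝓡 n) p).target,
        vol.density p y * f ((extChartAt (𝓡 n) p).symm y) := by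
  have hac : vol.chartMeasure p ≪ volume.restrict (extChartAt (𝓡 n) p).target :=
    withDensity_absolutelyContinuous _ _
  rw [restrict_source_eq_map] at hf ⊢
  have hs := (aemeasurable_extChartAt_symm p).mono_ac hac
  rw [integral_map hs hf, chartMeasure, integral_withDensity_eq_integral_toReal_smul₀
    (vol.aemeasurable_density p) (ae_of_all _ fun _ => ENNReal.ofReal_lt_top)]
  refine setIntegral_congr_fun (isOpen_extChartAt_target p).measurableSet fun y hy => ?_
  simp [ENNReal.toReal_ofReal (vol.density_nonneg p hy)]

theorem measure_lt_top_of_isCompact_subset_source [T2Space M] {K : Set M} (hK : IsCompact K)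
    (hKs : K ⊆ (extChartAt (𝓡 n) p).source) : vol.toMeasure K < ⊤ := by
  rw [vol.measure_eq p K hK.isClosed.measurableSet hKs]
  have hc : IsCompact (extChartAt (𝓡 n) p '' K) :=
    hK.image_of_continuousOn ((continuousOn_extChartAt p).mono hKs)
  have ht : extChartAt (𝓡 n) p '' K ⊆ (extChartAt (𝓡 n) p).target :=
    image_subset_iff.2 fun x hx => (extChartAt (𝓡 n) p).map_source (hKs hx)
  obtain ⟨c, hcb⟩ := (hc.image_of_continuousOn ((vol.continuousOn_density p).mono ht)).bddAbove
  calc ∫⁻ y in extChartAt (𝓡 n) p '' K, ENNReal.ofReal (vol.density p y)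
      ≤ ∫⁻ _ in extChartAt (𝓡 n) p '' K, ENNReal.ofReal c :=
        setLIntegral_mono' hc.measurableSet fun y hy =>
          ENNReal.ofReal_le_ofReal (hcb (mem_image_of_mem _ hy))
    _ < ⊤ := by
        rw [setLIntegral_const]
        exact ENNReal.mul_lt_top ENNReal.ofReal_lt_top hc.measure_lt_top

theorem isLocallyFiniteMeasure [T2Space M] : IsLocallyFiniteMeasure vol.toMeasure := by
  have : LocallyCompactSpace M := ChartedSpace.locallyCompactSpace (EuclideanSpace ℝ (Fin n)) M
  refine ⟨fun x => ?_⟩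
  obtain ⟨K, hKn, hKs, hK⟩ := local_compact_nhds (extChartAt_source_mem_nhds (I := 𝓡 n) x)
  exact ⟨K, hKn, vol.measure_lt_top_of_isCompact_subset_source x hK hKs⟩

end SmoothMeasure

end ChartIntegrals

end CC

end

noncomputable section

namespace CC

/-! ### The divergence in Euclidean space. -/

section EuclideanDivergence

variable {n : ℕ}

/-- The divergence of a vector field on Euclidean space. -/
def eucDiv (Z : EuclideanSpace ℝ (Fin n) → EuclideanSpace ℝ (Fin n))
    (y : EuclideanSpace ℝ (Fin n)) : ℝ :=
  LinearMap.trace ℝ (EuclideanSpace ℝ (Fin n)) (fderiv ℝ Z y).toLinearMap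

theorem trace_eq_sum_apply_single
    (T : EuclideanSpace ℝ (Fin n) →ₗ[ℝ] EuclideanSpace ℝ (Fin n)) :
    LinearMap.trace ℝ (EuclideanSpace ℝ (Fin n)) T
      = ∑ i, (T (EuclideanSpace.single i 1)) i := by
  rw [LinearMap.trace_eq_matrix_trace ℝ (EuclideanSpace.basisFun (Fin n) ℝ).toBasis, Matrix.trace]
  simp [LinearMap.toMatrix_apply]

/-- The trace as a continuous linear form. -/
def traceCLM (n : ℕ) : (EuclideanSpace ℝ (Fin n) →L[ℝ] EuclideanSpace ℝ (Fin n)) →L[ℝ] ℝ :=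
  LinearMap.toContinuousLinearMap
    ((LinearMap.trace ℝ (EuclideanSpace ℝ (Fin n))).comp (ContinuousLinearMap.coeLM ℝ))

theorem eucDiv_eq_traceCLM (Z : EuclideanSpace ℝ (Fin n) → EuclideanSpace ℝ (Fin n)) :
    eucDiv Z = fun y => traceCLM n (fderiv ℝ Z y) := rfl

theorem trace_smulRight (l : EuclideanSpace ℝ (Fin n) →L[ℝ] ℝ) (v : EuclideanSpace ℝ (Fin n)) :
    traceCLM n (l.smulRight v) = l v := by
  change LinearMap.trace ℝ _ (l.smulRight v).toLinearMap = l v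
  rw [trace_eq_sum_apply_single]
  have h : v = ∑ i, v i • EuclideanSpace.single i (1 : ℝ) := by
    ext j
    simp [Finset.sum_apply, Pi.single_apply]
  conv_rhs => rw [h, map_sum]
  refine Finset.sum_congr rfl fun i _ => ?_
  simp [mul_comm]

theorem eucDiv_smul {u : EuclideanSpace ℝ (Fin n) → ℝ}
    {Z : EuclideanSpace ℝ (Fin n) → EuclideanSpace ℝ (Fin n)} {y : EuclideanSpace ℝ (Fin n)}
    (hu : DifferentiableAt ℝ u y) (hZ : DifferentiableAt ℝ Z y) :
    eucDiv (fun z => u z • Z z) y = u y * eucDiv Z y + fderiv ℝ u y (Z y) := by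
  simp only [eucDiv_eq_traceCLM]
  rw [fderiv_fun_smul hu hZ, map_add, map_smul, trace_smulRight, smul_eq_mul]

/-- Each term `∂ᵢ Zⁱ` integrates to zero: integrate by parts against the constant function `1`,
which compact support allows. -/
theorem integral_eucDiv_eq_zero {Z : EuclideanSpace ℝ (Fin n) → EuclideanSpace ℝ (Fin n)}
    (hZ : ContDiff ℝ 1 Z) (hc : HasCompactSupport Z) : ∫ y, eucDiv Z y = 0 := by
  have hd := hZ.continuous_fderiv one_ne_zero
  have hi : ∀ i : Fin n, Continuous fun y => (fderiv ℝ Z y (EuclideanSpace.single i 1)) i := by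
    intro i
    have := hd.clm_apply (continuous_const (y := EuclideanSpace.single i (1 : ℝ)))
    fun_prop
  have hci : ∀ i : Fin n, Integrable fun y => (fderiv ℝ Z y (EuclideanSpace.single i 1)) i := by
    intro i
    refine (hi i).integrable_of_hasCompactSupport ((hc.fderiv ℝ).mono fun y hy h => hy ?_)
    simp [h]
  have h : ∀ y, eucDiv Z y = ∑ i, (fderiv ℝ Z y (EuclideanSpace.single i 1)) i :=
    fun y => trace_eq_sum_apply_single _
  simp_rw [h]
  rw [integral_finsetSum _ fun i _ => hci i]
  refine Finset.sum_eq_zero fun i _ => ?_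
  have hf : ∀ y, fderiv ℝ (fun y => Z y i) y (EuclideanSpace.single i 1)
      = (fderiv ℝ Z y (EuclideanSpace.single i 1)) i := by
    intro y
    have := ((EuclideanSpace.proj i : EuclideanSpace ℝ (Fin n) →L[ℝ] ℝ).hasFDerivAt.comp y
      (hZ.differentiable one_ne_zero y).hasFDerivAt).fderiv
    simp only [Function.comp_def, PiLp.proj_apply] at this
    rw [this]; rfl
  have hZi : Differentiable ℝ fun y => Z y i := by
    have := hZ.differentiable one_ne_zero
    fun_prop
  have key := integral_mul_fderiv_eq_neg_fderiv_mul_of_integrable (μ := volume)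
    (f := fun _ : EuclideanSpace ℝ (Fin n) => (1 : ℝ)) (g := fun y => Z y i)
    (v := EuclideanSpace.single i 1) (by simp) (by simpa [hf] using hci i)
    (by
      simp only [one_mul]
      exact hZi.continuous.integrable_of_hasCompactSupport
        (hc.mono fun y hy h => hy (by simp [h])))
    (fun _ _ => differentiableAt_const _) (fun y _ => hZi y)
  simpa [hf] using key

end EuclideanDivergence

/-! ### Vector fields and differentials read in charts. -/

section ChartField

variable {n : ℕ} {M : Type*} [TopologicalSpace M] [ChartedSpace (EuclideanSpace ℝ (Fin n)) M]
  [IsManifold (𝓡 n) ∞ M]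

/-- A vector field read in the chart at `p`. -/
def chartField (p : M) (Y : ∀ x : M, TangentSpace (𝓡 n) x) (y : EuclideanSpace ℝ (Fin n)) :
    EuclideanSpace ℝ (Fin n) :=
  VectorField.mpullback 𝓘(ℝ, EuclideanSpace ℝ (Fin n)) (𝓡 n) (extChartAt (𝓡 n) p).symm Y y

theorem isInvertible_mfderiv_extChartAt_symm {p : M} {y : EuclideanSpace ℝ (Fin n)}
    (hy : y ∈ (extChartAt (𝓡 n) p).target) :
    (mfderiv 𝓘(ℝ, EuclideanSpace ℝ (Fin n)) (𝓡 n) (extChartAt (𝓡 n) p).symm y).IsInvertible := by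
  have : IsManifold (𝓡 n) 1 M := IsManifold.of_le (n := ∞) (by norm_cast)
  have h := isInvertible_mfderivWithin_extChartAt_symm (I := 𝓡 n) hy
  rwa [mfderivWithin_of_mem_nhds (by simp)] at h

theorem contMDiffAt_extChartAt_symm {p : M} {y : EuclideanSpace ℝ (Fin n)}
    (hy : y ∈ (extChartAt (𝓡 n) p).target) :
    ContMDiffAt 𝓘(ℝ, EuclideanSpace ℝ (Fin n)) (𝓡 n) ∞ (extChartAt (𝓡 n) p).symm y :=
  (contMDiffOn_extChartAt_symm p).contMDiffAt ((isOpen_extChartAt_target p).mem_nhds hy)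

theorem contDiffOn_chartField (p : M) {Y : ∀ x : M, TangentSpace (𝓡 n) x}
    (hY : ContMDiff (𝓡 n) (𝓡 n).tangent ∞ (fun x => (⟨x, Y x⟩ : TangentBundle (𝓡 n) M))) :
    ContDiffOn ℝ ∞ (chartField p Y) (extChartAt (𝓡 n) p).target := by
  intro y hy
  refine ContDiffAt.contDiffWithinAt (contMDiffAt_vectorSpace_iff_contDiffAt.1 ?_)
  exact ContMDiffAt.mpullback_vectorField_preimage (hY _) (contMDiffAt_extChartAt_symm hy)
    (isInvertible_mfderiv_extChartAt_symm hy) (by simp)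

variable (n) in
/-- The differential of a real function, as a real-valued linear form. -/
def differential (u : M → ℝ) (x : M) : TangentSpace (𝓡 n) x →L[ℝ] ℝ :=
  mfderiv (𝓡 n) 𝓘(ℝ, ℝ) u x

theorem differential_congr {u v : M → ℝ} {x : M} (h : u =ᶠ[𝓝 x] v) :
    differential n u x = differential n v x := by
  rw [differential, differential, h.mfderiv_eq]

@[simp]
theorem differential_const (c : ℝ) (x : M) :
    differential n (fun _ : M => c) x = 0 := by
  rw [differential, mfderiv_const]; rfl

theorem differential_eq_zero_of_notMem_tsupport {u : M → ℝ} {x : M} (hx : x ∉ tsupport u) :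
    differential n u x = 0 := by
  rw [differential_congr (notMem_tsupport_iff_eventuallyEq.1 hx)]
  exact differential_const 0 x

theorem differential_add {u v : M → ℝ} {x : M} (hu : MDifferentiableAt (𝓡 n) 𝓘(ℝ, ℝ) u x)
    (hv : MDifferentiableAt (𝓡 n) 𝓘(ℝ, ℝ) v x) :
    differential n (fun z => u z + v z) x = differential n u x + differential n v x :=
  (hu.hasMFDerivAt.add hv.hasMFDerivAt).mfderiv

theorem differential_sub {u v : M → ℝ} {x : M} (hu : MDifferentiableAt (𝓡 n) 𝓘(ℝ, ℝ) u x)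
    (hv : MDifferentiableAt (𝓡 n) 𝓘(ℝ, ℝ) v x) :
    differential n (fun z => u z - v z) x = differential n u x - differential n v x :=
  (hu.hasMFDerivAt.sub hv.hasMFDerivAt).mfderiv

theorem differential_mul {u v : M → ℝ} {x : M} (hu : MDifferentiableAt (𝓡 n) 𝓘(ℝ, ℝ) u x)
    (hv : MDifferentiableAt (𝓡 n) 𝓘(ℝ, ℝ) v x) :
    differential n (fun z => u z * v z) x = u x • differential n v x + v x • differential n u x :=
  (hu.hasMFDerivAt.mul hv.hasMFDerivAt).mfderiv

theorem differential_comp {g : ℝ → ℝ} {u : M → ℝ} {x : M} (hg : DifferentiableAt ℝ g (u x))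
    (hu : MDifferentiableAt (𝓡 n) 𝓘(ℝ, ℝ) u x) :
    differential n (fun z => g (u z)) x = deriv g (u x) • differential n u x := by
  have h := (hg.hasDerivAt.hasFDerivAt.hasMFDerivAt.comp x hu.hasMFDerivAt).mfderiv
  refine (h : differential n (fun z => g (u z)) x = _).trans ?_
  ext w
  change (differential n u x w) * deriv g (u x) = deriv g (u x) * differential n u x w
  rw [mul_comm]

theorem differential_sum {ι : Type*} (s : Finset ι) {u : ι → M → ℝ} {x : M}
    (hu : ∀ i ∈ s, MDifferentiableAt (𝓡 n) 𝓘(ℝ, ℝ) (u i) x) :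
    MDifferentiableAt (𝓡 n) 𝓘(ℝ, ℝ) (fun z => ∑ i ∈ s, u i z) x ∧
      differential n (fun z => ∑ i ∈ s, u i z) x = ∑ i ∈ s, differential n (u i) x := by
  classical
  induction s using Finset.induction_on with
  | empty => simpa using mdifferentiableAt_const
  | insert i s hi ih =>
    obtain ⟨h1, h2⟩ := ih fun j hj => hu j (Finset.mem_insert_of_mem hj)
    have h3 := hu i (Finset.mem_insert_self i s)
    simp only [Finset.sum_insert hi]
    exact ⟨h3.add h1, by rw [differential_add h3 h1, h2]⟩

/-- Chain rule: the inverse differential contained in `chartField` cancels against the differential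
of the inverse chart. -/
theorem fderiv_comp_extChartAt_symm {p : M} {y : EuclideanSpace ℝ (Fin n)}
    (hy : y ∈ (extChartAt (𝓡 n) p).target) {u : M → ℝ}
    (hu : MDifferentiableAt (𝓡 n) 𝓘(ℝ, ℝ) u ((extChartAt (𝓡 n) p).symm y))
    (Y : ∀ x : M, TangentSpace (𝓡 n) x) :
    fderiv ℝ (u ∘ (extChartAt (𝓡 n) p).symm) y (chartField p Y y)
      = differential n u ((extChartAt (𝓡 n) p).symm y)
          (Y ((extChartAt (𝓡 n) p).symm y)) := by
  rw [← mfderiv_eq_fderiv]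
  have h := mfderiv_comp_apply y hu
    ((contMDiffAt_extChartAt_symm hy).mdifferentiableAt (by simp)) (chartField p Y y)
  refine h.trans ?_
  congr 1
  exact (isInvertible_mfderiv_extChartAt_symm hy).self_apply_inverse _

end ChartField

end CC

end

/-! ### The divergence on a manifold and the divergence theorem. -/

noncomputable section

namespace CC

/-- Points of `K` have a neighbourhood where the extension by zero is `f`; all other points have one
where it vanishes. -/
theorem contDiff_indicator_of_isCompact {E G : Type*} [NormedAddCommGroup E] [NormedSpace ℝ E]
    [NormedAddCommGroup G] [NormedSpace ℝ G] {T K : Set E} (hT : IsOpen T) (hK : IsCompact K)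
    (hKT : K ⊆ T) {f : E → G} {m : WithTop ℕ∞} (hf : ContDiffOn ℝ m f T)
    (h0 : ∀ y ∈ T, y ∉ K → f y = 0) : ContDiff ℝ m (T.indicator f) := by
  refine contDiff_iff_contDiffAt.2 fun y => ?_
  by_cases hy : y ∈ K
  · refine ((hf.contDiffAt (hT.mem_nhds (hKT hy)))).congr_of_eventuallyEq ?_
    filter_upwards [hT.mem_nhds (hKT hy)] with z hz using indicator_of_mem hz f
  · refine (contDiffAt_const (c := (0 : G))).congr_of_eventuallyEq ?_
    filter_upwards [hK.isClosed.isOpen_compl.mem_nhds hy] with z hz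
    by_cases hzT : z ∈ T
    · rw [indicator_of_mem hzT, h0 z hzT hz]
    · rw [indicator_of_notMem hzT]

theorem hasCompactSupport_indicator_of_isCompact {E G : Type*} [TopologicalSpace E] [T2Space E]
    [Zero G] {T K : Set E} (hK : IsCompact K) {f : E → G}
    (h0 : ∀ y ∈ T, y ∉ K → f y = 0) : HasCompactSupport (T.indicator f) := by
  refine HasCompactSupport.intro hK fun y hy => ?_
  by_cases hyT : y ∈ T
  · rw [indicator_of_mem hyT, h0 y hyT hy]
  · rw [indicator_of_notMem hyT]

theorem eucDiv_congr {n : ℕ} {Z Z' : EuclideanSpace ℝ (Fin n) → EuclideanSpace ℝ (Fin n)}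
    {y : EuclideanSpace ℝ (Fin n)} (h : Z =ᶠ[𝓝 y] Z') : eucDiv Z y = eucDiv Z' y := by
  rw [eucDiv, eucDiv, h.fderiv_eq]

section ChartDivergence

variable {n : ℕ} {M : Type*} [TopologicalSpace M] [ChartedSpace (EuclideanSpace ℝ (Fin n)) M]
  [IsManifold (𝓡 n) ∞ M] [MeasurableSpace M]

namespace SmoothMeasure

variable (vol : SmoothMeasure n M)

/-- The divergence of a vector field computed in the chart at `p`. -/
def chartDiv (p : M) (Y : ∀ x : M, TangentSpace (𝓡 n) x) (x : M) : ℝ :=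
  eucDiv (fun y => vol.density p y • chartField p Y y) (extChartAt (𝓡 n) p x)
    / vol.density p (extChartAt (𝓡 n) p x)

omit [IsManifold (𝓡 n) ∞ M] in
theorem divergence_eq_chartDiv (Y : ∀ x : M, TangentSpace (𝓡 n) x) (x : M) :
    vol.divergence Y x = vol.chartDiv x Y x := rfl

variable {Y : ∀ x : M, TangentSpace (𝓡 n) x}

theorem contDiffOn_density_smul_chartField (p : M)
    (hY : ContMDiff (𝓡 n) (𝓡 n).tangent ∞ (fun x => (⟨x, Y x⟩ : TangentBundle (𝓡 n) M))) :
    ContDiffOn ℝ ∞ (fun y => vol.density p y • chartField p Y y) (extChartAt (𝓡 n) p).target :=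
  (vol.contDiffOn_density p).smul (contDiffOn_chartField p hY)

theorem continuousOn_chartDiv (p : M)
    (hY : ContMDiff (𝓡 n) (𝓡 n).tangent ∞ (fun x => (⟨x, Y x⟩ : TangentBundle (𝓡 n) M))) :
    ContinuousOn (vol.chartDiv p Y) (extChartAt (𝓡 n) p).source := by
  have hm : MapsTo (extChartAt (𝓡 n) p) (extChartAt (𝓡 n) p).source (extChartAt (𝓡 n) p).target :=
    (extChartAt (𝓡 n) p).mapsTo
  have h1 : ContinuousOn (eucDiv fun y => vol.density p y • chartField p Y y)
      (extChartAt (𝓡 n) p).target :=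
    (traceCLM n).continuous.comp_continuousOn
      ((vol.contDiffOn_density_smul_chartField p hY).continuousOn_fderiv_of_isOpen
        (isOpen_extChartAt_target p) (by simp))
  refine (h1.comp (continuousOn_extChartAt p) hm).div
    ((vol.continuousOn_density p).comp (continuousOn_extChartAt p) hm) fun x hx => ?_
  exact (vol.density_pos p _ (hm hx)).ne'

omit [MeasurableSpace M] in
theorem continuous_differential_apply {u : M → ℝ} (hu : ContMDiff (𝓡 n) 𝓘(ℝ, ℝ) ∞ u)
    (hY : ContMDiff (𝓡 n) (𝓡 n).tangent ∞ (fun x => (⟨x, Y x⟩ : TangentBundle (𝓡 n) M))) :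
    Continuous fun x => differential n u x (Y x) := by
  refine continuous_iff_continuousAt.2 fun p => ?_
  have h1 : ContinuousOn (fun y => fderiv ℝ (u ∘ (extChartAt (𝓡 n) p).symm) y (chartField p Y y))
      (extChartAt (𝓡 n) p).target := by
    have hc : ContDiffOn ℝ ∞ (u ∘ (extChartAt (𝓡 n) p).symm) (extChartAt (𝓡 n) p).target :=
      (hu.comp_contMDiffOn (contMDiffOn_extChartAt_symm p)).contDiffOn
    exact (hc.continuousOn_fderiv_of_isOpen (isOpen_extChartAt_target p) (by simp)).clm_apply
      (contDiffOn_chartField p hY).continuousOn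
  have h2 := (h1.comp (continuousOn_extChartAt p) (extChartAt (𝓡 n) p).mapsTo).continuousAt
    (extChartAt_source_mem_nhds p)
  refine h2.congr ?_
  filter_upwards [extChartAt_source_mem_nhds (I := 𝓡 n) p] with x hx
  have := fderiv_comp_extChartAt_symm ((extChartAt (𝓡 n) p).map_source hx)
    (hu.mdifferentiable (by simp) _) Y
  simp only [Function.comp_apply]
  rw [this, (extChartAt (𝓡 n) p).left_inv hx]

variable [BorelSpace M]

/-- In the chart, with density `ρ`, the two integrands add up to `div (u ρ Y)` by the Leibniz rule.
The field `u ρ Y` extends by zero to a compactly supported field on the whole Euclidean space, so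
its divergence has integral zero. -/
theorem integral_mul_chartDiv (p : M)
    (hY : ContMDiff (𝓡 n) (𝓡 n).tangent ∞ (fun x => (⟨x, Y x⟩ : TangentBundle (𝓡 n) M)))
    {u : M → ℝ} (hu : ContMDiff (𝓡 n) 𝓘(ℝ, ℝ) ∞ u) (huc : HasCompactSupport u)
    (hus : tsupport u ⊆ (extChartAt (𝓡 n) p).source) :
    ∫ x, u x * vol.chartDiv p Y x ∂vol.toMeasure
      = - ∫ x, differential n u x (Y x) ∂vol.toMeasure := by
  have hS := (isOpen_extChartAt_source (I := 𝓡 n) p).measurableSet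
  have hT := isOpen_extChartAt_target (I := 𝓡 n) p
  have hz1 : ∀ x, x ∉ (extChartAt (𝓡 n) p).source → u x * vol.chartDiv p Y x = 0 := fun x hx => by
    rw [image_eq_zero_of_notMem_tsupport (fun h => hx (hus h)), zero_mul]
  have hd0 : ∀ x, x ∉ tsupport u → differential n u x (Y x) = 0 := fun x hx => by
    rw [differential_eq_zero_of_notMem_tsupport hx, zero_apply]
  rw [← setIntegral_eq_integral_of_forall_compl_eq_zero hz1,
    ← setIntegral_eq_integral_of_forall_compl_eq_zero (fun x hx => hd0 x (fun h => hx (hus h))),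
    vol.integral_source p (f := fun x => u x * vol.chartDiv p Y x)
      ((hu.continuous.continuousOn.mul (vol.continuousOn_chartDiv p hY)).aestronglyMeasurable hS),
    vol.integral_source p (continuous_differential_apply hu hY).aestronglyMeasurable]
  set K := extChartAt (𝓡 n) p '' tsupport u with hKdef
  have hK : IsCompact K := huc.isCompact.image_of_continuousOn ((continuousOn_extChartAt p).mono hus)
  have hKT : K ⊆ (extChartAt (𝓡 n) p).target :=
    image_subset_iff.2 fun x hx => (extChartAt (𝓡 n) p).map_source (hus hx)
  have hK0 : ∀ y ∈ (extChartAt (𝓡 n) p).target, y ∉ K →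
      (extChartAt (𝓡 n) p).symm y ∉ tsupport u := fun y hy hyK h =>
    hyK ⟨_, h, (extChartAt (𝓡 n) p).right_inv hy⟩
  have hc : ContDiffOn ℝ ∞ (u ∘ (extChartAt (𝓡 n) p).symm) (extChartAt (𝓡 n) p).target :=
    (hu.comp_contMDiffOn (contMDiffOn_extChartAt_symm p)).contDiffOn
  have hW := vol.contDiffOn_density_smul_chartField p hY
  have hz : ∀ y ∈ (extChartAt (𝓡 n) p).target, y ∉ K →
      (u ∘ (extChartAt (𝓡 n) p).symm) y • (vol.density p y • chartField p Y y) = 0 :=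
    fun y hy hyK => by
      rw [Function.comp_apply, image_eq_zero_of_notMem_tsupport (hK0 y hy hyK), zero_smul]
  have hZ : ContDiff ℝ ∞ ((extChartAt (𝓡 n) p).target.indicator fun y =>
      (u ∘ (extChartAt (𝓡 n) p).symm) y • (vol.density p y • chartField p Y y)) :=
    contDiff_indicator_of_isCompact hT hK hKT (hc.smul hW) hz
  have hZc := hasCompactSupport_indicator_of_isCompact hK hz
  have hcf := hc.continuousOn_fderiv_of_isOpen hT (by simp)
  have key := integral_eucDiv_eq_zero (hZ.of_le (by simp)) hZc
  have hsupp : ∀ y, y ∉ (extChartAt (𝓡 n) p).target →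
      eucDiv ((extChartAt (𝓡 n) p).target.indicator fun y =>
        (u ∘ (extChartAt (𝓡 n) p).symm) y • (vol.density p y • chartField p Y y)) y = 0 := by
    intro y hy
    have h : ((extChartAt (𝓡 n) p).target.indicator fun y =>
        (u ∘ (extChartAt (𝓡 n) p).symm) y • (vol.density p y • chartField p Y y))
        =ᶠ[𝓝 y] fun _ => 0 := by
      filter_upwards [hK.isClosed.isOpen_compl.mem_nhds (fun h => hy (hKT h))] with z hzK
      by_cases hzT : z ∈ (extChartAt (𝓡 n) p).target
      · rw [indicator_of_mem hzT, hz z hzT hzK]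
      · rw [indicator_of_notMem hzT]
    rw [eucDiv_congr h, eucDiv, fderiv_fun_const, Pi.zero_apply,
      ContinuousLinearMap.toLinearMap_zero, map_zero]
  rw [← setIntegral_eq_integral_of_forall_compl_eq_zero hsupp] at key
  have hint : ∀ {f : EuclideanSpace ℝ (Fin n) → ℝ},
      ContinuousOn f (extChartAt (𝓡 n) p).target →
      (∀ y ∈ (extChartAt (𝓡 n) p).target, y ∉ K → f y = 0) →
      IntegrableOn f (extChartAt (𝓡 n) p).target := fun {f} hf h0 => by
    have h1 : IntegrableOn f K := (hf.mono hKT).integrableOn_compact hK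
    exact h1.of_forall_sdiff_eq_zero hT.measurableSet fun y hy => h0 y hy.1 hy.2
  rw [← sub_eq_zero, sub_neg_eq_add, ← integral_add, ← key]
  · refine setIntegral_congr_fun hT.measurableSet fun y hy => ?_
    have h : ((extChartAt (𝓡 n) p).target.indicator fun y =>
        (u ∘ (extChartAt (𝓡 n) p).symm) y • (vol.density p y • chartField p Y y))
        =ᶠ[𝓝 y] fun y =>
          (u ∘ (extChartAt (𝓡 n) p).symm) y • (vol.density p y • chartField p Y y) := by
      filter_upwards [hT.mem_nhds hy] with z hz using indicator_of_mem hz _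
    have h2 := eucDiv_smul ((hc.contDiffAt (hT.mem_nhds hy)).differentiableAt (by simp))
      ((hW.contDiffAt (hT.mem_nhds hy)).differentiableAt (by simp))
    rw [eucDiv_congr h, h2, map_smul, fderiv_comp_extChartAt_symm hy (hu.mdifferentiable (by simp) _)]
    simp only [chartDiv, (extChartAt (𝓡 n) p).right_inv hy,
      Function.comp_apply, smul_eq_mul]
    have := (vol.density_pos p y hy).ne'
    field_simp
  · refine hint ((vol.continuousOn_density p).mul ((hc.continuousOn).mul
      ((vol.continuousOn_chartDiv p hY).comp (continuousOn_extChartAt_symm p)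
        (extChartAt (𝓡 n) p).symm.mapsTo))) fun y hy hyK => ?_
    rw [image_eq_zero_of_notMem_tsupport (hK0 y hy hyK), zero_mul, mul_zero]
  · refine hint ((vol.continuousOn_density p).mul
      ((continuous_differential_apply hu hY).comp_continuousOn (continuousOn_extChartAt_symm p)))
      fun y hy hyK => ?_
    rw [hd0 _ (hK0 y hy hyK), mul_zero]

omit [IsManifold (𝓡 n) ∞ M] in
-- Positivity of the density is what lets almost everywhere equalities of continuous functions be
-- upgraded to equalities everywhere.
theorem isOpenPosMeasure : vol.toMeasure.IsOpenPosMeasure := by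
  refine ⟨fun O hO ⟨x, hx⟩ h0 => ?_⟩
  have hm := vol.measure_eq x (O ∩ (extChartAt (𝓡 n) x).source)
    (hO.inter (isOpen_extChartAt_source x)).measurableSet inter_subset_right
  rw [measure_mono_null inter_subset_left h0, inter_comm, PartialEquiv.image_source_inter_eq'] at hm
  set T := (extChartAt (𝓡 n) x).target ∩ (extChartAt (𝓡 n) x).symm ⁻¹' O
  have hT : IsOpen T :=
    (continuousOn_extChartAt_symm x).isOpen_inter_preimage (isOpen_extChartAt_target x) hO
  have hmem : extChartAt (𝓡 n) x x ∈ T :=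
    ⟨mem_extChartAt_target x, by rwa [mem_preimage, extChartAt_to_inv]⟩
  have hae := (lintegral_eq_zero_iff' ((vol.aemeasurable_density x).mono_measure
    (Measure.restrict_mono inter_subset_left le_rfl))).1 hm.symm
  rw [Filter.EventuallyEq, ae_restrict_iff' hT.measurableSet] at hae
  refine (hT.measure_pos volume ⟨_, hmem⟩).ne' (measure_mono_null ?_ hae)
  intro y hy h
  have := vol.density_pos x y hy.1
  simpa [this.not_ge] using h hy

variable [T2Space M] [SigmaCompactSpace M]

/-- Independence of the chart, without Jacobians: both sides are adjoint to the derivative along `Y`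
for test functions supported in the overlap of the charts, so they agree almost everywhere there,
hence everywhere by continuity. This is needed because `divergence` uses a different chart at each
point. -/
theorem chartDiv_eq_divergence (p : M)
    (hY : ContMDiff (𝓡 n) (𝓡 n).tangent ∞ (fun x => (⟨x, Y x⟩ : TangentBundle (𝓡 n) M)))
    {x : M} (hx : x ∈ (extChartAt (𝓡 n) p).source) :
    vol.chartDiv p Y x = vol.divergence Y x := by
  rw [divergence_eq_chartDiv]
  have : vol.toMeasure.IsOpenPosMeasure := vol.isOpenPosMeasure
  have : IsLocallyFiniteMeasure vol.toMeasure := vol.isLocallyFiniteMeasure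
  have : LocallyCompactSpace M := ChartedSpace.locallyCompactSpace (EuclideanSpace ℝ (Fin n)) M
  set O := (extChartAt (𝓡 n) p).source ∩ (extChartAt (𝓡 n) x).source with hOdef
  have hO : IsOpen O := (isOpen_extChartAt_source p).inter (isOpen_extChartAt_source x)
  have hc1 := (vol.continuousOn_chartDiv p hY).mono (inter_subset_left : O ⊆ _)
  have hc2 := (vol.continuousOn_chartDiv x hY).mono (inter_subset_right : O ⊆ _)
  have hae : ∀ᵐ z ∂vol.toMeasure, z ∈ O → vol.chartDiv p Y z - vol.chartDiv x Y z = 0 := by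
    refine IsOpen.ae_eq_zero_of_integral_contMDiff_smul_eq_zero (𝓡 n) hO
      ((hc1.sub hc2).locallyIntegrableOn hO.measurableSet) fun g hg hgc hgs => ?_
    have hgi : ∀ {D : M → ℝ}, ContinuousOn D O → Integrable (fun z => g z * D z) vol.toMeasure :=
      fun {D} hD => by
        refine Continuous.integrable_of_hasCompactSupport ?_ hgc.mul_right
        refine continuous_of_tsupport fun z hz => ?_
        have hzO : z ∈ O := hgs (tsupport_mul_subset_left hz)
        exact hg.continuous.continuousAt.mul (hD.continuousAt (hO.mem_nhds hzO))
    simp only [smul_eq_mul, mul_sub]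
    rw [integral_sub (hgi hc1) (hgi hc2),
      vol.integral_mul_chartDiv p hY hg hgc (hgs.trans inter_subset_left),
      vol.integral_mul_chartDiv x hY hg hgc (hgs.trans inter_subset_right), sub_self]
  have hae' : vol.chartDiv p Y =ᵐ[vol.toMeasure.restrict O] vol.chartDiv x Y := by
    rw [Filter.EventuallyEq, ae_restrict_iff' hO.measurableSet]
    filter_upwards [hae] with z hz hzO using sub_eq_zero.1 (hz hzO)
  exact Measure.eqOn_open_of_ae_eq hae' hO hc1 hc2 ⟨hx, mem_extChartAt_source x⟩

theorem continuous_divergence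
    (hY : ContMDiff (𝓡 n) (𝓡 n).tangent ∞ (fun x => (⟨x, Y x⟩ : TangentBundle (𝓡 n) M))) :
    Continuous (vol.divergence Y) := by
  refine continuous_iff_continuousAt.2 fun p => ?_
  refine ((vol.continuousOn_chartDiv p hY).continuousAt
    (extChartAt_source_mem_nhds p)).congr ?_
  filter_upwards [extChartAt_source_mem_nhds (I := 𝓡 n) p] with x hx
    using vol.chartDiv_eq_divergence p hY hx

/-- **Divergence theorem**: `-div` is the formal adjoint of the derivative of functions. -/
theorem integral_mul_divergence
    (hY : ContMDiff (𝓡 n) (𝓡 n).tangent ∞ (fun x => (⟨x, Y x⟩ : TangentBundle (𝓡 n) M)))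
    {u : M → ℝ} (hu : ContMDiff (𝓡 n) 𝓘(ℝ, ℝ) ∞ u) (huc : HasCompactSupport u) :
    ∫ x, u x * vol.divergence Y x ∂vol.toMeasure
      = - ∫ x, differential n u x (Y x) ∂vol.toMeasure := by
  have : IsLocallyFiniteMeasure vol.toMeasure := vol.isLocallyFiniteMeasure
  obtain ⟨f, hf⟩ := SmoothPartitionOfUnity.exists_isSubordinate_chartAt_source (𝓡 n) M
  -- Only finitely many members of the partition of unity meet the compact support of `u`, so finite
  -- sums suffice.
  obtain ⟨I, hI⟩ : ∃ I : Finset M, ∀ x ∈ tsupport u, f.finsupport x ⊆ I := by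
    obtain ⟨I, hI⟩ := f.locallyFinite.finite_nonempty_inter_compact huc.isCompact |>.exists_finset
    refine ⟨I, fun x hx i hi => (hI i).2 ⟨x, ?_, hx⟩⟩
    exact (f.mem_finsupport x).1 hi
  have hsum : ∀ x ∈ tsupport u, ∑ i ∈ I, f i x = 1 := fun x hx =>
    f.sum_finsupport' x (mem_univ x) (hI x hx)
  have hus : u = fun x => ∑ i ∈ I, f i x * u x := by
    ext x
    by_cases hx : x ∈ tsupport u
    · rw [← Finset.sum_mul, hsum x hx, one_mul]
    · simp [image_eq_zero_of_notMem_tsupport hx]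
  have hfu : ∀ i, ContMDiff (𝓡 n) 𝓘(ℝ, ℝ) ∞ fun x => f i x * u x :=
    fun i => (f i).contMDiff.mul hu
  have hfc : ∀ i, HasCompactSupport fun x => f i x * u x := fun i => huc.mul_left
  have hfd : ∀ i, ∫ x, f i x * u x * vol.divergence Y x ∂vol.toMeasure
      = - ∫ x, differential n (fun x => f i x * u x) x (Y x) ∂vol.toMeasure := by
    intro i
    have hs : tsupport (fun x => f i x * u x) ⊆ (extChartAt (𝓡 n) i).source := by
      rw [extChartAt_source]
      exact (tsupport_mul_subset_left).trans (hf i)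
    rw [← vol.integral_mul_chartDiv i hY (hfu i) (hfc i) hs]
    refine integral_congr_ae (ae_of_all _ fun x => ?_)
    by_cases hx : x ∈ (extChartAt (𝓡 n) i).source
    · simp only [vol.chartDiv_eq_divergence i hY hx]
    · simp only [image_eq_zero_of_notMem_tsupport (f := fun x => f i x * u x)
        (fun h => hx (hs h)), zero_mul]
  have hd : ∀ x, differential n u x (Y x)
      = ∑ i ∈ I, differential n (fun x => f i x * u x) x (Y x) := by
    intro x
    conv_lhs => rw [hus]
    rw [(differential_sum I fun i _ => (hfu i).mdifferentiable (by simp) x).2,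
      sum_apply]
  have hcd : ∀ i, Integrable (fun x => differential n (fun x => f i x * u x) x (Y x))
      vol.toMeasure := by
    intro i
    refine (continuous_differential_apply (hfu i) hY).integrable_of_hasCompactSupport ?_
    refine HasCompactSupport.intro (hfc i).isCompact fun x hx => ?_
    rw [differential_eq_zero_of_notMem_tsupport hx, zero_apply]
  simp_rw [hd]
  rw [integral_finsetSum _ fun i _ => hcd i, ← Finset.sum_neg_distrib]
  simp_rw [← hfd]
  rw [← integral_finsetSum]
  · refine integral_congr_ae (ae_of_all _ fun x => ?_)
    conv_lhs => rw [hus]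
    simp only [Finset.sum_mul]
  · exact fun i _ => ((hfu i).continuous.mul
      (vol.continuous_divergence hY)).integrable_of_hasCompactSupport (hfc i).mul_right

end SmoothMeasure

end ChartDivergence

end CC

end

noncomputable section

namespace CC

/-! ### Smooth sections: dense families, measurability of norms, local frames. -/

section Sections

variable {n : ℕ} {M : Type*} [TopologicalSpace M] [ChartedSpace (EuclideanSpace ℝ (Fin n)) M]
  [IsManifold (𝓡 n) ∞ M] [T2Space M]
  {F : Type*} [NormedAddCommGroup F] [NormedSpace ℝ F]
  {U : M → Type*} [TopologicalSpace (TotalSpace F U)] [∀ x, NormedAddCommGroup (U x)]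
  [∀ x, InnerProductSpace ℝ (U x)] [FiberBundle F U] [VectorBundle ℝ F U]
  [ContMDiffVectorBundle ∞ F U (𝓡 n)]

variable (n F U) in
/-- Near `p`, vectors of the model fibre extend to global smooth sections that are constant in the
trivialization at `p`. -/
theorem exists_section_eq_symmL (p : M) :
    ∃ N : Set M, IsOpen N ∧ p ∈ N ∧ N ⊆ (trivializationAt F U p).baseSet ∧
      ∀ v : F, ∃ σ : Cₛ^∞⟮𝓡 n; F, U⟯, ∀ x ∈ N, σ x = (trivializationAt F U p).symmL ℝ x v := by
  set e := trivializationAt F U p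
  have hpe : p ∈ e.baseSet := FiberBundle.mem_baseSet_trivializationAt' p
  obtain ⟨f, -, hf⟩ := (SmoothBumpFunction.nhds_basis_tsupport (I := 𝓡 n) p).mem_iff.1
    (e.open_baseSet.mem_nhds hpe)
  obtain ⟨N, hN1, hNo, hpN⟩ := eventually_nhds_iff.1 f.eventuallyEq_one
  refine ⟨N ∩ e.baseSet, hNo.inter e.open_baseSet, ⟨hpN, hpe⟩, inter_subset_right, fun v => ?_⟩
  have hs : ContMDiffOn (𝓡 n) ((𝓡 n).prod 𝓘(ℝ, F)) ∞
      (fun x => TotalSpace.mk' F x (e.symmL ℝ x v)) e.baseSet := by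
    intro x hx
    rw [e.contMDiffWithinAt_section _ hx]
    refine (contMDiffWithinAt_const (c := v)).congr (fun y hy => ?_) ?_
    · simp [e.symmL_apply, hy]
    · simp [e.symmL_apply, hx]
  refine ⟨⟨_, ContMDiffOn.smul_section_of_tsupport (f.contMDiff.contMDiffOn) e.open_baseSet hf hs⟩,
    fun x hx => ?_⟩
  change f x • e.symmL ℝ x v = e.symmL ℝ x v
  rw [hN1 x hx.1]
  simp

variable (n F U) in
/-- There are countably many global smooth sections whose values are dense in each fibre. -/
theorem exists_dense_sections [SecondCountableTopology M] [FiniteDimensional ℝ F] :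
    ∃ S : ℕ → Cₛ^∞⟮𝓡 n; F, U⟯, ∀ x, DenseRange fun k => S k x := by
  choose N hNo hpN hNb σ hσ using exists_section_eq_symmL n F U (M := M)
  obtain ⟨s, hsc, hs⟩ := TopologicalSpace.countable_cover_nhds
    fun p => (hNo p).mem_nhds (hpN p)
  have hcs : Countable s := hsc
  rcases isEmpty_or_nonempty M with hM | ⟨⟨p0⟩⟩
  · exact ⟨fun _ => 0, fun x => (hM.false x).elim⟩
  obtain ⟨q0, hq0, -⟩ := mem_iUnion₂.1 (hs.symm ▸ mem_univ p0 : p0 ∈ ⋃ x ∈ s, N x)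
  have : Nonempty s := ⟨⟨q0, hq0⟩⟩
  have : TopologicalSpace.SeparableSpace F := inferInstance
  obtain ⟨g, hg⟩ := exists_surjective_nat (s × ℕ)
  refine ⟨fun k => σ (g k).1 (TopologicalSpace.denseSeq F (g k).2), fun x => ?_⟩
  obtain ⟨q, hq, hxq⟩ := mem_iUnion₂.1 (hs.symm ▸ mem_univ x : x ∈ ⋃ x ∈ s, N x)
  have hx := hNb q hxq
  have h1 : DenseRange fun i =>
      (trivializationAt F U q).symmL ℝ x (TopologicalSpace.denseSeq F i) := by
    refine DenseRange.comp ?_ (TopologicalSpace.denseRange_denseSeq F)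
      ((trivializationAt F U q).symmL ℝ x).continuous
    refine Function.Surjective.denseRange fun u => ⟨(trivializationAt F U q).continuousLinearMapAt ℝ x u, ?_⟩
    exact (trivializationAt F U q).symmL_continuousLinearMapAt hx u
  refine h1.mono ?_
  rintro _ ⟨i, rfl⟩
  obtain ⟨k, hk⟩ := hg (⟨q, hq⟩, i)
  refine ⟨k, ?_⟩
  simp only [hk]
  exact hσ q _ x hxq

variable (F) in
theorem finiteDimensional_fiber [FiniteDimensional ℝ F] (x : M) : FiniteDimensional ℝ (U x) :=
  ((trivializationAt F U x).continuousLinearEquivAt ℝ x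
    (FiberBundle.mem_baseSet_trivializationAt' x)).toLinearEquiv.symm.finiteDimensional

/-- If `G` is the Riesz representative of `L`, then `2 L v - ‖v‖² = ‖G‖² - ‖G - v‖²`, with supremum
`‖G‖²` over any dense set. The norm of a form is thus a countable supremum of expressions in
sections, which yields its measurability. -/
theorem enorm_sq_eq_iSup_of_denseRange {V : Type*} [NormedAddCommGroup V] [InnerProductSpace ℝ V]
    [CompleteSpace V] (L : V →L[ℝ] ℝ) {s : ℕ → V} (hs : DenseRange s) :
    ENNReal.ofReal (‖L‖ ^ 2) = ⨆ k, ENNReal.ofReal (2 * L (s k) - ‖s k‖ ^ 2) := by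
  set G := (InnerProductSpace.toDual ℝ V).symm L
  have hG : ∀ v, L v = inner ℝ G v := fun v =>
    (InnerProductSpace.toDual_symm_apply (𝕜 := ℝ)).symm
  have hn : ‖L‖ = ‖G‖ := ((InnerProductSpace.toDual ℝ V).symm.norm_map L).symm
  have hk : ∀ v, 2 * L v - ‖v‖ ^ 2 = ‖G‖ ^ 2 - ‖G - v‖ ^ 2 := fun v => by
    rw [norm_sub_sq_real, hG]; ring
  simp only [hk, hn]
  refine le_antisymm ?_ (iSup_le fun k => ENNReal.ofReal_le_ofReal
    (sub_le_self _ (sq_nonneg _)))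
  have hcont : Continuous fun v => ENNReal.ofReal (‖G‖ ^ 2 - ‖G - v‖ ^ 2) :=
    ENNReal.continuous_ofReal.comp (by fun_prop)
  have hcl : IsClosed {v | ENNReal.ofReal (‖G‖ ^ 2 - ‖G - v‖ ^ 2)
      ≤ ⨆ k, ENNReal.ofReal (‖G‖ ^ 2 - ‖G - s k‖ ^ 2)} := isClosed_le hcont continuous_const
  have := hs.induction_on (p := fun v => ENNReal.ofReal (‖G‖ ^ 2 - ‖G - v‖ ^ 2)
      ≤ ⨆ k, ENNReal.ofReal (‖G‖ ^ 2 - ‖G - s k‖ ^ 2)) G hcl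
    fun k => le_iSup (fun k => ENNReal.ofReal (‖G‖ ^ 2 - ‖G - s k‖ ^ 2)) k
  simpa using this

/-- A family of linear forms on the fibres has measurable norm if it is measurable on smooth
sections. -/
theorem aemeasurable_norm_dual [SecondCountableTopology M] [FiniteDimensional ℝ F]
    [MeasurableSpace M] [BorelSpace M] [IsContMDiffRiemannianBundle (𝓡 n) ∞ F U] {ν : Measure M}
    {L : ∀ x, U x →L[ℝ] ℝ}
    (hL : ∀ σ : Cₛ^∞⟮𝓡 n; F, U⟯, AEMeasurable (fun x => L x (σ x)) ν) :
    AEMeasurable (fun x => ‖L x‖) ν := by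
  obtain ⟨S, hS⟩ := exists_dense_sections n F U (M := M)
  have h : (fun x => ‖L x‖) = fun x => √(⨆ k, ENNReal.ofReal
      (2 * L x (S k x) - ‖S k x‖ ^ 2)).toReal := by
    ext x
    have := finiteDimensional_fiber F (U := U) x
    have : CompleteSpace (U x) := FiniteDimensional.complete ℝ _
    rw [← enorm_sq_eq_iSup_of_denseRange (L x) (hS x), ENNReal.toReal_ofReal (by positivity),
      Real.sqrt_sq (norm_nonneg _)]
  rw [h]
  refine (AEMeasurable.iSup fun k => ?_).ennreal_toReal.sqrt
  refine (((hL (S k)).const_mul 2).sub ?_).ennreal_ofReal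
  have hc : Continuous fun x => ‖S k x‖ ^ 2 := by
    simp_rw [← real_inner_self_eq_norm_sq]
    exact ((S k).contMDiff.inner_bundle (S k).contMDiff).continuous
  exact hc.measurable.aemeasurable

variable (n F U) in
/-- Local frames: norms of linear forms on the fibres near `p` are controlled by their values on
finitely many smooth sections. -/
theorem exists_frame [FiniteDimensional ℝ F] [IsContMDiffRiemannianBundle (𝓡 n) ∞ F U] (p : M) :
    ∃ (N : Set M) (d : ℕ) (σ : Fin d → Cₛ^∞⟮𝓡 n; F, U⟯) (c : ℝ), IsOpen N ∧ p ∈ N ∧ 0 < c ∧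
      (∀ x ∈ N, ∀ i, ‖σ i x‖ ≤ c) ∧
      ∀ x ∈ N, ∀ L : U x →L[ℝ] ℝ, ‖L‖ ≤ c * ∑ i, |L (σ i x)| := by
  have : IsContinuousRiemannianBundle F U := by
    obtain ⟨g, hg, hg'⟩ :=
      IsContMDiffRiemannianBundle.exists_contMDiff (IB := 𝓡 n) (n := ∞) (F := F) (E := U)
    exact ⟨g, hg.continuous, hg'⟩
  obtain ⟨N, hNo, hpN, hNb, hσ⟩ := exists_section_eq_symmL n F U p
  set e := trivializationAt F U p
  set b := Module.finBasis ℝ F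
  choose σ hσ using fun i => hσ (b i)
  obtain ⟨c1, hc1, h1⟩ := eventually_norm_trivializationAt_lt F U p
  obtain ⟨c2, hc2, h2⟩ := eventually_norm_symmL_trivializationAt_lt F U p
  obtain ⟨N', hN', hNo', hpN'⟩ := eventually_nhds_iff.1 (h1.and h2)
  set κ := ∑ i, ‖(b.coord i).toContinuousLinearMap‖ with hκ
  set β := ∑ i, ‖b i‖ with hβ
  have hκ0 : 0 ≤ κ := Finset.sum_nonneg fun _ _ => norm_nonneg _
  have hβ0 : 0 ≤ β := Finset.sum_nonneg fun _ _ => norm_nonneg _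
  -- One constant serves both bounds: `c2 * β` controls the sections, `c1 * κ` the coordinates of a
  -- vector in the frame, and `1` makes it positive.
  refine ⟨N ∩ N', _, σ, c2 * β + c1 * κ + 1, hNo.inter hNo', ⟨hpN, hpN'⟩, by positivity,
    fun x hx i => ?_, fun x hx L => ?_⟩
  · rw [hσ i x hx.1]
    calc ‖e.symmL ℝ x (b i)‖ ≤ c2 * β := by
          refine (ContinuousLinearMap.le_opNorm _ _).trans
            (mul_le_mul (hN' x hx.2).2.le ?_ (norm_nonneg _) hc2.le)
          exact Finset.single_le_sum (f := fun i => ‖b i‖) (fun _ _ => norm_nonneg _)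
            (Finset.mem_univ i)
      _ ≤ _ := by have := mul_nonneg hc1.le hκ0; linarith
  · set T := ∑ i, |L (σ i x)| with hT
    have hT0 : 0 ≤ T := Finset.sum_nonneg fun _ _ => abs_nonneg _
    have hb : ‖L‖ ≤ c1 * κ * T := by
      refine L.opNorm_le_bound (by positivity) fun u => ?_
      set y := e.continuousLinearMapAt ℝ x u
      have hu : u = ∑ i, b.repr y i • σ i x := by
        conv_lhs => rw [← e.symmL_continuousLinearMapAt (R := ℝ) (hNb hx.1) u,
          show e.continuousLinearMapAt ℝ x u = y from rfl, ← b.sum_repr y, map_sum]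
        exact Finset.sum_congr rfl fun i _ => by rw [map_smul, hσ i x hx.1]
      have hy : ‖y‖ ≤ c1 * ‖u‖ := (ContinuousLinearMap.le_opNorm _ _).trans
        (mul_le_mul_of_nonneg_right (hN' x hx.2).1.le (norm_nonneg _))
      rw [hu, map_sum, ← hu, Real.norm_eq_abs]
      calc |∑ i, L (b.repr y i • σ i x)| ≤ ∑ i, κ * (c1 * ‖u‖) * |L (σ i x)| := by
            refine (Finset.abs_sum_le_sum_abs _ _).trans (Finset.sum_le_sum fun i _ => ?_)
            rw [map_smul, smul_eq_mul, abs_mul]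
            refine mul_le_mul_of_nonneg_right ?_ (abs_nonneg _)
            calc |b.repr y i| = ‖(b.coord i).toContinuousLinearMap y‖ := rfl
              _ ≤ ‖(b.coord i).toContinuousLinearMap‖ * ‖y‖ := ContinuousLinearMap.le_opNorm _ _
              _ ≤ κ * (c1 * ‖u‖) := by
                refine mul_le_mul ?_ hy (norm_nonneg _) hκ0
                exact Finset.single_le_sum
                  (f := fun i => ‖(b.coord i).toContinuousLinearMap‖)
                  (fun _ _ => norm_nonneg _) (Finset.mem_univ i)
        _ = c1 * κ * T * ‖u‖ := by rw [← Finset.mul_sum]; ring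
    refine hb.trans (mul_le_mul_of_nonneg_right ?_ hT0)
    have := mul_nonneg hc2.le hβ0
    linarith

end Sections

end CC

end

noncomputable section

namespace CC

/-! ### Cutoffs, horizontal differential and its formal adjoint. -/

section Calculus

variable {n : ℕ} {M : Type*} [TopologicalSpace M] [ChartedSpace (EuclideanSpace ℝ (Fin n)) M]
  [IsManifold (𝓡 n) ∞ M] [T2Space M]

theorem contMDiff_mul_of_tsupport_subset {O : Set M} (hO : IsOpen O) {χ u : M → ℝ}
    (hχ : ContMDiff (𝓡 n) 𝓘(ℝ, ℝ) ∞ χ) (hs : tsupport χ ⊆ O)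
    (hu : ContMDiffOn (𝓡 n) 𝓘(ℝ, ℝ) ∞ u O) :
    ContMDiff (𝓡 n) 𝓘(ℝ, ℝ) ∞ fun x => χ x * u x := by
  refine contMDiff_of_tsupport fun x hx => ?_
  have hxO : x ∈ O := hs (tsupport_mul_subset_left hx)
  exact (hχ x).mul (hu.contMDiffAt (hO.mem_nhds hxO))

variable (n) in
theorem exists_cutoff [SigmaCompactSpace M] {K O : Set M} (hK : IsCompact K) (hO : IsOpen O)
    (hKO : K ⊆ O) :
    ∃ χ : M → ℝ, ContMDiff (𝓡 n) 𝓘(ℝ, ℝ) ∞ χ ∧ HasCompactSupport χ ∧ tsupport χ ⊆ O ∧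
      (∀ x, 0 ≤ χ x) ∧ (∀ x, χ x ≤ 1) ∧ ∀ᶠ x in 𝓝ˢ K, χ x = 1 := by
  have : LocallyCompactSpace M := ChartedSpace.locallyCompactSpace (EuclideanSpace ℝ (Fin n)) M
  obtain ⟨L, hL, hKL, hLO⟩ := exists_compact_between hK hO hKO
  obtain ⟨f, hf1, hf0, hf⟩ := exists_contMDiffMap_one_nhds_of_subset_interior (n := ⊤) (𝓡 n)
    hK.isClosed hKL
  have hs : tsupport f ⊆ L := closure_minimal
    (fun x hx => by_contra fun h => hx (hf0 x h)) hL.isClosed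
  exact ⟨f, f.contMDiff, HasCompactSupport.of_support_subset_isCompact hL
    (subset_closure.trans hs), hs.trans hLO, fun x => (hf x).1, fun x => (hf x).2, hf1⟩

/-- Multiplication by a bump function equal to `1` near the point reduces to functions smooth on all
of `M`. -/
theorem continuousOn_differential_apply {O : Set M} (hO : IsOpen O) {u : M → ℝ}
    (hu : ContMDiffOn (𝓡 n) 𝓘(ℝ, ℝ) ∞ u O) {Y : ∀ x : M, TangentSpace (𝓡 n) x}
    (hY : ContMDiff (𝓡 n) (𝓡 n).tangent ∞ (fun x => (⟨x, Y x⟩ : TangentBundle (𝓡 n) M))) :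
    ContinuousOn (fun x => differential n u x (Y x)) O := by
  refine fun x hx => ContinuousAt.continuousWithinAt ?_
  obtain ⟨f, -, hf⟩ := (SmoothBumpFunction.nhds_basis_tsupport (I := 𝓡 n) x).mem_iff.1
    (hO.mem_nhds hx)
  refine (SmoothMeasure.continuous_differential_apply
    (contMDiff_mul_of_tsupport_subset hO f.contMDiff hf hu) hY).continuousAt.congr ?_
  filter_upwards [eventually_eventually_nhds.2 f.eventuallyEq_one] with z hz
  have h : (fun x => f x * u x) =ᶠ[𝓝 z] u := by
    filter_upwards [hz] with y hy
    simp [hy]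
  rw [differential_congr h]

theorem SmoothMeasure.divergence_eq_zero [MeasurableSpace M] (vol : SmoothMeasure n M)
    {Y : ∀ x : M, TangentSpace (𝓡 n) x} {x : M} (h : ∀ᶠ z in 𝓝 x, Y z = 0) :
    vol.divergence Y x = 0 := by
  rw [vol.divergence_eq_chartDiv, chartDiv]
  have hc : Tendsto (extChartAt (𝓡 n) x).symm (𝓝 (extChartAt (𝓡 n) x x)) (𝓝 x) := by
    have := continuousAt_extChartAt_symm (I := 𝓡 n) x
    rwa [ContinuousAt, extChartAt_to_inv] at this
  have h0 : (fun y => vol.density x y • chartField x Y y)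
      =ᶠ[𝓝 (extChartAt (𝓡 n) x x)] fun _ => 0 := by
    filter_upwards [hc.eventually h] with y hy
    have h1 : chartField x Y y = 0 := by
      rw [chartField, VectorField.mpullback_apply, hy, map_zero]
      rfl
    rw [h1, smul_zero]
  rw [eucDiv_congr h0, eucDiv, fderiv_fun_const, Pi.zero_apply,
    ContinuousLinearMap.toLinearMap_zero, map_zero, zero_div]

end Calculus

section HorizontalDifferential

variable {n : ℕ} {M : Type*} [TopologicalSpace M] [ChartedSpace (EuclideanSpace ℝ (Fin n)) M]
  [IsManifold (𝓡 n) ∞ M] [MeasurableSpace M]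
  {F : Type*} [NormedAddCommGroup F] [NormedSpace ℝ F]
  {U : M → Type*} [TopologicalSpace (TotalSpace F U)] [∀ x, NormedAddCommGroup (U x)]
  [∀ x, InnerProductSpace ℝ (U x)] [FiberBundle F U] [VectorBundle ℝ F U]

namespace CCSpace

variable (C : CCSpace n M F U)

/-- The horizontal differential of a function. -/
def hd (u : M → ℝ) (x : M) : U x →L[ℝ] ℝ := (differential n u x).comp (C.anchor x)

theorem hd_apply (u : M → ℝ) (x : M) (v : U x) : C.hd u x v = differential n u x (C.anchor x v) :=
  rfl

theorem hd_congr {u v : M → ℝ} {x : M} (h : u =ᶠ[𝓝 x] v) : C.hd u x = C.hd v x := by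
  rw [hd, hd, differential_congr h]

theorem hd_eq_zero_of_notMem_tsupport {u : M → ℝ} {x : M} (hx : x ∉ tsupport u) :
    C.hd u x = 0 := by
  rw [hd, differential_eq_zero_of_notMem_tsupport hx, ContinuousLinearMap.zero_comp]

theorem hd_comp {g : ℝ → ℝ} {u : M → ℝ} {x : M} (hg : DifferentiableAt ℝ g (u x))
    (hu : MDifferentiableAt (𝓡 n) 𝓘(ℝ, ℝ) u x) :
    C.hd (fun z => g (u z)) x = deriv g (u x) • C.hd u x := by
  rw [hd, differential_comp hg hu, ContinuousLinearMap.smul_comp, hd]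

theorem hd_mul {u v : M → ℝ} {x : M} (hu : MDifferentiableAt (𝓡 n) 𝓘(ℝ, ℝ) u x)
    (hv : MDifferentiableAt (𝓡 n) 𝓘(ℝ, ℝ) v x) :
    C.hd (fun z => u z * v z) x = u x • C.hd v x + v x • C.hd u x := by
  rw [hd, differential_mul hu hv, ContinuousLinearMap.add_comp, ContinuousLinearMap.smul_comp,
    ContinuousLinearMap.smul_comp, hd, hd]

theorem hd_sub {u v : M → ℝ} {x : M} (hu : MDifferentiableAt (𝓡 n) 𝓘(ℝ, ℝ) u x)
    (hv : MDifferentiableAt (𝓡 n) 𝓘(ℝ, ℝ) v x) :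
    C.hd (fun z => u z - v z) x = C.hd u x - C.hd v x := by
  rw [hd, differential_sub hu hv, ContinuousLinearMap.sub_comp, hd, hd]

theorem contMDiff_anchor_comp (φ : Cₛ^∞⟮𝓡 n; F, U⟯) :
    ContMDiff (𝓡 n) (𝓡 n).tangent ∞
      (fun x => (⟨x, C.anchor x (φ x)⟩ : TangentBundle (𝓡 n) M)) :=
  C.contMDiff_anchor.comp φ.contMDiff

variable [T2Space M]

theorem continuousOn_hd_apply {O : Set M} (hO : IsOpen O) {u : M → ℝ}
    (hu : ContMDiffOn (𝓡 n) 𝓘(ℝ, ℝ) ∞ u O) (φ : Cₛ^∞⟮𝓡 n; F, U⟯) :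
    ContinuousOn (fun x => C.hd u x (φ x)) O :=
  continuousOn_differential_apply hO hu (C.contMDiff_anchor_comp φ)

theorem aemeasurable_norm_hd [SecondCountableTopology M] [FiniteDimensional ℝ F] [BorelSpace M]
    [ContMDiffVectorBundle ∞ F U (𝓡 n)] [IsContMDiffRiemannianBundle (𝓡 n) ∞ F U]
    {O : Set M} (hO : IsOpen O) {u : M → ℝ} (hu : ContMDiffOn (𝓡 n) 𝓘(ℝ, ℝ) ∞ u O)
    (ν : Measure M) : AEMeasurable (fun x => ‖C.hd u x‖) (ν.restrict O) :=
  aemeasurable_norm_dual fun σ => (C.continuousOn_hd_apply hO hu σ).aemeasurable hO.measurableSet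

theorem adjointGrad_eq_zero {φ : Cₛ^∞⟮𝓡 n; F, U⟯} {x : M} (hx : x ∉ closure {x | φ x ≠ 0}) :
    C.adjointGrad φ x = 0 := by
  rw [adjointGrad, C.vol.divergence_eq_zero, neg_zero]
  filter_upwards [isClosed_closure.isOpen_compl.mem_nhds hx] with z hz
  have : φ z = 0 := by_contra fun h => hz (subset_closure h)
  rw [this, map_zero]

variable [BorelSpace M] [SigmaCompactSpace M]

theorem continuous_adjointGrad (φ : Cₛ^∞⟮𝓡 n; F, U⟯) : Continuous (C.adjointGrad φ) :=
  (C.vol.continuous_divergence (C.contMDiff_anchor_comp φ)).neg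

/-- A cutoff equal to `1` near the support of `φ` turns `w` into a compactly supported smooth
function on `M`, to which the divergence theorem applies. Neither integral sees the change. -/
theorem integral_mul_adjointGrad {Ω : Set M} (hΩ : IsOpen Ω) {w : M → ℝ}
    (hw : ContMDiffOn (𝓡 n) 𝓘(ℝ, ℝ) ∞ w Ω) {φ : Cₛ^∞⟮𝓡 n; F, U⟯} (hφ : IsTestSection Ω φ) :
    ∫ x in Ω, w x * C.adjointGrad φ x ∂C.μ = ∫ x in Ω, C.hd w x (φ x) ∂C.μ := by
  obtain ⟨χ, hχ, hχc, hχs, -, -, hχ1⟩ := exists_cutoff n hφ.1 hΩ hφ.2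
  have hu := contMDiff_mul_of_tsupport_subset hΩ hχ hχs hw
  have h := C.vol.integral_mul_divergence (C.contMDiff_anchor_comp φ) hu hχc.mul_right
  have hφ0 : ∀ x, x ∉ closure {x | φ x ≠ 0} → φ x = 0 := fun x hx =>
    by_contra fun h => hx (subset_closure h)
  rw [setIntegral_eq_integral_of_forall_compl_eq_zero fun x hx => by
      rw [C.adjointGrad_eq_zero fun h => hx (hφ.2 h), mul_zero],
    setIntegral_eq_integral_of_forall_compl_eq_zero fun x hx => by
      rw [hφ0 x fun h => hx (hφ.2 h), map_zero]]
  rw [← neg_eq_iff_eq_neg, ← integral_neg] at h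
  refine Eq.trans (integral_congr_ae (ae_of_all _ fun x => ?_))
    (h.trans (integral_congr_ae (ae_of_all _ fun x => ?_)))
  · by_cases hx : x ∈ closure {x | φ x ≠ 0}
    · simp only [adjointGrad, hχ1.self_of_nhdsSet x hx]; ring
    · have := C.adjointGrad_eq_zero hx
      simp only [adjointGrad, neg_eq_zero] at this ⊢
      rw [this]; ring
  · by_cases hx : x ∈ closure {x | φ x ≠ 0}
    · have he : (fun x => χ x * w x) =ᶠ[𝓝 x] w := by
        filter_upwards [nhds_le_nhdsSet hx hχ1] with z hz
        simp [hz]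
      simp only [differential_congr he, hd_apply]
    · simp only [hφ0 x hx, map_zero]

end CCSpace

end HorizontalDifferential

end CC

end

noncomputable section

/-! ### The coarea inequality. -/

namespace CC

/-- A smooth approximation of the Heaviside function at `t`, whose derivative is at most
`1 / (2 r)` and vanishes away from distance `R` of `t`. -/
theorem exists_smooth_step (t : ℝ) {r R : ℝ} (hr : 0 < r) (hrR : r < R) :
    ∃ B : ℝ → ℝ, ContDiff ℝ ∞ B ∧ (∀ s, 0 ≤ B s ∧ B s ≤ 1) ∧ (∀ s, s ≤ t - R → B s = 0) ∧
      (∀ s, t + R ≤ s → B s = 1) ∧ (∀ s, 0 ≤ deriv B s) ∧ (∀ s, deriv B s ≤ 1 / (2 * r)) ∧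
      ∀ s, s ∉ Metric.closedBall t R → deriv B s = 0 := by
  set f : ContDiffBump t := ⟨r, R, hr, hrR⟩ with hf
  set b := f.normed volume with hb
  have hbc : Continuous b := f.continuous_normed
  have hbs : ∀ s, s ∉ Metric.closedBall t R → b s = 0 := fun s hs =>
    image_eq_zero_of_notMem_tsupport (by rwa [f.tsupport_normed_eq])
  have hb0 : ∀ s, 0 ≤ b s := fun s => f.nonneg_normed s
  set B : ℝ → ℝ := fun s => ∫ x in (t - R)..s, b x with hB
  have hd : ∀ s, HasDerivAt B (b s) s := fun s =>
    intervalIntegral.integral_hasDerivAt_right (hbc.intervalIntegrable _ _)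
      (hbc.stronglyMeasurableAtFilter _ _) hbc.continuousAt
  have hmono : Monotone B := monotone_of_deriv_nonneg (fun s => (hd s).differentiableAt)
    fun s => by rw [(hd s).deriv]; exact hb0 s
  have hlow : ∀ s, s ≤ t - R → B s = 0 := by
    intro s hs
    rw [hB]
    simp only
    rw [intervalIntegral.integral_symm, intervalIntegral.integral_of_le hs,
      integral_Ioc_eq_integral_Ioo, neg_eq_zero]
    refine setIntegral_eq_zero_of_forall_eq_zero fun x hx => hbs x ?_
    rw [Metric.mem_closedBall, Real.dist_eq, not_le, lt_abs]
    right; linarith [hx.2]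
  have hhigh : ∀ s, t + R ≤ s → B s = 1 := by
    intro s hs
    have h1 : ∫ x, b x = 1 := f.integral_normed
    have hR : 0 < R := hr.trans hrR
    rw [hB]
    simp only
    rw [intervalIntegral.integral_of_le (by linarith), ← integral_Icc_eq_integral_Ioc, ← h1]
    refine setIntegral_eq_integral_of_forall_compl_eq_zero fun x hx => hbs x fun h => hx ?_
    rw [Real.closedBall_eq_Icc] at h
    exact ⟨h.1, h.2.trans hs⟩
  refine ⟨B, ?_, fun s => ⟨?_, ?_⟩, hlow, hhigh, fun s => ?_, fun s => ?_, fun s hs => ?_⟩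
  · refine contDiff_infty_iff_deriv.2 ⟨fun s => (hd s).differentiableAt, ?_⟩
    rw [show deriv B = b from funext fun s => (hd s).deriv]
    exact f.contDiff_normed
  · rw [← hlow _ (min_le_left (t - R) s)]
    exact hmono (min_le_right _ _)
  · rw [← hhigh _ (le_max_left (t + R) s)]
    exact hmono (le_max_right _ _)
  · rw [(hd s).deriv]; exact hb0 s
  · rw [(hd s).deriv]
    -- The bump before normalization takes values in `[0, 1]` and equals `1` on an interval of
    -- length `2r`, so its integral is at least `2r`.
    refine (f.normed_le_div_measure_closedBall_rIn volume s).trans_eq ?_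
    rw [Real.volume_real_closedBall (show 0 ≤ f.rIn from hr.le)]
  · rw [(hd s).deriv, hbs s hs]

theorem sigmaCompactSpace_of_secondCountable (n : ℕ) (M : Type*) [TopologicalSpace M]
    [ChartedSpace (EuclideanSpace ℝ (Fin n)) M] [SecondCountableTopology M] :
    SigmaCompactSpace M := by
  have : LocallyCompactSpace M := ChartedSpace.locallyCompactSpace (EuclideanSpace ℝ (Fin n)) M
  infer_instance

theorem ofReal_integral_le_lintegral_ofReal {α : Type*} [MeasurableSpace α] {ν : Measure α}
    (f : α → ℝ) : ENNReal.ofReal (∫ x, f x ∂ν) ≤ ∫⁻ x, ENNReal.ofReal (f x) ∂ν := by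
  by_cases hf : Integrable f ν
  · rw [integral_eq_lintegral_pos_part_sub_lintegral_neg_part hf]
    exact (ENNReal.ofReal_le_ofReal (sub_le_self _ ENNReal.toReal_nonneg)).trans
      ENNReal.ofReal_toReal_le
  · rw [integral_undef hf, ENNReal.ofReal_zero]
    exact zero_le

section Coarea

variable {n : ℕ} {M : Type*} [TopologicalSpace M] [ChartedSpace (EuclideanSpace ℝ (Fin n)) M]
  [IsManifold (𝓡 n) ∞ M] [MeasurableSpace M] [T2Space M] [BorelSpace M]
  [SecondCountableTopology M]
  {F : Type*} [NormedAddCommGroup F] [NormedSpace ℝ F] [FiniteDimensional ℝ F]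
  {U : M → Type*} [TopologicalSpace (TotalSpace F U)] [∀ x, NormedAddCommGroup (U x)]
  [∀ x, InnerProductSpace ℝ (U x)] [FiberBundle F U] [VectorBundle ℝ F U]
  [ContMDiffVectorBundle ∞ F U (𝓡 n)] [IsContMDiffRiemannianBundle (𝓡 n) ∞ F U]

namespace CCSpace

variable (C : CCSpace n M F U)

/-- The distribution on the line of the horizontal energy of `w` along its values. -/
def levelEnergy (w : M → ℝ) (Ω : Set M) : Measure ℝ :=
  ((C.μ.restrict Ω).withDensity fun x => ‖C.hd w x‖ₑ).map w

theorem levelEnergy_univ {Ω : Set M} (w : M → ℝ) (hw : Measurable w) :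
    C.levelEnergy w Ω univ = ∫⁻ x in Ω, ‖C.hd w x‖ₑ ∂C.μ := by
  rw [levelEnergy, Measure.map_apply hw MeasurableSet.univ, preimage_univ,
    withDensity_apply _ MeasurableSet.univ, Measure.restrict_univ]

theorem integrable_adjointGrad {Ω : Set M} {φ : Cₛ^∞⟮𝓡 n; F, U⟯} (hφ : IsTestSection Ω φ) :
    Integrable (C.adjointGrad φ) C.μ := by
  have := sigmaCompactSpace_of_secondCountable n M
  have : IsLocallyFiniteMeasure C.μ := C.vol.isLocallyFiniteMeasure
  exact (C.continuous_adjointGrad φ).integrable_of_hasCompactSupport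
    (HasCompactSupport.intro hφ.1 fun x hx => C.adjointGrad_eq_zero hx)

/-- Integration by parts and the chain rule lead to the integral of `B'(w) dw(φ)`, where `B' ≤
1/(2r)` vanishes off the ball of radius `R` about `t`. The factor `R / r` exchanges `1/(2r)` for the
reciprocal of the length `2R` of that ball, so that a differentiation quotient of `levelEnergy`
appears. -/
theorem ofReal_integral_step_le {Ω : Set M} (hΩ : IsOpen Ω) {w : M → ℝ}
    (hw : ContMDiff (𝓡 n) 𝓘(ℝ, ℝ) ∞ w) {φ : Cₛ^∞⟮𝓡 n; F, U⟯} (hφ : IsTestSection Ω φ) (hφ1 : ∀ x, ‖φ x‖ ≤ 1) {t r R : ℝ} (hr : 0 < r)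
    (hrR : r < R) {B : ℝ → ℝ} (hB : ContDiff ℝ ∞ B) (hB0 : ∀ s, 0 ≤ deriv B s)
    (hBr : ∀ s, deriv B s ≤ 1 / (2 * r)) (hBR : ∀ s, s ∉ Metric.closedBall t R → deriv B s = 0) :
    ENNReal.ofReal (∫ x in Ω, B (w x) * C.adjointGrad φ x ∂C.μ)
      ≤ ENNReal.ofReal (R / r) *
        (C.levelEnergy w Ω (Metric.closedBall t R) / volume (Metric.closedBall t R)) := by
  have := sigmaCompactSpace_of_secondCountable n M
  have hBw : ContMDiff (𝓡 n) 𝓘(ℝ, ℝ) ∞ fun x => B (w x) := hB.contMDiff.comp hw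
  have hR : 0 < R := hr.trans hrR
  have hm := C.aemeasurable_norm_hd hΩ hw.contMDiffOn C.μ
  have hwm : Measurable w := hw.continuous.measurable
  have hrhs : ENNReal.ofReal (R / r) *
        (C.levelEnergy w Ω (Metric.closedBall t R) / volume (Metric.closedBall t R))
      = ENNReal.ofReal (1 / (2 * r)) * C.levelEnergy w Ω (Metric.closedBall t R) := by
    rw [Real.volume_closedBall, div_eq_mul_inv (C.levelEnergy w Ω _), mul_comm _ (_)⁻¹, ← mul_assoc,
      ← ENNReal.ofReal_inv_of_pos (by positivity), ← ENNReal.ofReal_mul (by positivity)]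
    congr 2
    field_simp
  rw [hrhs, C.integral_mul_adjointGrad hΩ hBw.contMDiffOn hφ]
  calc ENNReal.ofReal (∫ x in Ω, C.hd (fun z => B (w z)) x (φ x) ∂C.μ)
      ≤ ∫⁻ x in Ω, ENNReal.ofReal (C.hd (fun z => B (w z)) x (φ x)) ∂C.μ := by
        exact ofReal_integral_le_lintegral_ofReal _
    _ ≤ ∫⁻ x in Ω, (w ⁻¹' Metric.closedBall t R).indicator
          (fun x => ENNReal.ofReal (1 / (2 * r)) * ‖C.hd w x‖ₑ) x ∂C.μ := by
        refine lintegral_mono fun x => ?_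
        rw [C.hd_comp (hB.differentiable (by simp) _) (hw.mdifferentiable (by simp) x)]
        by_cases hx : x ∈ w ⁻¹' Metric.closedBall t R
        · rw [indicator_of_mem hx, ← ofReal_norm, ← ENNReal.ofReal_mul (by positivity)]
          refine ENNReal.ofReal_le_ofReal ?_
          rw [smul_apply, smul_eq_mul]
          calc deriv B (w x) * C.hd w x (φ x) ≤ deriv B (w x) * ‖C.hd w x‖ := by
                refine mul_le_mul_of_nonneg_left ((le_abs_self _).trans ?_) (hB0 _)
                exact ((C.hd w x).le_opNorm _).trans
                  (mul_le_of_le_one_right (norm_nonneg _) (hφ1 x))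
            _ ≤ 1 / (2 * r) * ‖C.hd w x‖ :=
                mul_le_mul_of_nonneg_right (hBr _) (norm_nonneg _)
        · rw [hBR _ hx]
          simp
    _ = ENNReal.ofReal (1 / (2 * r)) * C.levelEnergy w Ω (Metric.closedBall t R) := by
        have hs : MeasurableSet (w ⁻¹' Metric.closedBall t R) :=
          hwm Metric.isClosed_closedBall.measurableSet
        rw [lintegral_indicator hs, lintegral_const_mul', levelEnergy,
          Measure.map_apply hwm Metric.isClosed_closedBall.measurableSet, withDensity_apply _ hs]
        exact ENNReal.ofReal_ne_top

/-- **Coarea inequality**: almost every superlevel set of a smooth function has perimeter at most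
the density of the level energy. -/
theorem ae_horizontalPerimeter_le_rnDeriv {Ω : Set M} (hΩ : IsOpen Ω) (hμ : C.μ Ω < ⊤) {w : M → ℝ}
    (hw : ContMDiff (𝓡 n) 𝓘(ℝ, ℝ) ∞ w) (hfin : ∫⁻ x in Ω, ‖C.hd w x‖ₑ ∂C.μ < ⊤) :
    ∀ᵐ t : ℝ, C.horizontalPerimeter (Ω ∩ {x | t < w x}) Ω
      ≤ (C.levelEnergy w Ω).rnDeriv volume t := by
  have := sigmaCompactSpace_of_secondCountable n M
  have hwm : Measurable w := hw.continuous.measurable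
  have hfm : IsFiniteMeasure (C.levelEnergy w Ω) := ⟨by rwa [C.levelEnergy_univ w hwm]⟩
  have : IsFiniteMeasure (C.μ.restrict Ω) := ⟨by rwa [Measure.restrict_apply_univ]⟩
  -- A finite measure charges at most countably many levels. For the other `t` the steps converge to
  -- the indicator almost everywhere.
  have hcount := (Measure.countable_meas_level_set_pos (μ := C.μ.restrict Ω) hwm).ae_notMem volume
  filter_upwards [Besicovitch.ae_tendsto_rnDeriv (C.levelEnergy w Ω) volume, hcount] with t ht ht0
  have hlev : ∀ᵐ x ∂(C.μ.restrict Ω), w x ≠ t := by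
    simpa [ae_iff] using ht0
  refine iSup₂_le fun φ hφ => ?_
  -- The radii shrink to `0` while their ratio tends to `1`, so the factor `R k / r k` disappears in
  -- the limit.
  set R : ℕ → ℝ := fun k => 1 / ((k : ℝ) + 1) with hRdef
  set r : ℕ → ℝ := fun k => R k * (((k : ℝ) + 1) / ((k : ℝ) + 1 + 1)) with hrdef
  have hR0 : ∀ k, 0 < R k := fun k => by positivity
  have hr0 : ∀ k, 0 < r k := fun k => by positivity
  have hrR : ∀ k, r k < R k := fun k => by
    refine mul_lt_of_lt_one_right (hR0 k) ?_
    rw [div_lt_one (by positivity)]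
    linarith
  have hRlim : Tendsto R atTop (𝓝 0) := tendsto_one_div_add_atTop_nhds_zero_nat
  have hratio : Tendsto (fun k => R k / r k) atTop (𝓝 1) := by
    have h : (fun k => R k / r k) = fun k => 1 + R k := by
      ext k
      simp only [hrdef, hRdef]
      field_simp
    rw [h]
    simpa using hRlim.const_add 1
  have hRlim' : Tendsto R atTop (𝓝[>] 0) :=
    tendsto_nhdsWithin_iff.2 ⟨hRlim, Eventually.of_forall hR0⟩
  choose B hB hB01 hBlow hBhigh hB0 hBr hBR using fun k => exists_smooth_step t (hr0 k) (hrR k)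
  have hadj := C.integrable_adjointGrad hφ.1
  have hlim : Tendsto (fun k => ∫ x in Ω, B k (w x) * C.adjointGrad φ x ∂C.μ) atTop
      (𝓝 (∫ x in Ω, (Ω ∩ {x | t < w x}).indicator (fun _ => (1 : ℝ)) x *
        C.adjointGrad φ x ∂C.μ)) := by
    refine tendsto_integral_of_dominated_convergence (fun x => |C.adjointGrad φ x|)
      (fun k => ?_) hadj.abs.restrict (fun k => ae_of_all _ fun x => ?_) ?_
    · exact (((hB k).continuous.comp hw.continuous).mul
        (C.continuous_adjointGrad φ)).aestronglyMeasurable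
    · rw [Real.norm_eq_abs, abs_mul, abs_of_nonneg (hB01 k _).1]
      exact mul_le_of_le_one_left (abs_nonneg _) (hB01 k _).2
    · filter_upwards [hlev, ae_restrict_mem hΩ.measurableSet] with x hx hxΩ
      refine Tendsto.mul_const _ ?_
      rcases lt_or_gt_of_ne hx with h | h
      · rw [indicator_of_notMem (fun h' => absurd h'.2 h.not_gt)]
        refine tendsto_const_nhds.congr' ?_
        filter_upwards [hRlim.eventually (gt_mem_nhds (sub_pos.2 h))] with k hk
        rw [hBlow k _ (by linarith)]
      · rw [indicator_of_mem (show x ∈ Ω ∩ {x | t < w x} from ⟨hxΩ, h⟩)]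
        refine tendsto_const_nhds.congr' ?_
        filter_upwards [hRlim.eventually (gt_mem_nhds (sub_pos.2 h))] with k hk
        rw [hBhigh k _ (by linarith)]
  have hlim2 := (ENNReal.continuous_ofReal.tendsto _).comp hlim
  have hlim3 : Tendsto (fun k => ENNReal.ofReal (R k / r k) *
      (C.levelEnergy w Ω (Metric.closedBall t (R k)) / volume (Metric.closedBall t (R k)))) atTop
      (𝓝 (ENNReal.ofReal 1 * (C.levelEnergy w Ω).rnDeriv volume t)) := by
    refine ENNReal.Tendsto.mul ((ENNReal.continuous_ofReal.tendsto _).comp hratio) ?_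
      (ht.comp hRlim') ?_
    · simp
    · simp
  rw [ENNReal.ofReal_one, one_mul] at hlim3
  exact le_of_tendsto_of_tendsto' hlim2 hlim3 fun k =>
    C.ofReal_integral_step_le hΩ hw hφ.1 hφ.2 (hr0 k) (hrR k) (hB k) (hB0 k) (hBr k) (hBR k)

/-- An isoperimetric inequality for almost all superlevel sets of `w` integrates to an
inequality for `w`. -/
theorem mul_lintegral_le_lintegral_hd {Ω : Set M} (hΩ : IsOpen Ω) (hμ : C.μ Ω < ⊤) {w : M → ℝ}
    (hw : ContMDiff (𝓡 n) 𝓘(ℝ, ℝ) ∞ w) (hw0 : ∀ x, 0 ≤ w x) {c : ℝ≥0∞} 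
    (hc : ∀ᵐ t : ℝ, 0 < t → c * C.μ (Ω ∩ {x | t < w x})
      ≤ C.horizontalPerimeter (Ω ∩ {x | t < w x}) Ω) :
    c * ∫⁻ x in Ω, ENNReal.ofReal (w x) ∂C.μ ≤ ∫⁻ x in Ω, ‖C.hd w x‖ₑ ∂C.μ := by
  rcases eq_or_lt_of_le (le_top (a := ∫⁻ x in Ω, ‖C.hd w x‖ₑ ∂C.μ)) with htop | hfin
  · rw [htop]; exact le_top
  have hwm : Measurable w := hw.continuous.measurable
  have hanti : Antitone fun t : ℝ => C.μ.restrict Ω {x | t < w x} := fun s t hst =>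
    measure_mono fun x hx => lt_of_le_of_lt hst hx
  -- Layer-cake formula; the measure of the superlevel set is monotone in `t`, hence measurable.
  rw [lintegral_eq_lintegral_meas_lt _ (ae_of_all _ hw0) hwm.aemeasurable,
    ← lintegral_const_mul _ hanti.measurable]
  calc ∫⁻ t in Ioi 0, c * C.μ.restrict Ω {x | t < w x}
      ≤ ∫⁻ t in Ioi 0, (C.levelEnergy w Ω).rnDeriv volume t := by
        refine lintegral_mono_ae ?_
        rw [ae_restrict_iff' measurableSet_Ioi]
        filter_upwards [hc, C.ae_horizontalPerimeter_le_rnDeriv hΩ hμ hw hfin] with t h1 h2 ht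
        rw [Measure.restrict_apply (measurableSet_lt measurable_const hwm), inter_comm]
        exact (h1 ht).trans h2
    _ ≤ ∫⁻ t, (C.levelEnergy w Ω).rnDeriv volume t := setLIntegral_le_lintegral _ _
    -- Only the absolutely continuous part of `levelEnergy` enters; dropping a singular part goes in
    -- the right direction.
    _ ≤ C.levelEnergy w Ω univ := Measure.lintegral_rnDeriv_le
    _ = _ := C.levelEnergy_univ w hwm

end CCSpace

end Coarea

end CC

end

noncomputable section

namespace CC

/-! ### Weak horizontal gradients of smooth functions. -/

section WeakGradient

variable {n : ℕ} {M : Type*} [TopologicalSpace M] [ChartedSpace (EuclideanSpace ℝ (Fin n)) M]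
  [IsManifold (𝓡 n) ∞ M] [MeasurableSpace M] [T2Space M] [BorelSpace M]
  [SecondCountableTopology M]
  {F : Type*} [NormedAddCommGroup F] [NormedSpace ℝ F] [FiniteDimensional ℝ F]
  {U : M → Type*} [TopologicalSpace (TotalSpace F U)] [∀ x, NormedAddCommGroup (U x)]
  [∀ x, InnerProductSpace ℝ (U x)] [FiberBundle F U] [VectorBundle ℝ F U]
  [ContMDiffVectorBundle ∞ F U (𝓡 n)] [IsContMDiffRiemannianBundle (𝓡 n) ∞ F U]

theorem continuous_norm_section (σ : Cₛ^∞⟮𝓡 n; F, U⟯) : Continuous fun x => ‖σ x‖ := by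
  have hc : Continuous fun x => ‖σ x‖ ^ 2 := by
    simp_rw [← real_inner_self_eq_norm_sq]
    exact (σ.contMDiff.inner_bundle σ.contMDiff).continuous
  simpa [Real.sqrt_sq (norm_nonneg _)] using hc.sqrt

namespace CCSpace

variable {C : CCSpace n M F U}

theorem IsHorizontalGradient.aemeasurable_norm {Ω : Set M} {u : M → ℝ} {G : ∀ x, U x}
    (hG : C.IsHorizontalGradient Ω u G) : AEMeasurable (fun x => ‖G x‖) (C.μ.restrict Ω) := by
  have h := aemeasurable_norm_dual (n := n) (F := F) (ν := C.μ.restrict Ω)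
    (L := fun x => innerSL ℝ (G x)) fun σ => (hG.measurable σ).aemeasurable
  simpa using h

theorem IsHorizontalGradient.integrableOn_inner {Ω : Set M} {u : M → ℝ} {G : ∀ x, U x}
    (hG : C.IsHorizontalGradient Ω u G) (σ : Cₛ^∞⟮𝓡 n; F, U⟯) {K : Set M} (hK : IsCompact K)
    (hKΩ : K ⊆ Ω) : IntegrableOn (fun x => (inner ℝ (G x) (σ x) : ℝ)) K C.μ := by
  have : IsLocallyFiniteMeasure C.μ := C.vol.isLocallyFiniteMeasure
  refine ⟨(hG.measurable σ).mono_measure (Measure.restrict_mono hKΩ le_rfl), ?_⟩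
  have hσ : IntegrableOn (fun x => ‖σ x‖ ^ 2) K C.μ :=
    ((continuous_norm_section σ).pow 2).continuousOn.integrableOn_compact hK
  have hfin : ∫⁻ x in K, ‖G x‖ₑ ^ 2 + ‖‖σ x‖ ^ 2‖ₑ ∂C.μ < ⊤ := by
    rw [lintegral_add_right' _ hσ.aestronglyMeasurable.enorm]
    exact ENNReal.add_lt_top.2 ⟨(lintegral_mono_set hKΩ).trans_lt hG.sq_integrable, hσ.2⟩
  refine (lintegral_mono fun x => ?_).trans_lt hfin
  have h1 : |(inner ℝ (G x) (σ x) : ℝ)| ≤ ‖G x‖ ^ 2 + ‖σ x‖ ^ 2 := by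
    refine (abs_real_inner_le_norm _ _).trans ?_
    nlinarith [sq_nonneg (‖G x‖ - ‖σ x‖), sq_nonneg ‖G x‖, sq_nonneg ‖σ x‖]
  rw [← ofReal_norm, ← ofReal_norm, ← ofReal_norm, ← ENNReal.ofReal_pow (norm_nonneg _),
    ← ENNReal.ofReal_add (by positivity) (by positivity)]
  refine ENNReal.ofReal_le_ofReal ?_
  simpa using h1

/-- The weak horizontal gradient of a smooth function represents its horizontal differential. -/
theorem IsHorizontalGradient.ae_inner_eq_hd {Ω : Set M} (hΩ : IsOpen Ω) {v : M → ℝ}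
    (hv : ContMDiffOn (𝓡 n) 𝓘(ℝ, ℝ) ∞ v Ω) {G : ∀ x, U x} (hG : C.IsHorizontalGradient Ω v G) :
    ∀ᵐ x ∂(C.μ.restrict Ω), ∀ w : U x, (inner ℝ (G x) w : ℝ) = C.hd v x w := by
  have := sigmaCompactSpace_of_secondCountable n M
  have hlc : LocallyCompactSpace M :=
    ChartedSpace.locallyCompactSpace (EuclideanSpace ℝ (Fin n)) M
  have : IsLocallyFiniteMeasure C.μ := C.vol.isLocallyFiniteMeasure
  obtain ⟨S, hS⟩ := exists_dense_sections n F U (M := M)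
  have hk : ∀ k, ∀ᵐ x ∂(C.μ.restrict Ω), (inner ℝ (G x) (S k x) : ℝ) - C.hd v x (S k x) = 0 := by
    intro k
    rw [ae_restrict_iff' hΩ.measurableSet]
    refine IsOpen.ae_eq_zero_of_integral_contMDiff_smul_eq_zero (𝓡 n) hΩ ?_ fun g hg hgc hgs => ?_
    · refine LocallyIntegrableOn.sub ?_
        ((C.continuousOn_hd_apply hΩ hv (S k)).locallyIntegrableOn hΩ.measurableSet)
      intro x hx
      obtain ⟨K, hKn, hKΩ, hK⟩ := local_compact_nhds (hΩ.mem_nhds hx)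
      exact ⟨K, mem_nhdsWithin_of_mem_nhds hKn, hG.integrableOn_inner (S k) hK hKΩ⟩
    -- A scalar test function times a section is a test section, so the weak identity becomes a
    -- scalar one for each `S k`.
    · set φ : Cₛ^∞⟮𝓡 n; F, U⟯ := ⟨fun x => g x • S k x, hg.smul_section (S k).contMDiff⟩
      have hφa : ∀ x, φ x = g x • S k x := fun _ => rfl
      have hsub : closure {x | φ x ≠ 0} ⊆ tsupport g := closure_mono fun x hx h => hx (by
        rw [hφa, h, zero_smul])
      have hφ : IsTestSection Ω φ :=
        ⟨hgc.isCompact.of_isClosed_subset isClosed_closure hsub, hsub.trans hgs⟩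
      have h1 := hG.weak φ hφ
      rw [C.integral_mul_adjointGrad hΩ hv hφ] at h1
      rw [← setIntegral_eq_integral_of_forall_compl_eq_zero (s := tsupport g) fun x hx => by
        rw [image_eq_zero_of_notMem_tsupport hx, zero_smul]]
      have h2 : ∀ {f : M → ℝ}, (∀ x, x ∉ tsupport g → f x = 0) →
          ∫ x in Ω, f x ∂C.μ = ∫ x in tsupport g, f x ∂C.μ := fun {f} hf => by
        rw [setIntegral_eq_integral_of_forall_compl_eq_zero fun x hx => hf x fun h => hx (hgs h),
          setIntegral_eq_integral_of_forall_compl_eq_zero fun x hx => hf x hx]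
      have hg0 : ∀ x, x ∉ tsupport g → φ x = 0 := fun x hx => by
        rw [hφa, image_eq_zero_of_notMem_tsupport hx, zero_smul]
      rw [h2 fun x hx => by rw [hg0 x hx, inner_zero_right],
        h2 fun x hx => by rw [hg0 x hx, map_zero]] at h1
      rw [← sub_eq_zero, ← integral_sub (hG.integrableOn_inner φ hgc.isCompact hgs)
        (((C.continuousOn_hd_apply hΩ hv φ).mono hgs).integrableOn_compact hgc.isCompact)] at h1
      rw [← h1]
      refine integral_congr_ae (ae_of_all _ fun x => ?_)
      simp only [hφa, inner_smul_right, map_smul, smul_eq_mul]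
      ring
  -- Countably many sections with dense values leave a single null set, and continuity in `w` covers
  -- the whole fibre.
  filter_upwards [ae_all_iff.2 hk] with x hx w
  have hcl : IsClosed {w : U x | (inner ℝ (G x) w : ℝ) = C.hd v x w} :=
    isClosed_eq (by fun_prop) (C.hd v x).continuous
  exact (hS x).induction_on (p := fun w => (inner ℝ (G x) w : ℝ) = C.hd v x w) w hcl
    fun k => sub_eq_zero.1 (hx k)

theorem IsHorizontalGradient.ae_norm_eq_norm_hd {Ω : Set M} (hΩ : IsOpen Ω) {v : M → ℝ}
    (hv : ContMDiffOn (𝓡 n) 𝓘(ℝ, ℝ) ∞ v Ω) {G : ∀ x, U x} (hG : C.IsHorizontalGradient Ω v G) :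
    ∀ᵐ x ∂(C.μ.restrict Ω), ‖G x‖ = ‖C.hd v x‖ := by
  filter_upwards [hG.ae_inner_eq_hd hΩ hv] with x hx
  have : C.hd v x = innerSL ℝ (G x) := by
    ext w; rw [← hx w]; rfl
  rw [this, innerSL_apply_norm]

end CCSpace

end WeakGradient

end CC

end

noncomputable section

namespace CC

/-! ### Area of level sets in Euclidean space and a weak Sard theorem. -/

section LevelSets

open scoped NNReal

variable {n : ℕ}

theorem EuclideanSpace.dist_le_of_forall_abs_sub_le {x y : EuclideanSpace ℝ (Fin n)} {a : ℝ}
    (ha : 0 ≤ a) (h : ∀ i, |x i - y i| ≤ a) : dist x y ≤ (n + 1) * a := by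
  rw [EuclideanSpace.dist_eq]
  refine Real.sqrt_le_iff.2 ⟨by positivity, ?_⟩
  calc ∑ i, dist (x i) (y i) ^ 2 ≤ ∑ _i : Fin n, a ^ 2 :=
        Finset.sum_le_sum fun i _ => by
          rw [Real.dist_eq]; exact pow_le_pow_left₀ (abs_nonneg _) (h i) 2
    _ = n * a ^ 2 := by simp
    _ ≤ ((n + 1) * a) ^ 2 := by
        rw [mul_pow]
        refine mul_le_mul_of_nonneg_right ?_ (sq_nonneg a)
        nlinarith [(Nat.cast_nonneg n : (0 : ℝ) ≤ n)]

/-- A bounded set is covered by about `m ^ n` cells of size `1 / m`. -/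
theorem exists_cells {S : Set (EuclideanSpace ℝ (Fin n))} {N : ℕ} (hS : ∀ x ∈ S, ∀ i, |x i| ≤ N)
    (m : ℕ) : ∃ Q : (Fin n → Fin (2 * N * (m + 1) + 1)) → Set (EuclideanSpace ℝ (Fin n)),
      S ⊆ ⋃ j, Q j ∧ (∀ j, Q j ⊆ S) ∧
      ∀ j, ∀ x ∈ Q j, ∀ y ∈ Q j, dist x y ≤ (n + 1) / ((m : ℝ) + 1) := by
  have hm : (0 : ℝ) < (m : ℝ) + 1 := by positivity
  -- The cells have side `1 / (m + 1)`. Since `|x i| ≤ N`, the rescaled coordinate lies in `[0, 2 N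
  -- (m + 1)]`, and the closed right end costs one more index.
  refine ⟨fun j => {x ∈ S | ∀ i, ⌊(x i + N) * (m + 1)⌋₊ = j i}, fun x hx => ?_,
    fun j x hx => hx.1, fun j x hx y hy => ?_⟩
  · refine mem_iUnion.2 ⟨fun i => ⟨⌊(x i + N) * (m + 1)⌋₊, ?_⟩, hx, fun i => rfl⟩
    refine Nat.lt_succ_of_le (Nat.floor_le_of_le ?_)
    push_cast
    refine mul_le_mul_of_nonneg_right ?_ hm.le
    linarith [(abs_le.1 (hS x hx i)).2]
  · have hnn : ∀ z ∈ S, ∀ i, 0 ≤ (z i + N) * ((m : ℝ) + 1) := fun z hz i =>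
      mul_nonneg (by linarith [(abs_le.1 (hS z hz i)).1]) hm.le
    rw [div_eq_mul_one_div]
    refine EuclideanSpace.dist_le_of_forall_abs_sub_le (by positivity) fun i => ?_
    rw [le_div_iff₀ hm]
    have hx1 := Nat.floor_le (hnn x hx.1 i)
    have hx2 := Nat.lt_floor_add_one ((x i + N) * ((m : ℝ) + 1))
    have hy1 := Nat.floor_le (hnn y hy.1 i)
    have hy2 := Nat.lt_floor_add_one ((y i + N) * ((m : ℝ) + 1))
    rw [hx.2 i] at hx1 hx2
    rw [hy.2 i] at hy1 hy2
    have hab : |x i - y i| * ((m : ℝ) + 1) = |(x i - y i) * ((m : ℝ) + 1)| := by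
      rw [abs_mul, abs_of_pos hm]
    rw [hab, abs_le]
    constructor <;> nlinarith

/-- The measures of the level sets of `g` on a bounded set are controlled, in the mean, by the
oscillation of `g` at small scales. -/
theorem exists_measurable_hausdorffMeasure_level_le (hn : 1 ≤ n)
    {S : Set (EuclideanSpace ℝ (Fin n))} {N : ℕ} (hS : ∀ x ∈ S, ∀ i, |x i| ≤ N)
    {g : EuclideanSpace ℝ (Fin n) → ℝ} {osc : ℕ → ℝ} (hosc0 : ∀ m, 0 ≤ osc m)
    (hg : ∀ m : ℕ, ∀ x ∈ S, ∀ y ∈ S, dist x y ≤ (n + 1) / ((m : ℝ) + 1) → |g x - g y| ≤ osc m) :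
    ∃ (c : ℝ) (f : ℕ → ℝ → ℝ≥0∞), 0 ≤ c ∧ (∀ m, Measurable (f m)) ∧
      (∀ t, Measure.hausdorffMeasure ((n : ℝ) - 1) (S ∩ {x | g x = t})
        ≤ liminf (fun m => f m t) atTop) ∧
      ∀ m, ∫⁻ t, f m t ≤ ENNReal.ofReal (c * (((m : ℝ) + 1) * osc m)) := by
  classical
  choose Q hQc hQS hQd using fun m => exists_cells hS m
  have hpt : ∀ m j, ∃ x, (Q m j).Nonempty → x ∈ Q m j := fun m j => by
    by_cases h : (Q m j).Nonempty
    · exact ⟨h.some, fun _ => h.some_mem⟩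
    · exact ⟨0, fun h' => absurd h' h⟩
  choose p hp using hpt
  have hexp : (n : ℝ) - 1 = ((n - 1 : ℕ) : ℝ) := by rw [Nat.cast_sub hn, Nat.cast_one]
  set δ : ℕ → ℝ := fun m => (n + 1) / ((m : ℝ) + 1) with hδ
  have hδ0 : ∀ m, 0 ≤ δ m := fun m => by positivity
  -- A cell meeting the level `t` forces `t` to lie within `osc m` of the value at the base point `p
  -- m j`. Charging `δ m ^ (n - 1)` for each such cell bounds the covering sums. Integration in `t`
  -- costs `2 * osc m` per cell, hence in all a multiple of `(m + 1) ^ n * δ m ^ (n - 1) * osc m`,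
  -- that is, of `(m + 1) * osc m`.
  set f : ℕ → ℝ → ℝ≥0∞ := fun m t => ∑ j, (Metric.closedBall (g (p m j)) (osc m)).indicator
    (fun _ => ENNReal.ofReal (δ m ^ (n - 1))) t with hf
  refine ⟨2 * (n + 1) ^ (n - 1) * (2 * N + 1) ^ n, f, by positivity, fun m => ?_, fun t => ?_,
    fun m => ?_⟩
  · exact Finset.measurable_fun_sum _ fun j _ =>
      measurable_const.indicator Metric.isClosed_closedBall.measurableSet
  · have hlim : Tendsto (fun m => ENNReal.ofReal (δ m)) atTop (𝓝 0) := by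
      rw [← ENNReal.ofReal_zero]
      refine (ENNReal.continuous_ofReal.tendsto _).comp ?_
      have := (tendsto_one_div_add_atTop_nhds_zero_nat (𝕜 := ℝ)).const_mul ((n : ℝ) + 1)
      simpa [hδ, div_eq_mul_inv] using this
    have hdiam : ∀ m j, Metric.ediam (Q m j) ≤ ENNReal.ofReal (δ m) := fun m j =>
      Metric.ediam_le fun x hx y hy => by
        rw [edist_dist]; exact ENNReal.ofReal_le_ofReal (hQd m j x hx y hy)
    have key := Measure.hausdorffMeasure_le_liminf_sum
      (ι := fun m => {j : Fin n → Fin (2 * N * (m + 1) + 1) // (Q m j ∩ {x | g x = t}).Nonempty})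
      ((n : ℝ) - 1) (S ∩ {x | g x = t}) (l := atTop) (fun m => ENNReal.ofReal (δ m)) hlim
      (fun m j => Q m j.1 ∩ {x | g x = t})
      (Eventually.of_forall fun m j => (Metric.ediam_mono inter_subset_left).trans (hdiam m j.1))
      (Eventually.of_forall fun m x hx => by
        obtain ⟨j, hj⟩ := mem_iUnion.1 (hQc m hx.1)
        exact mem_iUnion.2 ⟨⟨j, x, hj, hx.2⟩, hj, hx.2⟩)
    refine key.trans (liminf_le_liminf (Eventually.of_forall fun m => ?_))
    calc ∑ j : {j // (Q m j ∩ {x | g x = t}).Nonempty},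
          Metric.ediam (Q m j.1 ∩ {x | g x = t}) ^ ((n : ℝ) - 1)
        ≤ ∑ j : {j // (Q m j ∩ {x | g x = t}).Nonempty},
          (Metric.closedBall (g (p m j.1)) (osc m)).indicator
            (fun _ => ENNReal.ofReal (δ m ^ (n - 1))) t := by
          refine Finset.sum_le_sum fun ⟨j, x, hxQ, hxt⟩ _ => ?_
          have hpj := hp m j ⟨x, hxQ⟩
          have ht : t ∈ Metric.closedBall (g (p m j)) (osc m) := by
            rw [Metric.mem_closedBall, Real.dist_eq, ← show g x = t from hxt]
            exact hg m x (hQS m j hxQ) _ (hQS m j hpj) (hQd m j x hxQ _ hpj)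
          simp only
          rw [indicator_of_mem ht, ENNReal.ofReal_pow (hδ0 m), hexp, ENNReal.rpow_natCast]
          exact pow_le_pow_left' ((Metric.ediam_mono inter_subset_left).trans (hdiam m j)) _
      _ = ∑ j ∈ Finset.univ.filter (fun j => (Q m j ∩ {x | g x = t}).Nonempty),
          (Metric.closedBall (g (p m j)) (osc m)).indicator
            (fun _ => ENNReal.ofReal (δ m ^ (n - 1))) t :=
          (Finset.sum_subtype (p := fun j => (Q m j ∩ {x | g x = t}).Nonempty)
            (Finset.univ.filter fun j => (Q m j ∩ {x | g x = t}).Nonempty)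
            (fun j => by simp only [Finset.mem_filter, Finset.mem_univ, true_and])
            fun j => (Metric.closedBall (g (p m j)) (osc m)).indicator
              (fun _ => ENNReal.ofReal (δ m ^ (n - 1))) t).symm
      _ ≤ f m t := Finset.sum_le_sum_of_subset (Finset.filter_subset _ _)
  · rw [hf]
    simp only
    rw [lintegral_finsetSum _ fun j _ =>
      measurable_const.indicator Metric.isClosed_closedBall.measurableSet]
    simp_rw [lintegral_indicator_const Metric.isClosed_closedBall.measurableSet,
      Real.volume_closedBall]
    rw [Finset.sum_const, Finset.card_univ, Fintype.card_fun, Fintype.card_fin, Fintype.card_fin,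
      nsmul_eq_mul, ← ENNReal.ofReal_natCast, ← ENNReal.ofReal_mul (by positivity),
      ← ENNReal.ofReal_mul (by positivity)]
    refine ENNReal.ofReal_le_ofReal ?_
    have hm : (0 : ℝ) < (m : ℝ) + 1 := by positivity
    have h1 : (((2 * N * (m + 1) + 1) ^ n : ℕ) : ℝ) ≤ (2 * N + 1) ^ n * ((m : ℝ) + 1) ^ n := by
      push_cast
      rw [← mul_pow]
      refine pow_le_pow_left₀ (by positivity) ?_ n
      nlinarith [(Nat.cast_nonneg m : (0 : ℝ) ≤ m)]
    have h2 : δ m ^ (n - 1) * ((m : ℝ) + 1) ^ n = (n + 1) ^ (n - 1) * ((m : ℝ) + 1) := by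
      obtain ⟨k, rfl⟩ : ∃ k, n = k + 1 := ⟨n - 1, by omega⟩
      simp only [hδ, Nat.add_sub_cancel, div_pow]
      field_simp
      ring
    have h3 : 0 ≤ δ m ^ (n - 1) * (2 * osc m) :=
      mul_nonneg (pow_nonneg (hδ0 m) _) (by linarith [hosc0 m])
    calc _ ≤ ((2 * N + 1) ^ n * ((m : ℝ) + 1) ^ n) * (δ m ^ (n - 1) * (2 * osc m)) :=
          mul_le_mul_of_nonneg_right h1 h3
      _ = (2 * N + 1) ^ n * (δ m ^ (n - 1) * ((m : ℝ) + 1) ^ n) * (2 * osc m) := by ring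
      _ = _ := by rw [h2]; ring

theorem exists_nat_abs_le_of_isBounded {S : Set (EuclideanSpace ℝ (Fin n))}
    (hS : Bornology.IsBounded S) : ∃ N : ℕ, ∀ x ∈ S, ∀ i, |x i| ≤ N := by
  obtain ⟨R, hR⟩ := hS.exists_norm_le
  obtain ⟨N, hN⟩ := exists_nat_ge R
  exact ⟨N, fun x hx i => ((EuclideanSpace.norm_eq x ▸ PiLp.norm_apply_le x i :
    ‖x i‖ ≤ _).trans (by simpa [EuclideanSpace.norm_eq] using hR x hx)).trans hN⟩

/-- Almost all level sets of a smooth function have locally finite area. -/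
theorem ae_hausdorffMeasure_level_lt_top {S : Set (EuclideanSpace ℝ (Fin n))}
    (hS : Bornology.IsBounded S) {g : EuclideanSpace ℝ (Fin n) → ℝ} (hg : ContDiff ℝ ∞ g)
    (hgc : HasCompactSupport g) :
    ∀ᵐ t : ℝ, Measure.hausdorffMeasure ((n : ℝ) - 1) (S ∩ {x | g x = t}) < ⊤ := by
  -- In dimension zero the space is a point, so every level but one is empty.
  rcases Nat.eq_zero_or_pos n with rfl | hn
  · filter_upwards [(countable_singleton (g 0)).ae_notMem volume] with t ht
    have : S ∩ {x | g x = t} = ∅ := by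
      refine eq_empty_of_forall_notMem fun x hx => ht ?_
      rw [mem_singleton_iff, ← hx.2, Subsingleton.elim x 0]
    rw [this, measure_empty]
    exact ENNReal.zero_lt_top
  obtain ⟨N, hN⟩ := exists_nat_abs_le_of_isBounded hS
  obtain ⟨L, hL⟩ := hg.lipschitzWith_of_hasCompactSupport hgc (by simp)
  -- A Lipschitz function oscillates by `O(1 / (m + 1))` on a cell, so the integrals of `f m` stay
  -- bounded and Fatou's lemma applies.
  obtain ⟨c, f, hc, hfm, hf, hfi⟩ := exists_measurable_hausdorffMeasure_level_le hn hN (g := g)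
    (osc := fun m => L * ((n + 1) / ((m : ℝ) + 1))) (fun m => by positivity)
    fun m x _ y _ hxy => by
      rw [← Real.dist_eq]
      exact (hL.dist_le_mul x y).trans (mul_le_mul_of_nonneg_left hxy L.2)
  have hfi' : ∀ m, ∫⁻ t, f m t ≤ ENNReal.ofReal (c * (L * (n + 1))) := fun m => by
    refine (hfi m).trans_eq ?_
    congr 1
    field_simp
  have hlim : ∫⁻ t, liminf (fun m => f m t) atTop < ⊤ :=
    (lintegral_liminf_le hfm).trans_lt
      ((liminf_le_of_frequently_le' (Frequently.of_forall hfi')).trans_lt ENNReal.ofReal_lt_top)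
  filter_upwards [ae_lt_top (Measurable.liminf hfm) hlim.ne] with t ht using (hf t).trans_lt ht

/-- **Sard's theorem**, weak form: almost every level set of a smooth function meets the critical
set in a set of area zero. -/
theorem ae_hausdorffMeasure_critical_level_eq_zero {S : Set (EuclideanSpace ℝ (Fin n))}
    (hS : Bornology.IsBounded S) {g : EuclideanSpace ℝ (Fin n) → ℝ} (hg : ContDiff ℝ ∞ g)
    (hgc : HasCompactSupport g) :
    ∀ᵐ t : ℝ, Measure.hausdorffMeasure ((n : ℝ) - 1)
      ((S ∩ {x | fderiv ℝ g x = 0}) ∩ {x | g x = t}) = 0 := by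
  rcases Nat.eq_zero_or_pos n with rfl | hn
  · filter_upwards [(countable_singleton (g 0)).ae_notMem volume] with t ht
    have : (S ∩ {x | fderiv ℝ g x = 0}) ∩ {x | g x = t} = ∅ := by
      refine eq_empty_of_forall_notMem fun x hx => ht ?_
      rw [mem_singleton_iff, ← hx.2, Subsingleton.elim x 0]
    rw [this, measure_empty]
  obtain ⟨N, hN⟩ := exists_nat_abs_le_of_isBounded hS
  obtain ⟨L, hL⟩ := (hg.fderiv_right (m := ∞) (by simp)).lipschitzWith_of_hasCompactSupport
    (hgc.fderiv ℝ) (by simp)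
  -- Between critical points the oscillation is quadratic in the distance, since the derivative
  -- vanishes at `y` and is Lipschitz. Hence `(m + 1) * osc m → 0`, and Fatou's lemma gives zero.
  obtain ⟨c, f, hc, hfm, hf, hfi⟩ := exists_measurable_hausdorffMeasure_level_le hn
    (S := S ∩ {x | fderiv ℝ g x = 0}) (fun x hx => hN x hx.1) (g := g)
    (osc := fun m => L * ((n + 1) / ((m : ℝ) + 1)) ^ 2) (fun m => by positivity)
    fun m x _ y hy hxy => by
      have hb : ∀ z ∈ Metric.closedBall y (dist x y), ‖fderiv ℝ g z‖ ≤ L * dist x y := by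
        intro z hz
        have h := hL.dist_le_mul z y
        rw [hy.2, dist_zero_right] at h
        exact h.trans (mul_le_mul_of_nonneg_left hz L.2)
      have h := (convex_closedBall y (dist x y)).norm_image_sub_le_of_norm_fderiv_le
        (fun z _ => hg.differentiable (by simp) z) hb
        (Metric.mem_closedBall_self dist_nonneg) (Metric.mem_closedBall.2 le_rfl : x ∈ _)
      rw [Real.norm_eq_abs, ← dist_eq_norm] at h
      refine h.trans ?_
      rw [mul_assoc, sq]
      exact mul_le_mul_of_nonneg_left (mul_le_mul hxy hxy dist_nonneg (by positivity)) L.2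
  have hlim : Tendsto (fun m : ℕ => ENNReal.ofReal
      (c * (((m : ℝ) + 1) * (L * ((n + 1) / ((m : ℝ) + 1)) ^ 2)))) atTop (𝓝 0) := by
    rw [← ENNReal.ofReal_zero]
    refine (ENNReal.continuous_ofReal.tendsto _).comp ?_
    have h := (tendsto_one_div_add_atTop_nhds_zero_nat (𝕜 := ℝ)).const_mul
      (c * (L * ((n : ℝ) + 1) ^ 2))
    rw [mul_zero] at h
    refine h.congr fun m => ?_
    field_simp
  have hint : ∫⁻ t, liminf (fun m => f m t) atTop = 0 := by
    refine le_antisymm ((lintegral_liminf_le hfm).trans ?_) zero_le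
    rw [← hlim.liminf_eq]
    exact liminf_le_liminf (Eventually.of_forall hfi)
  filter_upwards [(lintegral_eq_zero_iff (Measurable.liminf hfm)).1 hint] with t ht
  exact le_antisymm ((hf t).trans_eq ht) zero_le

end LevelSets

end CC

end

noncomputable section

namespace CC

/-! ### Piecewise smooth boundaries of superlevel sets on the manifold. -/

section ChartFunctions

variable {n : ℕ} {M : Type*} [TopologicalSpace M] [ChartedSpace (EuclideanSpace ℝ (Fin n)) M]
  [IsManifold (𝓡 n) ∞ M]

/-- A smooth function with compact support in a chart domain, read in the chart. -/
theorem contDiff_chart_indicator (p : M) {u : M → ℝ} (hu : ContMDiff (𝓡 n) 𝓘(ℝ, ℝ) ∞ u)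
    (huc : HasCompactSupport u) (hus : tsupport u ⊆ (extChartAt (𝓡 n) p).source) :
    ContDiff ℝ ∞ ((extChartAt (𝓡 n) p).target.indicator (u ∘ (extChartAt (𝓡 n) p).symm)) ∧
    HasCompactSupport
      ((extChartAt (𝓡 n) p).target.indicator (u ∘ (extChartAt (𝓡 n) p).symm)) := by
  have hK : IsCompact (extChartAt (𝓡 n) p '' tsupport u) :=
    huc.isCompact.image_of_continuousOn ((continuousOn_extChartAt p).mono hus)
  have hKT : extChartAt (𝓡 n) p '' tsupport u ⊆ (extChartAt (𝓡 n) p).target := by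
    rintro - ⟨x, hx, rfl⟩; exact (extChartAt (𝓡 n) p).map_source (hus hx)
  have h0 : ∀ y ∈ (extChartAt (𝓡 n) p).target, y ∉ extChartAt (𝓡 n) p '' tsupport u →
      (u ∘ (extChartAt (𝓡 n) p).symm) y = 0 := fun y hy hyK => by
    refine image_eq_zero_of_notMem_tsupport (f := u) (x := (extChartAt (𝓡 n) p).symm y) ?_
    exact fun h => hyK ⟨_, h, (extChartAt (𝓡 n) p).right_inv hy⟩
  refine ⟨contDiff_indicator_of_isCompact (isOpen_extChartAt_target p) hK hKT ?_ h0,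
    hasCompactSupport_indicator_of_isCompact hK h0⟩
  exact (hu.comp_contMDiffOn (contMDiffOn_extChartAt_symm p)).contDiffOn

end ChartFunctions

section LevelSetsManifold

open scoped NNReal

variable {n : ℕ} {M : Type*} [TopologicalSpace M] [ChartedSpace (EuclideanSpace ℝ (Fin n)) M]
  [IsManifold (𝓡 n) ∞ M]

/-- Changes of charts are locally Lipschitz. -/
theorem exists_nhds_hausdorffMeasure_image_le {d : ℝ} (hd : 0 ≤ d) {p q x : M}
    (hp : x ∈ (extChartAt (𝓡 n) p).source) (hq : x ∈ (extChartAt (𝓡 n) q).source) :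
    ∃ V ∈ 𝓝 x, V ⊆ (extChartAt (𝓡 n) q).source ∧ ∃ L : ℝ≥0∞, L ≠ ⊤ ∧ ∀ Z ⊆ V,
      Measure.hausdorffMeasure d (extChartAt (𝓡 n) p '' Z)
        ≤ L * Measure.hausdorffMeasure d (extChartAt (𝓡 n) q '' Z) := by
  have hy : extChartAt (𝓡 n) q x ∈
      ((extChartAt (𝓡 n) q).symm.trans (extChartAt (𝓡 n) p)).source := by
    rw [PartialEquiv.trans_source, PartialEquiv.symm_source]
    exact ⟨(extChartAt (𝓡 n) q).map_source hq, by
      rw [mem_preimage, (extChartAt (𝓡 n) q).left_inv hq]; exact hp⟩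
  have hc : ContDiffAt ℝ ∞ (extChartAt (𝓡 n) p ∘ (extChartAt (𝓡 n) q).symm)
      (extChartAt (𝓡 n) q x) := by
    have := contDiffWithinAt_ext_coord_change (I := 𝓡 n) (n := ∞) p q hy
    rwa [modelWithCornersSelf_coe, range_id, contDiffWithinAt_univ] at this
  obtain ⟨K, t, ht, hK⟩ := (hc.of_le (by simp) : ContDiffAt ℝ 1 _ _).exists_lipschitzOnWith
  refine ⟨(extChartAt (𝓡 n) q).source ∩ extChartAt (𝓡 n) q ⁻¹' t,
    inter_mem (extChartAt_source_mem_nhds' hq)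
      ((continuousAt_extChartAt' hq).preimage_mem_nhds ht), inter_subset_left,
    (K : ℝ≥0∞) ^ d, by simp [hd], fun Z hZ => ?_⟩
  have he : extChartAt (𝓡 n) p '' Z
      = (extChartAt (𝓡 n) p ∘ (extChartAt (𝓡 n) q).symm) '' (extChartAt (𝓡 n) q '' Z) := by
    rw [← image_comp]
    exact image_congr fun z hz => by
      simp only [Function.comp_apply, (extChartAt (𝓡 n) q).left_inv (hZ hz).1]
  rw [he]
  refine (hK.mono ?_).hausdorffMeasure_image_le hd
  rintro - ⟨z, hz, rfl⟩
  exact (hZ hz).2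

/-- A set which is locally null in charts is null in all charts. -/
theorem hausdorffMeasure_chart_image_eq_zero [SecondCountableTopology M] {d : ℝ} (hd : 0 ≤ d)
    {S : Set M}
    (hS : ∀ x, ∃ q, x ∈ (extChartAt (𝓡 n) q).source ∧ ∃ V ∈ 𝓝 x,
      Measure.hausdorffMeasure d (extChartAt (𝓡 n) q '' (S ∩ V)) = 0) (p : M) :
    Measure.hausdorffMeasure d (extChartAt (𝓡 n) p '' (S ∩ (extChartAt (𝓡 n) p).source)) = 0 := by
  have hS' : ∀ x ∈ (extChartAt (𝓡 n) p).source, ∃ W ∈ 𝓝 x,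
      Measure.hausdorffMeasure d (extChartAt (𝓡 n) p '' (S ∩ W)) = 0 := fun x hx => by
    obtain ⟨q, hq, V, hV, h0⟩ := hS x
    obtain ⟨W, hW, -, L, hL, h⟩ := exists_nhds_hausdorffMeasure_image_le hd hx hq
    refine ⟨V ∩ W, inter_mem hV hW, le_antisymm ?_ bot_le⟩
    refine (h _ fun z hz => hz.2.2).trans ?_
    rw [measure_mono_null (image_mono (inter_subset_inter_right S inter_subset_left)) h0,
      mul_zero]
  choose! W hW hW0 using hS'
  obtain ⟨T, hTs, hTc, hT⟩ := TopologicalSpace.countable_cover_nhdsWithin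
    fun x hx => mem_nhdsWithin_of_mem_nhds (hW x hx)
  refine measure_mono_null (t := ⋃ x ∈ T, extChartAt (𝓡 n) p '' (S ∩ W x)) ?_
    ((measure_biUnion_null_iff hTc).2 fun x hx => hW0 x (hTs hx))
  rintro - ⟨z, hz, rfl⟩
  obtain ⟨x, hx, hzx⟩ := mem_iUnion₂.1 (hT hz.2)
  exact mem_iUnion₂.2 ⟨x, hx, _, ⟨hz.1, hzx⟩, rfl⟩

/-- A frontier point inside `Ω` lies on the level `t`, where `t - w` is a defining function. At a
frontier point on `∂Ω` one has `w q > t`, so the set coincides with `Ω` nearby and inherits its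
defining function. -/
theorem IsSmoothBoundaryPoint.superlevel {w : M → ℝ} (hw : ContMDiff (𝓡 n) 𝓘(ℝ, ℝ) ∞ w)
    {Ω : Set M} (hΩ : IsOpen Ω) {t : ℝ} {q : M} (hq : q ∈ frontier (Ω ∩ {x | t < w x}))
    (h1 : q ∈ frontier Ω → IsSmoothBoundaryPoint n Ω q) (h2 : q ∈ frontier Ω → w q ≠ t)
    (h3 : w q = t → mfderiv (𝓡 n) 𝓘(ℝ, ℝ) w q ≠ 0) :
    IsSmoothBoundaryPoint n (Ω ∩ {x | t < w x}) q := by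
  have hle : t ≤ w q := by
    have : q ∈ closure {x | t < w x} := closure_mono inter_subset_right hq.1
    exact closure_lt_subset_le continuous_const hw.continuous this
  have hΩq : q ∈ closure Ω := closure_mono inter_subset_left hq.1
  have hopen : IsOpen {x | t < w x} := isOpen_lt continuous_const hw.continuous
  by_cases hqΩ : q ∈ Ω
  · have hwq : w q = t := by
      refine le_antisymm (not_lt.1 fun h => ?_) hle
      rw [(hΩ.inter hopen).frontier_eq] at hq
      exact hq.2 ⟨hqΩ, h⟩
    refine ⟨Ω, fun x => t - w x, hΩ, hqΩ, (contMDiff_const.sub hw).contMDiffOn, by simp [hwq],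
      fun h => h3 hwq ?_, fun x hx => by simp [hx]⟩
    have hsub := differential_sub (n := n) (u := fun _ => t) (v := w) (x := q)
      mdifferentiableAt_const (hw.mdifferentiable (by simp) q)
    rw [differential_const, zero_sub] at hsub
    have : differential n (fun x => t - w x) q = 0 := h
    rw [hsub, neg_eq_zero] at this
    exact this
  · have hqf : q ∈ frontier Ω := by rw [hΩ.frontier_eq]; exact ⟨hΩq, hqΩ⟩
    obtain ⟨V, g, hV, hqV, hg, hg0, hdg, hVg⟩ := h1 hqf
    exact ⟨V ∩ {x | t < w x}, g, hV.inter hopen,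
      ⟨hqV, lt_of_le_of_ne hle (h2 hqf).symm⟩, hg.mono inter_subset_left, hg0, hdg,
      fun x hx => by simp [hVg x hx.1, show t < w x from hx.2]⟩

/-- Local statement behind the regularity of almost every superlevel set. -/
theorem exists_nhds_ae_hausdorffMeasure_level [T2Space M] [SecondCountableTopology M]
    {w : M → ℝ} (hw : ContMDiff (𝓡 n) 𝓘(ℝ, ℝ) ∞ w) {S : Set M} {p : M}
    (hSp : ∃ V ∈ 𝓝 p, Measure.hausdorffMeasure ((n : ℝ) - 1)
      (extChartAt (𝓡 n) p '' (S ∩ V ∩ (extChartAt (𝓡 n) p).source)) < ⊤) :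
    ∃ V ∈ 𝓝 p, V ⊆ (extChartAt (𝓡 n) p).source ∧ ∀ᵐ t : ℝ,
      Measure.hausdorffMeasure ((n : ℝ) - 1) (extChartAt (𝓡 n) p '' ({x | w x = t} ∩ V)) < ⊤ ∧
      Measure.hausdorffMeasure ((n : ℝ) - 1) (extChartAt (𝓡 n) p ''
        ({x | w x = t ∧ (mfderiv (𝓡 n) 𝓘(ℝ, ℝ) w x = 0 ∨ x ∈ S)} ∩ V)) = 0 := by
  have : LocallyCompactSpace M := ChartedSpace.locallyCompactSpace (EuclideanSpace ℝ (Fin n)) M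
  have : SigmaCompactSpace M := sigmaCompactSpace_of_secondCountable n M
  obtain ⟨V₀, hV₀, hfin⟩ := hSp
  obtain ⟨K, hK, hKs, hKc⟩ := local_compact_nhds (extChartAt_source_mem_nhds (I := 𝓡 n) p)
  -- Read in the chart, `χ * w` is smooth with compact support on the whole Euclidean space and
  -- agrees with `w` near `K`, so the Euclidean statements apply to it.
  obtain ⟨χ, hχ, hχc, hχs, -, -, hχ1⟩ := exists_cutoff n hKc (isOpen_extChartAt_source p) hKs
  obtain ⟨hg, hgc⟩ := contDiff_chart_indicator p (hχ.mul hw) hχc.mul_right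
    (tsupport_mul_subset_left.trans hχs)
  set g := (extChartAt (𝓡 n) p).target.indicator
    ((χ * w) ∘ (extChartAt (𝓡 n) p).symm) with hgdef
  have hgK : ∀ x ∈ K, g =ᶠ[𝓝 (extChartAt (𝓡 n) p x)] w ∘ (extChartAt (𝓡 n) p).symm := by
    intro x hx
    have h1 : ∀ᶠ z in 𝓝 x, χ z = 1 := hχ1.filter_mono (nhds_le_nhdsSet hx)
    have h2 : ∀ᶠ y in 𝓝 (extChartAt (𝓡 n) p x), χ ((extChartAt (𝓡 n) p).symm y) = 1 := by
      have hct := continuousAt_extChartAt_symm' (I := 𝓡 n) (hKs hx)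
      rw [ContinuousAt, (extChartAt (𝓡 n) p).left_inv (hKs hx)] at hct
      exact hct.eventually h1
    filter_upwards [h2, extChartAt_target_mem_nhds' ((extChartAt (𝓡 n) p).map_source (hKs hx))]
      with y hy hyT
    rw [hgdef, indicator_of_mem hyT, Function.comp_apply, Pi.mul_apply, hy, one_mul,
      Function.comp_apply]
  have hgv : ∀ x ∈ K, g (extChartAt (𝓡 n) p x) = w x := fun x hx => by
    rw [(hgK x hx).self_of_nhds, Function.comp_apply, (extChartAt (𝓡 n) p).left_inv (hKs hx)]
  have hbd : Bornology.IsBounded (extChartAt (𝓡 n) p '' K) :=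
    (hKc.image_of_continuousOn ((continuousOn_extChartAt p).mono hKs)).isBounded
  refine ⟨K ∩ V₀, inter_mem hK hV₀, inter_subset_left.trans hKs, ?_⟩
  set Z : Set (EuclideanSpace ℝ (Fin n)) :=
    extChartAt (𝓡 n) p '' (S ∩ V₀ ∩ (extChartAt (𝓡 n) p).source) with hZ
  have : IsFiniteMeasure ((Measure.hausdorffMeasure ((n : ℝ) - 1)).restrict Z) :=
    ⟨by rwa [Measure.restrict_apply_univ]⟩
  -- `Z` has finite area, so only countably many levels meet it in positive area. With `S = ∂Ω` this
  -- makes the edge where a level meets `∂Ω` negligible.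
  have hcount : ∀ᵐ t : ℝ, Measure.hausdorffMeasure ((n : ℝ) - 1) ({y | g y = t} ∩ Z) = 0 := by
    have hc := Measure.countable_meas_level_set_pos
      (μ := (Measure.hausdorffMeasure ((n : ℝ) - 1)).restrict Z) hg.continuous.measurable
    filter_upwards [hc.ae_notMem volume] with t ht
    have hms : MeasurableSet {y | g y = t} := hg.continuous.measurable (measurableSet_singleton t)
    rw [← Measure.restrict_apply hms]
    exact nonpos_iff_eq_zero.1 (not_lt.1 ht)
  filter_upwards [ae_hausdorffMeasure_level_lt_top hbd hg hgc,
    ae_hausdorffMeasure_critical_level_eq_zero hbd hg hgc, hcount] with t h1 h2 h3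
  refine ⟨(measure_mono ?_).trans_lt h1, measure_mono_null ?_ (measure_union_null h2 h3)⟩
  · rintro - ⟨x, ⟨hxt, hxK, -⟩, rfl⟩
    exact ⟨mem_image_of_mem _ hxK, (hgv x hxK).trans hxt⟩
  · rintro - ⟨x, ⟨⟨hxt, hx⟩, hxK, hxV⟩, rfl⟩
    have hgt : g (extChartAt (𝓡 n) p x) = t := (hgv x hxK).trans hxt
    rcases hx with hx | hx
    · refine Or.inl ⟨⟨mem_image_of_mem _ hxK, ?_⟩, hgt⟩
      change fderiv ℝ g _ = 0
      rw [(hgK x hxK).fderiv_eq, ← mfderiv_eq_fderiv]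
      have hd1 : MDifferentiableAt (𝓡 n) 𝓘(ℝ, ℝ) w
          ((extChartAt (𝓡 n) p).symm (extChartAt (𝓡 n) p x)) := hw.mdifferentiable (by simp) _
      have hd2 := (contMDiffAt_extChartAt_symm
        ((extChartAt (𝓡 n) p).map_source (hKs hxK))).mdifferentiableAt (by simp)
      rw [mfderiv_comp _ hd1 hd2, (extChartAt (𝓡 n) p).left_inv (hKs hxK), hx]
      exact ContinuousLinearMap.zero_comp _
    · exact Or.inr ⟨hgt, x, ⟨⟨hx, hxV⟩, hKs hxK⟩, rfl⟩

/-- Almost every superlevel set of a smooth function in a domain with piecewise smooth boundary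
has piecewise smooth boundary. -/
theorem HasPiecewiseSmoothBoundary.ae_superlevel [T2Space M] [SecondCountableTopology M]
    {w : M → ℝ} (hw : ContMDiff (𝓡 n) 𝓘(ℝ, ℝ) ∞ w) {Ω : Set M} (hΩ : IsOpen Ω)
    (hΩs : HasPiecewiseSmoothBoundary n Ω) :
    ∀ᵐ t : ℝ, HasPiecewiseSmoothBoundary n (Ω ∩ {x | t < w x}) := by
  rcases Nat.eq_zero_or_pos n with rfl | hn
  -- In dimension zero `M` is discrete and every frontier is empty.
  · have : DiscreteTopology M := ChartedSpace.discreteTopology (EuclideanSpace ℝ (Fin 0)) M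
    refine ae_of_all _ fun t => ⟨fun p => ⟨univ, univ_mem, ?_⟩, fun p => ?_⟩ <;> simp
  have hd : (0 : ℝ) ≤ (n : ℝ) - 1 := by
    have : (1 : ℝ) ≤ n := by exact_mod_cast hn
    linarith
  choose V hV hVs hVae using fun p => exists_nhds_ae_hausdorffMeasure_level hw
    (hΩs.finite_area p)
  obtain ⟨T, hTc, hT⟩ := TopologicalSpace.countable_cover_nhds
    fun p => interior_mem_nhds.2 (hV p)
  have hae := (ae_ball_iff hTc).2 fun p _ => hVae p
  filter_upwards [hae] with t ht
  have hsub : frontier (Ω ∩ {x | t < w x}) ⊆ frontier Ω ∪ {x | w x = t} := by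
    refine (frontier_inter_subset _ _).trans (union_subset_union inter_subset_left ?_)
    refine inter_subset_right.trans ((frontier_lt_subset_eq continuous_const hw.continuous).trans ?_)
    exact fun x hx => Eq.symm hx
  have hcov : ∀ x, ∃ p ∈ T, x ∈ interior (V p) := fun x => by
    have : x ∈ ⋃ p ∈ T, interior (V p) := hT ▸ mem_univ x
    simpa using this
  refine ⟨fun p => ?_, hausdorffMeasure_chart_image_eq_zero hd fun x => ?_⟩
  · obtain ⟨q, hqT, hpq⟩ := hcov p
    obtain ⟨W, hW, -, L, hL, hLW⟩ := exists_nhds_hausdorffMeasure_image_le hd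
      (mem_extChartAt_source (I := 𝓡 n) p) (hVs q (interior_subset hpq))
    obtain ⟨V', hV', hfin⟩ := hΩs.finite_area p
    refine ⟨V' ∩ W ∩ V q, inter_mem (inter_mem hV' hW) (mem_interior_iff_mem_nhds.1 hpq), ?_⟩
    have h2 : Measure.hausdorffMeasure ((n : ℝ) - 1)
        (extChartAt (𝓡 n) p '' ({x | w x = t} ∩ V q ∩ W)) < ⊤ := by
      refine (hLW _ inter_subset_right).trans_lt (ENNReal.mul_lt_top hL.lt_top ?_)
      exact (measure_mono (image_mono inter_subset_left)).trans_lt (ht q hqT).1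
    refine (measure_mono (t := _ ∪ _) ?_).trans_lt
      ((measure_union_le _ _).trans_lt (ENNReal.add_lt_top.2 ⟨hfin, h2⟩))
    rw [← image_union]
    refine image_mono ?_
    rintro x ⟨⟨hx, ⟨hx1, hx2⟩, hx3⟩, hx4⟩
    rcases hsub hx with h | h
    · exact Or.inl ⟨⟨h, hx1⟩, hx4⟩
    · exact Or.inr ⟨⟨h, hx3⟩, hx2⟩
  · obtain ⟨q, hqT, hpq⟩ := hcov x
    refine ⟨q, hVs q (interior_subset hpq), V q, mem_interior_iff_mem_nhds.1 hpq, ?_⟩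
    -- A boundary point outside three null sets is smooth: the singular points of `∂Ω`, the critical
    -- points on the level, and the intersection of the level with `∂Ω`.
    refine measure_mono_null ?_ (measure_union_null (hΩs.singular_null q) (ht q hqT).2)
    rw [← image_union]
    refine image_mono ?_
    rintro y ⟨⟨hy1, hy2⟩, hy3⟩
    by_contra hcon
    rw [mem_union, not_or] at hcon
    refine hy2 (IsSmoothBoundaryPoint.superlevel hw hΩ hy1 (fun h => ?_) (fun h ht => ?_)
      fun ht h => ?_)
    · exact by_contra fun h' => hcon.1 ⟨⟨h, h'⟩, hVs q hy3⟩
    · exact hcon.2 ⟨⟨ht, Or.inr h⟩, hy3⟩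
    · exact hcon.2 ⟨⟨ht, Or.inl h⟩, hy3⟩

end LevelSetsManifold

end CC

end

noncomputable section

namespace CC

variable {n : ℕ} {M : Type*} [TopologicalSpace M] [ChartedSpace (EuclideanSpace ℝ (Fin n)) M]
  [IsManifold (𝓡 n) ∞ M] [MeasurableSpace M] [T2Space M] [SecondCountableTopology M]
  [BorelSpace M]
  {F : Type*} [NormedAddCommGroup F] [NormedSpace ℝ F] [FiniteDimensional ℝ F]
  {U : M → Type*} [TopologicalSpace (TotalSpace F U)] [∀ x, NormedAddCommGroup (U x)]
  [∀ x, InnerProductSpace ℝ (U x)] [FiberBundle F U] [VectorBundle ℝ F U]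
  [ContMDiffVectorBundle ∞ F U (𝓡 n)] [IsContMDiffRiemannianBundle (𝓡 n) ∞ F U]

/-! ### The Cheeger inequality in `L¹` for functions smooth on `M`. -/

namespace CCSpace

variable (C : CCSpace n M F U)

/-- `c` is a lower bound for the quotients defining the mixed Cheeger constant. -/
def IsCheegerBound (Ω Γ : Set M) (c : ℝ≥0∞) : Prop :=
  ∀ A : Set M, IsOpen A → A.Nonempty → A ⊆ Ω → HasPiecewiseSmoothBoundary n A →
    frontier A ∩ Γ = ∅ → c * C.μ A ≤ C.horizontalPerimeter A Ω

theorem measure_lt_top_of_isCompact_closure {Ω : Set M} (hΩb : IsCompact (closure Ω)) :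
    C.μ Ω < ⊤ := by
  have : IsLocallyFiniteMeasure C.μ := C.vol.isLocallyFiniteMeasure
  exact (measure_mono subset_closure).trans_lt hΩb.measure_lt_top

/-- The Cheeger inequality in `L¹` for smooth functions. -/
theorem IsCheegerBound.mul_lintegral_le {C : CCSpace n M F U} {Ω Γ : Set M} {c : ℝ≥0∞}
    (hc : C.IsCheegerBound Ω Γ c) (hΩ : IsOpen Ω) (hΩb : IsCompact (closure Ω))
    (hΩs : HasPiecewiseSmoothBoundary n Ω) {w : M → ℝ}
    (hw : ContMDiff (𝓡 n) 𝓘(ℝ, ℝ) ∞ w) (hw0 : ∀ x, 0 ≤ w x) (hwΓ : tsupport w ∩ Γ = ∅) :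
    c * ∫⁻ x in Ω, ENNReal.ofReal (w x) ∂C.μ ≤ ∫⁻ x in Ω, ‖C.hd w x‖ₑ ∂C.μ := by
  refine C.mul_lintegral_le_lintegral_hd hΩ (C.measure_lt_top_of_isCompact_closure hΩb) hw hw0 ?_
  filter_upwards [hΩs.ae_superlevel hw hΩ] with t ht ht0
  rcases (Ω ∩ {x | t < w x}).eq_empty_or_nonempty with he | hne
  · rw [he, measure_empty, mul_zero]; exact bot_le
  refine hc _ (hΩ.inter (isOpen_lt continuous_const hw.continuous)) hne inter_subset_left ht ?_
  -- Since `t > 0`, the closure of the superlevel set lies in the support of `w`, which misses `Γ`.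
  rw [← subset_empty_iff, ← hwΓ]
  refine inter_subset_inter_left _ (frontier_subset_closure.trans (closure_mono fun x hx => ?_))
  exact (ht0.trans hx.2).ne'

end CCSpace

end CC

end

noncomputable section

namespace CC

/-! ### Mollification and its commutator with a vector field. -/

section Mollification

variable {n : ℕ}

/-- The mollification of `u` at scale `δ` with kernel `ρ`. -/
def mollify (ρ u : EuclideanSpace ℝ (Fin n) → ℝ) (δ : ℝ) (y : EuclideanSpace ℝ (Fin n)) : ℝ :=
  ∫ z, ρ z * u (y + δ • z)

variable {ρ u f : EuclideanSpace ℝ (Fin n) → ℝ} {δ : ℝ} {y : EuclideanSpace ℝ (Fin n)}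

theorem mollify_nonneg (hρ : ∀ z, 0 ≤ ρ z) (hu : ∀ y, 0 ≤ u y) : 0 ≤ mollify ρ u δ y :=
  integral_nonneg fun z => mul_nonneg (hρ z) (hu _)

/-- Translations are continuous in `L¹`. -/
theorem tendsto_lintegral_enorm_translate_sub (hf : Integrable f) :
    Tendsto (fun v => ∫⁻ y, ‖f (y + v) - f y‖ₑ) (𝓝 0) (𝓝 0) := by
  have hm : MemLp f 1 volume := memLp_one_iff_integrable.2 hf
  let g : C(EuclideanSpace ℝ (Fin n), C(EuclideanSpace ℝ (Fin n), EuclideanSpace ℝ (Fin n))) :=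
    (ContinuousMap.mk (fun a : EuclideanSpace ℝ (Fin n) × EuclideanSpace ℝ (Fin n) => a.2 + a.1)
      (by fun_prop)).curry
  have hmp : ∀ v, MeasurePreserving (g v) volume volume :=
    fun v => measurePreserving_add_right volume v
  have hc : Continuous fun v => Lp.compMeasurePreserving (g v) (hmp v) (hm.toLp f) :=
    continuous_const.compMeasurePreservingLp g.continuous hmp ENNReal.one_ne_top
  have h0 := (hc.tendsto 0).edist (tendsto_const_nhds (x := hm.toLp f))
  have he : ∀ v, edist (Lp.compMeasurePreserving (g v) (hmp v) (hm.toLp f)) (hm.toLp f)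
      = ∫⁻ y, ‖f (y + v) - f y‖ₑ := fun v => by
    rw [Lp.toLp_compMeasurePreserving hm (hmp v), Lp.edist_toLp_toLp, eLpNorm_one_eq_lintegral_enorm]
    rfl
  simp only [he] at h0
  simpa using h0

/-- After exchanging the integrals, the inner one is a translation error by `δ • z`, and these
shifts are uniformly small on the compact support of `ρ`. -/
theorem tendsto_lintegral_lintegral_translate_sub (hf : Integrable f) (hfm : Measurable f)
    (hρ : Continuous ρ) (hρc : HasCompactSupport ρ) :
    Tendsto (fun δ : ℝ => ∫⁻ y, ∫⁻ z, ‖ρ z * (f (y + δ • z) - f y)‖ₑ) (𝓝 0) (𝓝 0) := by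
  have hC : ∫⁻ z, ‖ρ z‖ₑ < ⊤ := (hρ.integrable_of_hasCompactSupport hρc).2
  obtain ⟨R, hR⟩ := hρc.isCompact.isBounded.exists_norm_le
  rw [ENNReal.tendsto_nhds_zero]
  intro ε hε
  obtain ⟨η, hη0, hη⟩ := ENNReal.exists_pos_mul_lt hC.ne hε.ne'
  have h1 := (ENNReal.tendsto_nhds_zero.1 (tendsto_lintegral_enorm_translate_sub hf)) η hη0
  rw [Metric.eventually_nhds_iff] at h1
  obtain ⟨r, hr, h1⟩ := h1
  have h2 : Tendsto (fun δ : ℝ => |δ| * (|R| + 1)) (𝓝 0) (𝓝 0) := by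
    have : Continuous fun δ : ℝ => |δ| * (|R| + 1) := by fun_prop
    simpa using this.tendsto 0
  filter_upwards [h2.eventually (gt_mem_nhds hr)] with δ hδ
  rw [lintegral_lintegral_swap]
  · calc ∫⁻ z, ∫⁻ y, ‖ρ z * (f (y + δ • z) - f y)‖ₑ
        ≤ ∫⁻ z, η * ‖ρ z‖ₑ := lintegral_mono fun z => by
          simp_rw [enorm_mul]
          rw [lintegral_const_mul _ (by fun_prop), mul_comm]
          by_cases hz : z ∈ tsupport ρ
          · gcongr
            refine h1 ?_
            rw [dist_zero_right, norm_smul, Real.norm_eq_abs]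
            refine lt_of_le_of_lt (mul_le_mul_of_nonneg_left ?_ (abs_nonneg δ)) hδ
            exact (hR z hz).trans ((le_abs_self R).trans (by linarith))
          · simp [image_eq_zero_of_notMem_tsupport hz]
      _ ≤ ε := by
          rw [lintegral_const_mul _ (by fun_prop)]; exact hη.le
  · have : Measurable (Function.uncurry fun (y z : EuclideanSpace ℝ (Fin n)) =>
        ‖ρ z * (f (y + δ • z) - f y)‖ₑ) := by
      have hρm := hρ.measurable
      unfold Function.uncurry
      fun_prop
    exact this.aemeasurable

theorem enorm_mollify_sub_le (hρ : Continuous ρ) (hρc : HasCompactSupport ρ) (hρ1 : ∫ z, ρ z = 1)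
    (hi : Integrable fun z => ρ z * f (y + δ • z)) :
    ‖mollify ρ f δ y - f y‖ₑ ≤ ∫⁻ z, ‖ρ z * (f (y + δ • z) - f y)‖ₑ := by
  have h : mollify ρ f δ y - f y = ∫ z, ρ z * (f (y + δ • z) - f y) := by
    simp_rw [mul_sub]
    rw [integral_sub hi ((hρ.integrable_of_hasCompactSupport hρc).mul_const _), integral_mul_const,
      hρ1, one_mul, mollify]
  rw [h]
  exact enorm_integral_le_lintegral_enorm _

/-- Substitution `t = y + δ • z`. It moves the dependence on `y` from `u` to the kernel, where it
can be differentiated. -/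
theorem integral_kernel_eq (k : EuclideanSpace ℝ (Fin n) → ℝ) (hδ : 0 < δ) :
    ∫ z, k z * u (y + δ • z)
      = ∫ t, u t * (|(δ ^ Module.finrank ℝ (EuclideanSpace ℝ (Fin n)))⁻¹| * k (-(δ⁻¹ • (y - t)))) := by
  have h1 := Measure.integral_comp_smul (volume : Measure (EuclideanSpace ℝ (Fin n)))
    (fun x => k (δ⁻¹ • x) * u (y + x)) δ
  simp only [smul_smul, inv_mul_cancel₀ hδ.ne', one_smul] at h1
  rw [h1, ← integral_add_left_eq_self (fun t => u t * _) y, smul_eq_mul, ← integral_const_mul]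
  refine integral_congr_ae (ae_of_all _ fun x => ?_)
  simp only [sub_add_cancel_left, smul_neg, neg_neg]
  ring

theorem mollify_eq_convolution (ρ u : EuclideanSpace ℝ (Fin n) → ℝ) (hδ : 0 < δ) :
    mollify ρ u δ = convolution u
      (fun s => |(δ ^ Module.finrank ℝ (EuclideanSpace ℝ (Fin n)))⁻¹| * ρ (-(δ⁻¹ • s)))
      (ContinuousLinearMap.mul ℝ ℝ) volume := by
  ext y
  rw [mollify, integral_kernel_eq ρ hδ, convolution_def]
  rfl

theorem hasCompactSupport_scaled_kernel {k : EuclideanSpace ℝ (Fin n) → ℝ}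
    (hk : HasCompactSupport k) (hδ : 0 < δ) (c : ℝ) :
    HasCompactSupport fun s => c * k (-(δ⁻¹ • s)) := by
  have h := hk.comp_homeomorph
    ((Homeomorph.smulOfNeZero δ⁻¹ (inv_ne_zero hδ.ne')).trans (Homeomorph.neg _))
  exact HasCompactSupport.mul_left (f := fun _ => c) h

theorem contDiff_mollify (hρ : ContDiff ℝ ∞ ρ) (hρc : HasCompactSupport ρ)
    (hu : LocallyIntegrable u) (hδ : 0 < δ) : ContDiff ℝ ∞ (mollify ρ u δ) := by
  rw [mollify_eq_convolution ρ u hδ]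
  exact HasCompactSupport.contDiff_convolution_right (n := ⊤) _
    (hasCompactSupport_scaled_kernel hρc hδ _) hu (by fun_prop)

theorem fderiv_scaled_kernel (hρ : Differentiable ℝ ρ) (c : ℝ) (s v : EuclideanSpace ℝ (Fin n)) :
    fderiv ℝ (fun s => c * ρ (-(δ⁻¹ • s))) s v
      = c * -(δ⁻¹ * fderiv ℝ ρ (-(δ⁻¹ • s)) v) := by
  have h1 : HasFDerivAt (fun s : EuclideanSpace ℝ (Fin n) => -(δ⁻¹ • s))
      (-(δ⁻¹ • ContinuousLinearMap.id ℝ (EuclideanSpace ℝ (Fin n)))) s :=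
    (-(δ⁻¹ • ContinuousLinearMap.id ℝ (EuclideanSpace ℝ (Fin n)))).hasFDerivAt
  have h2 : HasFDerivAt (fun s => ρ (-(δ⁻¹ • s))) _ s := (hρ (-(δ⁻¹ • s))).hasFDerivAt.comp s h1
  rw [(h2.const_mul c).fderiv]
  simp

theorem fderiv_mollify_apply (hρ : ContDiff ℝ ∞ ρ) (hρc : HasCompactSupport ρ)
    (hu : LocallyIntegrable u) (hδ : 0 < δ) (v : EuclideanSpace ℝ (Fin n)) :
    fderiv ℝ (mollify ρ u δ) y v = ∫ z, -(δ⁻¹ * fderiv ℝ ρ z v) * u (y + δ • z) := by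
  rw [mollify_eq_convolution ρ u hδ, integral_kernel_eq _ hδ]
  set c := |(δ ^ Module.finrank ℝ (EuclideanSpace ℝ (Fin n)))⁻¹|
  have hgc := hasCompactSupport_scaled_kernel hρc hδ c
  have hg : ContDiff ℝ ∞ fun s => c * ρ (-(δ⁻¹ • s)) := by fun_prop
  have hex : ConvolutionExists u (fderiv ℝ fun s => c * ρ (-(δ⁻¹ • s)))
      ((ContinuousLinearMap.mul ℝ ℝ).precompR (EuclideanSpace ℝ (Fin n))) volume :=
    HasCompactSupport.convolutionExists_right _ (hgc.fderiv ℝ) hu (hg.continuous_fderiv (by simp))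
  rw [(hgc.hasFDerivAt_convolution_right _ hu (hg.of_le (by simp)) y).fderiv, convolution_def,
    ContinuousLinearMap.integral_apply]
  · refine integral_congr_ae (ae_of_all _ fun t => ?_)
    simp only [ContinuousLinearMap.precompR_apply, ContinuousLinearMap.compL_apply,
      ContinuousLinearMap.comp_apply, ContinuousLinearMap.mul_apply']
    congr 1
    exact fderiv_scaled_kernel (hρ.differentiable (by simp)) _ _ _
  · exact hex y

/-- The kernel of the commutator of a vector field with a mollifier. -/
def commKernel (ρ : EuclideanSpace ℝ (Fin n) → ℝ)
    (a : EuclideanSpace ℝ (Fin n) → EuclideanSpace ℝ (Fin n)) (δ : ℝ)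
    (y z : EuclideanSpace ℝ (Fin n)) : ℝ :=
  ρ z * eucDiv a (y + δ • z) + fderiv ℝ ρ z (δ⁻¹ • (a (y + δ • z) - a y))

/-- The commutator of a vector field with a mollifier involves no derivative of the function. -/
theorem fderiv_mollify_sub_mollify {W : Set (EuclideanSpace ℝ (Fin n))} (hW : IsOpen W)
    (hρ : ContDiff ℝ ∞ ρ) (hρc : HasCompactSupport ρ) (hu : LocallyIntegrable u) (hδ : 0 < δ)
    (huW : ContDiffOn ℝ 1 u W) {a : EuclideanSpace ℝ (Fin n) → EuclideanSpace ℝ (Fin n)}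
    (ha : ContDiff ℝ ∞ a) (hyW : ∀ z ∈ tsupport ρ, y + δ • z ∈ W) :
    (Integrable fun z => ρ z * fderiv ℝ u (y + δ • z) (a (y + δ • z))) ∧
    fderiv ℝ (mollify ρ u δ) y (a y) - mollify ρ (fun x => fderiv ℝ u x (a x)) δ y
      = ∫ z, commKernel ρ a δ y z * u (y + δ • z) := by
  have hO : IsOpen ((fun z : EuclideanSpace ℝ (Fin n) => y + δ • z) ⁻¹' W) :=
    hW.preimage (by fun_prop)
  have hadd : ContDiff ℝ ∞ fun z : EuclideanSpace ℝ (Fin n) => y + δ • z := by fun_prop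
  have hcu : ContDiffOn ℝ 1 (fun z => u (y + δ • z))
      ((fun z : EuclideanSpace ℝ (Fin n) => y + δ • z) ⁻¹' W) :=
    huW.comp (hadd.of_le (by simp)).contDiffOn fun z hz => hz
  -- cutting off by a function with the support of `ρ`
  have hcut : ∀ {k v : EuclideanSpace ℝ (Fin n) → ℝ}, Continuous k → tsupport k ⊆ tsupport ρ →
      ContinuousOn v ((fun z : EuclideanSpace ℝ (Fin n) => y + δ • z) ⁻¹' W) →
      Integrable fun z => k z * v z := by
    intro k v hk hks hv
    have hkc : HasCompactSupport k := hρc.of_isClosed_subset (isClosed_tsupport k) hks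
    refine Continuous.integrable_of_hasCompactSupport ?_ hkc.mul_right
    refine continuous_of_tsupport fun z hz => ?_
    have hz' := hyW z (hks (tsupport_mul_subset_left hz))
    exact hk.continuousAt.mul (hv.continuousAt (hO.mem_nhds hz'))
  have hcd : ContinuousOn (fun z => fderiv ℝ u (y + δ • z) (a (y + δ • z)))
      ((fun z : EuclideanSpace ℝ (Fin n) => y + δ • z) ⁻¹' W) :=
    ((huW.continuousOn_fderiv_of_isOpen hW (by simp)).comp hadd.continuous.continuousOn
      fun z hz => hz).clm_apply (ha.continuous.comp hadd.continuous).continuousOn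
  have hdiv : Continuous fun z => eucDiv a (y + δ • z) := by
    rw [eucDiv_eq_traceCLM]
    exact (traceCLM n).continuous.comp
      ((ha.continuous_fderiv (by simp)).comp hadd.continuous)
  have hρd : ∀ v : EuclideanSpace ℝ (Fin n) → EuclideanSpace ℝ (Fin n), Continuous v →
      Continuous (fun z => fderiv ℝ ρ z (v z)) ∧
        tsupport (fun z => fderiv ℝ ρ z (v z)) ⊆ tsupport ρ := fun v hv =>
    ⟨(hρ.continuous_fderiv (by simp)).clm_apply hv,
      (closure_mono fun z (hz : fderiv ℝ ρ z (v z) ≠ 0) (h : fderiv ℝ ρ z = 0) => hz (by simp [h])).trans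
        (tsupport_fderiv_subset ℝ)⟩
  have hI1 := hcut hρ.continuous subset_rfl hcd
  have hI2 := hcut (v := fun z => u (y + δ • z) * eucDiv a (y + δ • z)) hρ.continuous subset_rfl
    (hcu.continuousOn.mul hdiv.continuousOn)
  have hI3 := hcut (hρd (fun z => a (y + δ • z)) (ha.continuous.comp hadd.continuous)).1
    (hρd _ (ha.continuous.comp hadd.continuous)).2 hcu.continuousOn
  have hI4 := hcut (hρd (fun _ => a y) continuous_const).1 (hρd _ continuous_const).2
    hcu.continuousOn
  refine ⟨hI1, ?_⟩
  have hZ1 : ContDiff ℝ 1 fun z => ρ z * u (y + δ • z) := by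
    refine contMDiff_iff_contDiff.1 (contMDiff_of_tsupport fun z hz => ContDiffAt.contMDiffAt ?_)
    have hz' := hyW z (tsupport_mul_subset_left hz)
    exact (hρ.of_le (by simp)).contDiffAt.mul (hcu.contDiffAt (hO.mem_nhds hz'))
  have hZ2 : ContDiff ℝ 1 fun z => a (y + δ • z) := (ha.comp hadd).of_le (by simp)
  -- Divergence theorem in the variable `z`: this one identity trades the derivative of `u` for
  -- derivatives of `ρ` and `a`.
  have key := integral_eucDiv_eq_zero (hZ1.smul hZ2) (HasCompactSupport.smul_right hρc.mul_right)
  have hdivZ : ∀ z, eucDiv (fun z => (ρ z * u (y + δ • z)) • a (y + δ • z)) z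
      = δ * (ρ z * (u (y + δ • z) * eucDiv a (y + δ • z)))
        + fderiv ℝ ρ z (a (y + δ • z)) * u (y + δ • z)
        + δ * (ρ z * fderiv ℝ u (y + δ • z) (a (y + δ • z))) := by
    intro z
    have hda : HasFDerivAt (fun z => a (y + δ • z))
        ((fderiv ℝ a (y + δ • z)).comp (δ • ContinuousLinearMap.id ℝ _)) z :=
      ((ha.differentiable (by simp) _).hasFDerivAt).comp z
        (((hasFDerivAt_id z).const_smul δ).const_add y)
    rw [eucDiv_smul (hZ1.differentiable (by simp) z) hda.differentiableAt]
    have hd : eucDiv (fun z => a (y + δ • z)) z = δ * eucDiv a (y + δ • z) := by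
      simp only [eucDiv_eq_traceCLM]
      rw [hda.fderiv, ContinuousLinearMap.comp_smul, ContinuousLinearMap.comp_id, map_smul,
        smul_eq_mul]
    rw [hd]
    by_cases hz : z ∈ tsupport ρ
    · have hdu : HasFDerivAt (fun z => u (y + δ • z))
          ((fderiv ℝ u (y + δ • z)).comp (δ • ContinuousLinearMap.id ℝ _)) z :=
        (((huW.contDiffAt (hW.mem_nhds (hyW z hz))).differentiableAt
          (by simp)).hasFDerivAt).comp z (((hasFDerivAt_id z).const_smul δ).const_add y)
      rw [((hρ.differentiable (by simp) z).hasFDerivAt.fun_mul hdu).fderiv]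
      simp only [ContinuousLinearMap.comp_smul, ContinuousLinearMap.comp_id, _root_.add_apply,
        _root_.smul_apply, smul_eq_mul]
      ring
    · have h1 : (fun z => ρ z * u (y + δ • z)) =ᶠ[𝓝 z] fun _ => 0 := by
        filter_upwards [(notMem_tsupport_iff_eventuallyEq.1 hz)] with x hx
        rw [hx]; simp
      rw [h1.fderiv_eq, image_eq_zero_of_notMem_tsupport hz,
        image_eq_zero_of_notMem_tsupport fun h => hz (tsupport_fderiv_subset ℝ h)]
      simp
  change ∫ z, eucDiv (fun z => (ρ z * u (y + δ • z)) • a (y + δ • z)) z = 0 at key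
  have hI23 : Integrable fun z => δ * (ρ z * (u (y + δ • z) * eucDiv a (y + δ • z)))
      + fderiv ℝ ρ z (a (y + δ • z)) * u (y + δ • z) := (hI2.const_mul _).add hI3
  have hI34 : Integrable fun z => δ⁻¹ * (fderiv ℝ ρ z (a (y + δ • z)) * u (y + δ • z))
      - δ⁻¹ * (fderiv ℝ ρ z (a y) * u (y + δ • z)) := (hI3.const_mul _).sub (hI4.const_mul _)
  rw [integral_congr_ae (ae_of_all _ hdivZ), integral_add hI23 (hI1.const_mul _),
    integral_add (hI2.const_mul _) hI3, integral_const_mul,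
    integral_const_mul] at key
  have hmol : mollify ρ (fun x => fderiv ℝ u x (a x)) δ y
      = - (∫ z, ρ z * (u (y + δ • z) * eucDiv a (y + δ • z)))
        - δ⁻¹ * ∫ z, fderiv ℝ ρ z (a (y + δ • z)) * u (y + δ • z) := by
    rw [mollify]
    generalize (∫ z, ρ z * fderiv ℝ u (y + δ • z) (a (y + δ • z))) = A at key ⊢
    generalize (∫ z, ρ z * (u (y + δ • z) * eucDiv a (y + δ • z))) = B at key ⊢
    linear_combination δ⁻¹ * key - (A + B) * inv_mul_cancel₀ hδ.ne'
  have hfd : fderiv ℝ (mollify ρ u δ) y (a y)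
      = - (δ⁻¹ * ∫ z, fderiv ℝ ρ z (a y) * u (y + δ • z)) := by
    rw [fderiv_mollify_apply hρ hρc hu hδ, ← integral_const_mul, ← integral_neg]
    exact integral_congr_ae (ae_of_all _ fun z => by ring)
  have hker : ∀ z, commKernel ρ a δ y z * u (y + δ • z)
      = ρ z * (u (y + δ • z) * eucDiv a (y + δ • z))
        + (δ⁻¹ * (fderiv ℝ ρ z (a (y + δ • z)) * u (y + δ • z))
          - δ⁻¹ * (fderiv ℝ ρ z (a y) * u (y + δ • z))) := fun z => by
    rw [commKernel, map_smul, map_sub, smul_eq_mul]; ring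
  rw [hmol, hfd, integral_congr_ae (ae_of_all _ hker),
    integral_add hI2 hI34,
    integral_sub (hI3.const_mul _) (hI4.const_mul _), integral_const_mul, integral_const_mul]
  ring

end Mollification

end CC

end

noncomputable section

namespace CC

/-! ### Friedrichs' lemma. -/

section Friedrichs

open scoped NNReal

variable {n : ℕ} {ρ u : EuclideanSpace ℝ (Fin n) → ℝ}
  {a : EuclideanSpace ℝ (Fin n) → EuclideanSpace ℝ (Fin n)}

theorem measurable_indicator_of_continuousOn {X : Type*} [TopologicalSpace X] [MeasurableSpace X]
    [OpensMeasurableSpace X] {W : Set X} (hW : IsOpen W) {f : X → ℝ}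
    (hf : ContinuousOn f W) : Measurable (W.indicator f) := by
  classical
  have h := hf.measurable_piecewise (g := fun _ => 0) continuousOn_const hW.measurableSet
  have he : W.piecewise f (fun _ => 0) = W.indicator f := by
    ext x
    by_cases hx : x ∈ W <;> simp [hx]
  rwa [he] at h

theorem measurable_uncurry_commKernel (hρ : ContDiff ℝ ∞ ρ) (ha : ContDiff ℝ ∞ a) (δ : ℝ) :
    Measurable (Function.uncurry (commKernel ρ a δ)) := by
  have hdiv : Continuous (eucDiv a) := by
    rw [eucDiv_eq_traceCLM]
    exact (traceCLM n).continuous.comp (ha.continuous_fderiv (by simp))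
  have hca := ha.continuous
  have hcρ := hρ.continuous
  have hc : Continuous (Function.uncurry (commKernel ρ a δ)) := by
    unfold commKernel Function.uncurry
    refine Continuous.add (by fun_prop) (Continuous.clm_apply ?_ (by fun_prop))
    exact (hρ.continuous_fderiv (by simp)).comp continuous_snd
  exact hc.measurable

/-- The Lipschitz bound on `a` compensates the factor `δ⁻¹`. The resulting bound is uniform in `δ`
and `y` and dominates the limits below. -/
theorem exists_bound_commKernel (hρ : ContDiff ℝ ∞ ρ) (hρc : HasCompactSupport ρ)
    (ha : ContDiff ℝ ∞ a) (hac : HasCompactSupport a) :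
    ∃ b : EuclideanSpace ℝ (Fin n) → ℝ, Continuous b ∧ HasCompactSupport b ∧ (∀ z, 0 ≤ b z) ∧
      ∀ δ > 0, ∀ y z, |commKernel ρ a δ y z| ≤ b z := by
  obtain ⟨K, hK⟩ := ContDiff.lipschitzWith_of_hasCompactSupport hac ha (by simp)
  have hdiv : Continuous (eucDiv a) := by
    rw [eucDiv_eq_traceCLM]
    exact (traceCLM n).continuous.comp (ha.continuous_fderiv (by simp))
  have hdc : HasCompactSupport (eucDiv a) := by
    rw [eucDiv_eq_traceCLM]
    exact (hac.fderiv ℝ).comp_left (g := traceCLM n) (map_zero _)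
  obtain ⟨D, hD⟩ := hdc.exists_bound_of_continuous hdiv
  have hρd := hρ.continuous_fderiv (by simp)
  have hcρ := hρ.continuous
  refine ⟨fun z => |ρ z| * D + ‖fderiv ℝ ρ z‖ * (K * ‖z‖), by fun_prop, ?_, fun z => ?_,
    fun δ hδ y z => ?_⟩
  · exact (hρc.norm.mul_right).add ((hρc.fderiv ℝ).norm.mul_right)
  · have := (norm_nonneg _).trans (hD z)
    positivity
  · rw [commKernel]
    refine (abs_add_le _ _).trans (add_le_add ?_ ?_)
    · rw [abs_mul]
      exact mul_le_mul_of_nonneg_left (hD _) (abs_nonneg _)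
    · refine ((fderiv ℝ ρ z).le_opNorm _).trans
        (mul_le_mul_of_nonneg_left ?_ (norm_nonneg (fderiv ℝ ρ z)))
      rw [norm_smul, norm_inv, Real.norm_of_nonneg hδ.le, inv_mul_le_iff₀ hδ, ← dist_eq_norm]
      refine (hK.dist_le_mul _ _).trans (le_of_eq ?_)
      rw [dist_eq_norm, add_sub_cancel_left, norm_smul, Real.norm_of_nonneg hδ.le]
      ring

/-- The integrand is the divergence of the compactly supported field `z ↦ ρ z • Da(y) z`: the linear
field `Da(y)` has constant divergence `eucDiv a y`. -/
theorem integral_commKernel_limit_eq_zero (hρ : ContDiff ℝ ∞ ρ) (hρc : HasCompactSupport ρ)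
    (y : EuclideanSpace ℝ (Fin n)) :
    ∫ z, (ρ z * eucDiv a y + fderiv ℝ ρ z (fderiv ℝ a y z)) = 0 := by
  have h := integral_eucDiv_eq_zero (Z := fun z => ρ z • fderiv ℝ a y z)
    ((hρ.of_le (by simp)).smul (fderiv ℝ a y).contDiff) hρc.smul_right
  rw [← h]
  refine integral_congr_ae (ae_of_all _ fun z => ?_)
  beta_reduce
  rw [eucDiv_smul (hρ.differentiable (by simp) z) (fderiv ℝ a y).differentiableAt]
  simp only [eucDiv_eq_traceCLM, ContinuousLinearMap.fderiv]

/-- By dominated convergence the difference quotient of `a` becomes `Da(y) z` and `u (y + δ • z)`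
becomes `u y`; the limiting kernel has integral zero. -/
theorem tendsto_integral_commKernel (hρ : ContDiff ℝ ∞ ρ) (hρc : HasCompactSupport ρ)
    (ha : ContDiff ℝ ∞ a) (hac : HasCompactSupport a) (hum : Measurable u) {B : ℝ}
    (huB : ∀ y, |u y| ≤ B) {y : EuclideanSpace ℝ (Fin n)} (huy : ContinuousAt u y) :
    Tendsto (fun δ => ∫ z, commKernel ρ a δ y z * u (y + δ • z)) (𝓝[>] (0 : ℝ)) (𝓝 0) := by
  obtain ⟨b, hb, hbc, hb0, hcb⟩ := exists_bound_commKernel hρ hρc ha hac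
  have hlim : ∫ z, (ρ z * eucDiv a y + fderiv ℝ ρ z (fderiv ℝ a y z)) * u y = 0 := by
    rw [integral_mul_const, integral_commKernel_limit_eq_zero hρ hρc, zero_mul]
  suffices h : Tendsto (fun δ => ∫ z, commKernel ρ a δ y z * u (y + δ • z)) (𝓝[>] (0 : ℝ))
      (𝓝 (∫ z, (ρ z * eucDiv a y + fderiv ℝ ρ z (fderiv ℝ a y z)) * u y)) by rwa [hlim] at h
  refine tendsto_integral_filter_of_dominated_convergence (fun z => b z * B) ?_ ?_
    ((hb.integrable_of_hasCompactSupport hbc).mul_const B) (ae_of_all _ fun z => ?_)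
  · refine Eventually.of_forall fun δ => Measurable.aestronglyMeasurable ?_
    exact ((measurable_uncurry_commKernel hρ ha δ).comp measurable_prodMk_left).mul
      (hum.comp (by fun_prop))
  · filter_upwards [self_mem_nhdsWithin] with δ hδ
    refine ae_of_all _ fun z => ?_
    rw [norm_mul]
    exact mul_le_mul (hcb δ hδ y z) (huB _) (norm_nonneg _) (hb0 z)
  · have h1 : Tendsto (fun δ : ℝ => y + δ • z) (𝓝[>] 0) (𝓝 y) := by
      have : Continuous fun δ : ℝ => y + δ • z := by fun_prop
      simpa using (this.tendsto 0).mono_left nhdsWithin_le_nhds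
    have hdiv : Continuous (eucDiv a) := by
      rw [eucDiv_eq_traceCLM]
      exact (traceCLM n).continuous.comp (ha.continuous_fderiv (by simp))
    refine Tendsto.mul (((hdiv.tendsto y).comp h1).const_mul (ρ z) |>.add ?_) (huy.tendsto.comp h1)
    refine ((fderiv ℝ ρ z).continuous.tendsto _).comp ?_
    have hl := ((ha.differentiable (by simp)) y).hasFDerivAt.lim z
      (c := fun δ : ℝ => δ⁻¹) (l := 𝓝[>] 0) ?_
    · simpa only [inv_inv] using hl
    · exact tendsto_norm_atTop_atTop.comp tendsto_inv_nhdsGT_zero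

theorem tendsto_lintegral_integral_commKernel (hρ : ContDiff ℝ ∞ ρ) (hρc : HasCompactSupport ρ)
    (ha : ContDiff ℝ ∞ a) (hac : HasCompactSupport a) (hum : Measurable u) {B : ℝ}
    (huB : ∀ y, |u y| ≤ B) {W : Set (EuclideanSpace ℝ (Fin n))} (hW : IsOpen W)
    (huW : ContinuousOn u W) {N : Set (EuclideanSpace ℝ (Fin n))} (hN : MeasurableSet N)
    (hNv : volume N < ⊤) :
    Tendsto (fun δ => ∫⁻ y in W ∩ N, ‖∫ z, commKernel ρ a δ y z * u (y + δ • z)‖ₑ)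
      (𝓝[>] (0 : ℝ)) (𝓝 0) := by
  obtain ⟨b, hb, hbc, hb0, hcb⟩ := exists_bound_commKernel hρ hρc ha hac
  have hbi : Integrable fun z => b z * B := (hb.integrable_of_hasCompactSupport hbc).mul_const B
  have h0 : ∫⁻ y in W ∩ N, ‖(0 : ℝ)‖ₑ = 0 := by simp
  suffices h : Tendsto (fun δ => ∫⁻ y in W ∩ N, ‖∫ z, commKernel ρ a δ y z * u (y + δ • z)‖ₑ)
      (𝓝[>] (0 : ℝ)) (𝓝 (∫⁻ y in W ∩ N, ‖(0 : ℝ)‖ₑ)) by rwa [h0] at h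
  refine tendsto_lintegral_filter_of_dominated_convergence
    (fun _ => ENNReal.ofReal (∫ z, b z * B)) ?_ ?_ ?_ ?_
  · refine Eventually.of_forall fun δ => Measurable.enorm ?_
    refine (StronglyMeasurable.integral_prod_right (Measurable.stronglyMeasurable ?_)).measurable
    refine Measurable.mul (measurable_uncurry_commKernel hρ ha δ) (hum.comp ?_)
    fun_prop
  · filter_upwards [self_mem_nhdsWithin] with δ hδ
    refine ae_of_all _ fun y => ?_
    rw [← ofReal_norm]
    refine ENNReal.ofReal_le_ofReal (norm_integral_le_of_norm_le hbi (ae_of_all _ fun z => ?_))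
    rw [norm_mul]
    exact mul_le_mul (hcb δ hδ y z) (huB _) (norm_nonneg _) (hb0 z)
  · rw [lintegral_const, Measure.restrict_apply_univ]
    exact ENNReal.mul_ne_top ENNReal.ofReal_ne_top
      ((measure_mono inter_subset_right).trans_lt hNv).ne
  · filter_upwards [ae_restrict_mem (hW.measurableSet.inter hN)] with y hy
    exact (tendsto_integral_commKernel hρ hρc ha hac hum huB
      (huW.continuousAt (hW.mem_nhds hy.1))).enorm

theorem mollify_congr {f g : EuclideanSpace ℝ (Fin n) → ℝ} {δ : ℝ} {y : EuclideanSpace ℝ (Fin n)}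
    (h : ∀ z ∈ tsupport ρ, f (y + δ • z) = g (y + δ • z)) : mollify ρ f δ y = mollify ρ g δ y := by
  refine integral_congr_ae (ae_of_all _ fun z => ?_)
  by_cases hz : z ∈ tsupport ρ
  · simp only [h z hz]
  · simp only [image_eq_zero_of_notMem_tsupport hz, zero_mul]

/-- **Friedrichs' lemma**: mollification approximates derivatives along smooth vector fields in
`L¹`, up to the boundary if the mollification only uses interior values. -/
theorem tendsto_lintegral_fderiv_mollify_sub (hρ : ContDiff ℝ ∞ ρ) (hρc : HasCompactSupport ρ)
    (hρ1 : ∫ z, ρ z = 1) (ha : ContDiff ℝ ∞ a) (hac : HasCompactSupport a)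
    (hum : Measurable u) {B : ℝ} (huB : ∀ y, |u y| ≤ B)
    {W : Set (EuclideanSpace ℝ (Fin n))} (hW : IsOpen W) (huW : ContDiffOn ℝ 1 u W)
    (hf : Integrable (W.indicator fun y => fderiv ℝ u y (a y)))
    {N : Set (EuclideanSpace ℝ (Fin n))} (hN : MeasurableSet N) (hNv : volume N < ⊤)
    {δ₀ : ℝ} (hδ₀ : 0 < δ₀)
    (hcone : ∀ y ∈ W ∩ N, ∀ z ∈ tsupport ρ, ∀ δ, 0 < δ → δ < δ₀ → y + δ • z ∈ W) :
    Tendsto (fun δ => ∫⁻ y in W ∩ N, ‖fderiv ℝ (mollify ρ u δ) y (a y) - fderiv ℝ u y (a y)‖ₑ)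
      (𝓝[>] (0 : ℝ)) (𝓝 0) := by
  have hui : LocallyIntegrable u := by
    refine (locallyIntegrable_const B).mono hum.aestronglyMeasurable (ae_of_all _ fun y => ?_)
    exact (huB y).trans (le_abs_self B)
  set f := W.indicator fun y => fderiv ℝ u y (a y) with hfdef
  have hfm : Measurable f := measurable_indicator_of_continuousOn hW
    ((huW.continuousOn_fderiv_of_isOpen hW (by simp)).clm_apply ha.continuous.continuousOn)
  have h1 := tendsto_lintegral_integral_commKernel hρ hρc ha hac hum huB hW huW.continuousOn hN hNv
  have h2 := (tendsto_lintegral_lintegral_translate_sub hf hfm hρ.continuous hρc).mono_left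
    (nhdsWithin_le_nhds (s := Ioi 0))
  have h12 := h1.add h2
  rw [add_zero] at h12
  refine tendsto_of_tendsto_of_tendsto_of_le_of_le' tendsto_const_nhds h12
    (Eventually.of_forall fun _ => bot_le) ?_
  filter_upwards [self_mem_nhdsWithin, mem_nhdsWithin_of_mem_nhds (gt_mem_nhds hδ₀)] with δ hδ hδ'
  have hm : Measurable fun y => ‖∫ z, commKernel ρ a δ y z * u (y + δ • z)‖ₑ := by
    refine Measurable.enorm (StronglyMeasurable.integral_prod_right
      (Measurable.stronglyMeasurable ?_)).measurable
    refine Measurable.mul (measurable_uncurry_commKernel hρ ha δ) (hum.comp ?_)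
    fun_prop
  refine le_trans ?_ (add_le_add_right (lintegral_mono' (Measure.restrict_le_self
    (s := W ∩ N)) le_rfl) _)
  rw [← lintegral_add_left hm]
  refine setLIntegral_mono' (hW.measurableSet.inter hN) fun y hy => ?_
  have hyW := fun z hz => hcone y hy z hz δ hδ hδ'
  obtain ⟨hi, hcomm⟩ := fderiv_mollify_sub_mollify hW hρ hρc hui hδ huW ha hyW
  have hmf : mollify ρ (fun x => fderiv ℝ u x (a x)) δ y = mollify ρ f δ y :=
    mollify_congr fun z hz => by rw [hfdef, indicator_of_mem (hyW z hz)]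
  have hfy : fderiv ℝ u y (a y) = f y := by rw [hfdef, indicator_of_mem hy.1]
  have hi' : Integrable fun z => ρ z * f (y + δ • z) := by
    refine hi.congr (ae_of_all _ fun z => ?_)
    by_cases hz : z ∈ tsupport ρ
    · simp only [hfdef, indicator_of_mem (hyW z hz)]
    · simp only [image_eq_zero_of_notMem_tsupport hz, zero_mul]
  -- The error splits into the commutator, free of derivatives of `u`, and the mollification error
  -- of the integrable function `f`, controlled by continuity of translations in `L¹`.
  have he : fderiv ℝ (mollify ρ u δ) y (a y) - fderiv ℝ u y (a y)
      = (∫ z, commKernel ρ a δ y z * u (y + δ • z)) + (mollify ρ f δ y - f y) := by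
    rw [← hcomm, hmf, hfy]; ring
  rw [he]
  exact (enorm_add_le _ _).trans (add_le_add le_rfl
    (enorm_mollify_sub_le hρ.continuous hρc hρ1 hi'))

theorem tendsto_lintegral_mollify_sub (hρ : Continuous ρ) (hρc : HasCompactSupport ρ)
    (hρ1 : ∫ z, ρ z = 1) (hum : Measurable u) {B : ℝ} (huB : ∀ y, |u y| ≤ B)
    (hu : Integrable u) :
    Tendsto (fun δ => ∫⁻ y, ‖mollify ρ u δ y - u y‖ₑ) (𝓝 (0 : ℝ)) (𝓝 0) := by
  refine tendsto_of_tendsto_of_tendsto_of_le_of_le tendsto_const_nhds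
    (tendsto_lintegral_lintegral_translate_sub hu hum hρ hρc) (fun _ => bot_le) fun δ => ?_
  refine lintegral_mono fun y => enorm_mollify_sub_le hρ hρc hρ1 ?_
  refine (hρ.integrable_of_hasCompactSupport hρc).mul_bdd (c := B) ?_ (ae_of_all _ fun z => huB _)
  exact (hum.comp (by fun_prop)).aestronglyMeasurable

end Friedrichs

end CC

end

noncomputable section

namespace CC

/-! ### Comparison with Lebesgue measure and inward directions at the boundary. -/

section ChartComparison

variable {n : ℕ} {M : Type*} [TopologicalSpace M] [ChartedSpace (EuclideanSpace ℝ (Fin n)) M]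
  [IsManifold (𝓡 n) ∞ M]

theorem contDiff_smul_of_tsupport_subset {E G : Type*} [NormedAddCommGroup E] [NormedSpace ℝ E]
    [NormedAddCommGroup G] [NormedSpace ℝ G] {T : Set E} (hT : IsOpen T) {χ : E → ℝ} {f : E → G}
    {m : WithTop ℕ∞} (hχ : ContDiff ℝ m χ) (hs : tsupport χ ⊆ T) (hf : ContDiffOn ℝ m f T) :
    ContDiff ℝ m fun x => χ x • f x := by
  refine contMDiff_iff_contDiff.1 (contMDiff_of_tsupport fun x hx => ContDiffAt.contMDiffAt ?_)
  have hxT := hs (tsupport_smul_subset_left χ f hx)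
  exact hχ.contDiffAt.smul (hf.contDiffAt (hT.mem_nhds hxT))

/-- A smooth function with compact support in the target of a chart, read on the manifold. -/
theorem contMDiff_source_indicator [T2Space M] (p : M) {g : EuclideanSpace ℝ (Fin n) → ℝ}
    (hg : ContDiff ℝ ∞ g) {L : Set (EuclideanSpace ℝ (Fin n))} (hL : IsCompact L)
    (hLT : L ⊆ (extChartAt (𝓡 n) p).target) (hg0 : ∀ y, y ∉ L → g y = 0) :
    ContMDiff (𝓡 n) 𝓘(ℝ, ℝ) ∞
      ((extChartAt (𝓡 n) p).source.indicator (g ∘ extChartAt (𝓡 n) p)) ∧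
    tsupport ((extChartAt (𝓡 n) p).source.indicator (g ∘ extChartAt (𝓡 n) p))
      ⊆ (extChartAt (𝓡 n) p).symm '' L := by
  have hcpt : IsCompact ((extChartAt (𝓡 n) p).symm '' L) :=
    hL.image_of_continuousOn ((continuousOn_extChartAt_symm p).mono hLT)
  have hsup : tsupport ((extChartAt (𝓡 n) p).source.indicator (g ∘ extChartAt (𝓡 n) p))
      ⊆ (extChartAt (𝓡 n) p).symm '' L := by
    refine closure_minimal (fun x hx => ?_) hcpt.isClosed
    have hxs : x ∈ (extChartAt (𝓡 n) p).source := by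
      by_contra h
      exact hx (indicator_of_notMem h _)
    refine ⟨extChartAt (𝓡 n) p x, ?_, (extChartAt (𝓡 n) p).left_inv hxs⟩
    by_contra h
    refine hx ?_
    rw [indicator_of_mem hxs, Function.comp_apply, hg0 _ h]
  refine ⟨contMDiff_of_tsupport fun x hx => ?_, hsup⟩
  have hxs : x ∈ (extChartAt (𝓡 n) p).source := by
    obtain ⟨y, hy, rfl⟩ := hsup hx
    exact (extChartAt (𝓡 n) p).map_target (hLT hy)
  have h1 : ContMDiffAt (𝓡 n) 𝓘(ℝ, ℝ) ∞ (g ∘ extChartAt (𝓡 n) p) x :=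
    hg.contMDiff.contMDiffAt.comp x (contMDiffAt_extChartAt' (by simpa using hxs))
  refine h1.congr_of_eventuallyEq ?_
  filter_upwards [(isOpen_extChartAt_source p).mem_nhds hxs] with z hz
  rw [indicator_of_mem hz]

/-- On compact subsets of a chart, a smooth measure is comparable to Lebesgue measure. -/
theorem SmoothMeasure.exists_lintegral_comparison [MeasurableSpace M] [BorelSpace M]
    (vol : SmoothMeasure n M) (p : M) {L : Set (EuclideanSpace ℝ (Fin n))} (hL : IsCompact L)
    (hLT : L ⊆ (extChartAt (𝓡 n) p).target) {Ω : Set M} (hΩ : IsOpen Ω) :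
    ∃ D : ℝ≥0∞, D ≠ ⊤ ∧ ∀ f : M → ℝ≥0∞, AEMeasurable f (vol.toMeasure.restrict Ω) →
      ((∀ x ∈ Ω, x ∉ (extChartAt (𝓡 n) p).symm '' L → f x = 0) →
        ∫⁻ x in Ω, f x ∂vol.toMeasure
          ≤ D * ∫⁻ y in (extChartAt (𝓡 n) p).symm ⁻¹' Ω ∩ L, f ((extChartAt (𝓡 n) p).symm y)) ∧
      ∫⁻ y in (extChartAt (𝓡 n) p).symm ⁻¹' Ω ∩ L, f ((extChartAt (𝓡 n) p).symm y)
        ≤ D * ∫⁻ x in Ω, f x ∂vol.toMeasure := by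
  have hS := (isOpen_extChartAt_source (I := 𝓡 n) p).measurableSet
  have hT := isOpen_extChartAt_target (I := 𝓡 n) p
  have hcd : ContinuousOn (vol.density p) L := (vol.continuousOn_density p).mono hLT
  obtain ⟨b, hb⟩ := hL.exists_bound_of_continuousOn hcd
  obtain ⟨b', hb'⟩ := hL.exists_bound_of_continuousOn
    (hcd.inv₀ fun y hy => (vol.density_pos p y (hLT hy)).ne')
  have hWL : MeasurableSet ((extChartAt (𝓡 n) p).symm ⁻¹' Ω ∩ L) := by
    have h1 := (continuousOn_extChartAt_symm (I := 𝓡 n) p).isOpen_inter_preimage hT hΩ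
    have h2 : (extChartAt (𝓡 n) p).symm ⁻¹' Ω ∩ L
        = ((extChartAt (𝓡 n) p).target ∩ (extChartAt (𝓡 n) p).symm ⁻¹' Ω) ∩ L := by
      ext y; exact ⟨fun h => ⟨⟨hLT h.2, h.1⟩, h.2⟩, fun h => ⟨h.1.2, h.2⟩⟩
    rw [h2]
    exact h1.measurableSet.inter hL.measurableSet
  set W := (extChartAt (𝓡 n) p).symm ⁻¹' Ω with hW
  -- `b` bounds the density on `L` and `b'` its reciprocal, one for each inequality.
  refine ⟨max (ENNReal.ofReal b) (ENNReal.ofReal b'), by simp, fun f hf => ?_⟩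
  have hfi : AEMeasurable (Ω.indicator f)
      (vol.toMeasure.restrict (extChartAt (𝓡 n) p).source) := by
    rw [aemeasurable_indicator_iff hΩ.measurableSet]
    refine hf.mono_measure ?_
    rw [Measure.restrict_restrict hΩ.measurableSet]
    exact Measure.restrict_mono inter_subset_left le_rfl
  have hsrc := vol.lintegral_source p hfi
  constructor
  · intro h0
    have h1 : ∫⁻ x in Ω, f x ∂vol.toMeasure
        = ∫⁻ x in (extChartAt (𝓡 n) p).source, Ω.indicator f x ∂vol.toMeasure := by
      rw [← lintegral_indicator hΩ.measurableSet, ← lintegral_indicator hS]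
      refine lintegral_congr fun x => ?_
      by_cases hx : x ∈ (extChartAt (𝓡 n) p).source
      · rw [indicator_of_mem hx]
      · rw [indicator_of_notMem hx]
        by_cases hxΩ : x ∈ Ω
        · rw [indicator_of_mem hxΩ]
          refine h0 x hxΩ fun h => hx ?_
          obtain ⟨y, hy, rfl⟩ := h
          exact (extChartAt (𝓡 n) p).map_target (hLT hy)
        · rw [indicator_of_notMem hxΩ]
    rw [h1, hsrc, ← lintegral_const_mul' _ _ (by simp), ← lintegral_indicator hWL,
      ← lintegral_indicator hT.measurableSet]
    refine lintegral_mono fun y => ?_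
    by_cases hyT : y ∈ (extChartAt (𝓡 n) p).target
    · rw [indicator_of_mem hyT]
      by_cases hyΩ : (extChartAt (𝓡 n) p).symm y ∈ Ω
      · rw [indicator_of_mem hyΩ]
        by_cases hyL : y ∈ L
        · rw [indicator_of_mem (show y ∈ W ∩ L from ⟨hyΩ, hyL⟩)]
          gcongr
          exact le_max_of_le_left (ENNReal.ofReal_le_ofReal ((le_abs_self _).trans (hb y hyL)))
        · rw [h0 _ hyΩ, mul_zero]
          · exact bot_le
          · rintro ⟨y', hy', he⟩
            rw [(extChartAt (𝓡 n) p).symm.injOn (hLT hy') hyT he] at hy'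
            exact hyL hy'
      · rw [indicator_of_notMem hyΩ, mul_zero]; exact bot_le
    · rw [indicator_of_notMem hyT]; exact bot_le
  · calc ∫⁻ y in W ∩ L, f ((extChartAt (𝓡 n) p).symm y)
        ≤ ∫⁻ y in W ∩ L, max (ENNReal.ofReal b) (ENNReal.ofReal b') *
            (ENNReal.ofReal (vol.density p y) *
              Ω.indicator f ((extChartAt (𝓡 n) p).symm y)) := by
          refine setLIntegral_mono' hWL fun y hy => ?_
          rw [indicator_of_mem (show (extChartAt (𝓡 n) p).symm y ∈ Ω from hy.1), ← mul_assoc]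
          refine le_mul_of_one_le_left bot_le ?_
          have hd := vol.density_pos p y (hLT hy.2)
          calc (1 : ℝ≥0∞) = ENNReal.ofReal ((vol.density p y)⁻¹ * vol.density p y) := by
                rw [inv_mul_cancel₀ hd.ne', ENNReal.ofReal_one]
            _ = ENNReal.ofReal (vol.density p y)⁻¹ * ENNReal.ofReal (vol.density p y) :=
                ENNReal.ofReal_mul (inv_nonneg.2 hd.le)
            _ ≤ _ := by
                gcongr
                exact le_max_of_le_right
                  (ENNReal.ofReal_le_ofReal ((le_abs_self _).trans (hb' y hy.2)))
      _ ≤ ∫⁻ y in (extChartAt (𝓡 n) p).target, max (ENNReal.ofReal b) (ENNReal.ofReal b') *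
            (ENNReal.ofReal (vol.density p y) *
              Ω.indicator f ((extChartAt (𝓡 n) p).symm y)) :=
          lintegral_mono_set fun y hy => hLT hy.2
      _ = max (ENNReal.ofReal b) (ENNReal.ofReal b') *
            ∫⁻ x in (extChartAt (𝓡 n) p).source, Ω.indicator f x ∂vol.toMeasure := by
          rw [hsrc, lintegral_const_mul' _ _ (by simp)]
      _ ≤ _ := by
          refine mul_le_mul_right ?_ _
          rw [← lintegral_indicator hΩ.measurableSet]
          exact setLIntegral_le_lintegral _ _

/-- Near interior points and smooth boundary points a domain is stable under small translations
in some open set of directions. -/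
theorem exists_cone {Ω : Set M} (hΩ : IsOpen Ω) {p : M}
    (hp : p ∈ Ω ∨ IsSmoothBoundaryPoint n Ω p) {O : Set M} (hO : IsOpen O) (hpO : p ∈ O) :
    ∃ R > 0, ∃ e : EuclideanSpace ℝ (Fin n), ∃ r > 0,
      Metric.closedBall (extChartAt (𝓡 n) p p) (2 * R) ⊆ (extChartAt (𝓡 n) p).target ∧
      (∀ y ∈ Metric.closedBall (extChartAt (𝓡 n) p p) R, (extChartAt (𝓡 n) p).symm y ∈ O) ∧
      ∀ y ∈ Metric.ball (extChartAt (𝓡 n) p p) R, (extChartAt (𝓡 n) p).symm y ∈ Ω →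
        ∀ z ∈ Metric.closedBall e r, ∀ δ : ℝ, 0 < δ →
          y + δ • z ∈ Metric.ball (extChartAt (𝓡 n) p p) R →
          (extChartAt (𝓡 n) p).symm (y + δ • z) ∈ Ω := by
  have hps := mem_extChartAt_source (I := 𝓡 n) p
  have hsymm : ∀ {Q : Set M}, IsOpen Q → p ∈ Q →
      ∀ᶠ y in 𝓝 (extChartAt (𝓡 n) p p), (extChartAt (𝓡 n) p).symm y ∈ Q := fun hQ hpQ => by
    have hct := continuousAt_extChartAt_symm (I := 𝓡 n) p
    rw [ContinuousAt, (extChartAt (𝓡 n) p).left_inv hps] at hct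
    exact hct.eventually (hQ.mem_nhds hpQ)
  have hgen : ∀ P : EuclideanSpace ℝ (Fin n) → Prop, (∀ᶠ y in 𝓝 (extChartAt (𝓡 n) p p), P y) →
      ∃ R > 0, Metric.closedBall (extChartAt (𝓡 n) p p) (2 * R) ⊆ (extChartAt (𝓡 n) p).target ∧
        ∀ y ∈ Metric.closedBall (extChartAt (𝓡 n) p p) R,
          (extChartAt (𝓡 n) p).symm y ∈ O ∧ P y := fun P hP => by
    obtain ⟨R, hR, hRs⟩ := Metric.nhds_basis_closedBall.mem_iff.1
      (inter_mem (extChartAt_target_mem_nhds (I := 𝓡 n) p) (inter_mem (hsymm hO hpO) hP))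
    refine ⟨R / 2, by positivity, fun y hy => (hRs ?_).1, fun y hy => (hRs ?_).2⟩
    · rwa [mul_div_cancel₀ R two_ne_zero] at hy
    · exact Metric.closedBall_subset_closedBall (by linarith) hy
  rcases hp with hp | ⟨V, g, hV, hpV, hg, hgp, hdg, hVg⟩
  · obtain ⟨R, hR, hRT, hRP⟩ := hgen _ (hsymm hΩ hp)
    -- Around an interior point a whole ball lies in `Ω`, so any ball of directions will do.
    exact ⟨R, hR, 0, 1, one_pos, hRT, fun y hy => (hRP y hy).1, fun y _ _ z _ δ _ hyz =>
      (hRP _ (Metric.ball_subset_closedBall hyz)).2⟩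
  · set y₀ := extChartAt (𝓡 n) p p with hy₀
    have hyp : (extChartAt (𝓡 n) p).symm y₀ = p := (extChartAt (𝓡 n) p).left_inv hps
    have hgd : ContMDiffAt (𝓡 n) 𝓘(ℝ, ℝ) ∞ g ((extChartAt (𝓡 n) p).symm y₀) := by
      rw [hyp]; exact hg.contMDiffAt (hV.mem_nhds hpV)
    have hyT : y₀ ∈ (extChartAt (𝓡 n) p).target := (extChartAt (𝓡 n) p).map_source hps
    have hG : ContDiffAt ℝ ∞ (g ∘ (extChartAt (𝓡 n) p).symm) y₀ :=
      (hgd.comp y₀ (contMDiffAt_extChartAt_symm hyT)).contDiffAt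
    set l := fderiv ℝ (g ∘ (extChartAt (𝓡 n) p).symm) y₀ with hl
    have hl0 : l ≠ 0 := by
      intro h
      refine hdg (ContinuousLinearMap.ext fun v => ?_)
      have h1 := fderiv_comp_extChartAt_symm hyT (hgd.mdifferentiableAt (by simp))
        (fun _ => (v : EuclideanSpace ℝ (Fin n)))
      rw [← hl, h, hyp] at h1
      exact h1.symm
    -- A direction in which the defining function decreases points into `Ω`.
    obtain ⟨e, he⟩ : ∃ e, l e < 0 := by
      obtain ⟨v, hv⟩ := DFunLike.ne_iff.1 hl0
      rcases lt_or_gt_of_ne hv with hv | hv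
      · exact ⟨v, hv⟩
      · exact ⟨-v, by rw [map_neg]; exact neg_lt_zero.2 hv⟩
    -- The margin `c * ‖e‖` leaves room for the linearization error of the defining function.
    obtain ⟨c, hc, hce⟩ : ∃ c > 0, l e + c * ‖e‖ < 0 := by
      have h1 : 0 < ‖e‖ + 1 := by positivity
      refine ⟨-l e / (2 * (‖e‖ + 1)), by apply div_pos <;> linarith, ?_⟩
      have h2 : -l e / (2 * (‖e‖ + 1)) * ‖e‖ ≤ -l e / 2 := by
        rw [div_mul_eq_mul_div, div_le_div_iff₀ (by positivity) two_pos]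
        nlinarith [norm_nonneg e]
      linarith
    obtain ⟨r, hr, hrc⟩ : ∃ r > 0, ∀ z ∈ Metric.closedBall e r, l z + c * ‖z‖ < 0 := by
      have hcont : Continuous fun z => l z + c * ‖z‖ := by fun_prop
      obtain ⟨r, hr, h⟩ := Metric.nhds_basis_closedBall.mem_iff.1
        ((isOpen_Iio.preimage hcont).mem_nhds hce)
      exact ⟨r, hr, fun z hz => h hz⟩
    -- Strict differentiability controls increments between any two points near `y₀`, so the same
    -- directions serve all base points `y`.
    have hstrict := (hG.hasStrictFDerivAt (by simp)).isLittleO.bound hc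
    obtain ⟨ε, hε, hεs⟩ := Metric.eventually_nhds_iff.1 hstrict
    obtain ⟨R, hR, hRT, hRP⟩ := hgen _
      ((Metric.eventually_nhds_iff_ball.2 ⟨ε, hε, fun _ h => h⟩ :
        ∀ᶠ y in 𝓝 (extChartAt (𝓡 n) p p), y ∈ Metric.ball (extChartAt (𝓡 n) p p) ε).and
        (hsymm hV hpV))
    refine ⟨R, hR, e, r, hr, hRT, fun y hy => (hRP y hy).1, fun y hy hyΩ z hz δ hδ hyz => ?_⟩
    have h1 := (hRP y (Metric.ball_subset_closedBall hy)).2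
    have h2 := (hRP _ (Metric.ball_subset_closedBall hyz)).2
    have h3 := @hεs (y + δ • z, y) (max_lt h2.1 h1.1)
    simp only [add_sub_cancel_left, Function.comp_apply, map_smul, smul_eq_mul, norm_smul,
      Real.norm_of_nonneg hδ.le] at h3
    have h4 := (hVg _ h1.2).1 hyΩ
    refine (hVg _ h2.2).2 ?_
    have h5 := (abs_le.1 h3).2
    have h6 := mul_neg_of_pos_of_neg hδ (hrc z hz)
    nlinarith

end ChartComparison

end CC

end

noncomputable section

namespace CC

/-! ### Approximation up to the boundary near a point. -/

section LocalApproximation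

/-- The kernel is a bump on the ball of directions `closedBall e r`, so at points of `W` near `y₀`
the mollification sees only values of `u` inside `W`, as Friedrichs' lemma requires. For small `δ`
the support grows by at most `(R - R₁) / 2`. -/
theorem exists_mollification {n d : ℕ} {y₀ e : EuclideanSpace ℝ (Fin n)} {R R₁ r : ℝ} (hr : 0 < r)
    (hR₁ : R₁ < R) {W : Set (EuclideanSpace ℝ (Fin n))} (hW : IsOpen W)
    (hcone : ∀ y ∈ W, ∀ z ∈ Metric.closedBall e r, ∀ δ : ℝ, 0 < δ →
      y + δ • z ∈ Metric.ball y₀ R → y + δ • z ∈ W)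
    {u : EuclideanSpace ℝ (Fin n) → ℝ} (hum : Measurable u) {B : ℝ} (hu0 : ∀ y, 0 ≤ u y)
    (huB : ∀ y, u y ≤ B) (huW : ContDiffOn ℝ 1 u W)
    (hus : ∀ y, y ∉ Metric.closedBall y₀ R₁ → u y = 0)
    {a : Fin d → EuclideanSpace ℝ (Fin n) → EuclideanSpace ℝ (Fin n)}
    (ha : ∀ i, ContDiff ℝ ∞ (a i)) (hac : ∀ i, HasCompactSupport (a i))
    (hf : ∀ i, Integrable (W.indicator fun y => fderiv ℝ u y (a i y))) {ε : ℝ≥0∞} (hε : 0 < ε) :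
    ∃ g : EuclideanSpace ℝ (Fin n) → ℝ, ContDiff ℝ ∞ g ∧ (∀ y, 0 ≤ g y) ∧
      (∀ y, y ∉ Metric.closedBall y₀ ((R₁ + R) / 2) → g y = 0) ∧
      ∫⁻ y, ‖g y - u y‖ₑ ≤ ε ∧
      ∀ i, ∫⁻ y in W ∩ Metric.closedBall y₀ ((R₁ + R) / 2),
        ‖fderiv ℝ g y (a i y) - fderiv ℝ u y (a i y)‖ₑ ≤ ε := by
  have huB' : ∀ y, |u y| ≤ B := fun y => by rw [abs_of_nonneg (hu0 y)]; exact huB y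
  have hui : Integrable u := by
    have h := integrableOn_const (μ := (volume : Measure (EuclideanSpace ℝ (Fin n))))
      (s := Metric.closedBall y₀ R₁) (C := B) (hs := measure_closedBall_lt_top.ne)
    have h' := (integrable_indicator_iff measurableSet_closedBall).2 h
    refine h'.mono hum.aestronglyMeasurable (ae_of_all _ fun y => ?_)
    by_cases hy : y ∈ Metric.closedBall y₀ R₁
    · rw [indicator_of_mem hy]; exact (huB' y).trans (le_abs_self B)
    · rw [hus y hy]; simp
  let b : ContDiffBump e := ⟨r / 2, r, by positivity, by linarith⟩
  set ρ := b.normed volume with hρdef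
  have hρ : ContDiff ℝ ∞ ρ := b.contDiff_normed
  have hρc : HasCompactSupport ρ := b.hasCompactSupport_normed
  have hρ1 : ∫ z, ρ z = 1 := b.integral_normed
  have hρs : ∀ z ∈ tsupport ρ, z ∈ Metric.closedBall e r := fun z hz => by
    rw [hρdef, b.tsupport_normed_eq] at hz; exact hz
  set η := (R - R₁) / 2 with hη
  have hη0 : 0 < η := by rw [hη]; linarith
  set δ₁ := η / (‖e‖ + r + 1) with hδ₁
  have hden : 0 < ‖e‖ + r + 1 := by positivity
  have hδ₁0 : 0 < δ₁ := by positivity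
  have hsmall : ∀ z ∈ Metric.closedBall e r, ∀ δ, 0 < δ → δ < δ₁ → ‖δ • z‖ < η := by
    intro z hz δ hδ hδ'
    rw [norm_smul, Real.norm_of_nonneg hδ.le]
    have h1 : ‖z‖ ≤ ‖e‖ + r + 1 := by
      have := norm_le_norm_add_norm_sub' z e
      rw [mem_closedBall_iff_norm] at hz
      linarith
    calc δ * ‖z‖ ≤ δ * (‖e‖ + r + 1) := by gcongr
      _ < δ₁ * (‖e‖ + r + 1) := by gcongr
      _ = η := by rw [hδ₁]; field_simp
  have hconv1 := (tendsto_lintegral_mollify_sub hρ.continuous hρc hρ1 hum huB' hui).mono_left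
    (nhdsWithin_le_nhds (s := Ioi 0))
  have hconv2 := fun i => tendsto_lintegral_fderiv_mollify_sub hρ hρc hρ1 (ha i) (hac i) hum huB'
    hW huW (hf i) (measurableSet_closedBall (x := y₀) (ε := (R₁ + R) / 2))
    measure_closedBall_lt_top hδ₁0 (fun y hy z hz δ hδ hδ' => by
      refine hcone y hy.1 z (hρs z hz) δ hδ ?_
      have h1 := hsmall z (hρs z hz) δ hδ hδ'
      have h2 := hy.2
      rw [mem_closedBall_iff_norm] at h2
      rw [mem_ball_iff_norm, add_sub_right_comm]
      refine (norm_add_le _ _).trans_lt ?_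
      have : η + (R₁ + R) / 2 = R := by rw [hη]; ring
      linarith)
  have hev := ((ENNReal.tendsto_nhds_zero.1 hconv1 ε hε).and (eventually_all.2 fun i =>
    ENNReal.tendsto_nhds_zero.1 (hconv2 i) ε hε)).and
    ((eventually_mem_nhdsWithin (a := (0 : ℝ)) (s := Ioi 0)).and
      (mem_nhdsWithin_of_mem_nhds (gt_mem_nhds hδ₁0)))
  obtain ⟨δ, ⟨h1, h2⟩, hδ, hδ'⟩ := hev.exists
  refine ⟨mollify ρ u δ, contDiff_mollify hρ hρc hui.locallyIntegrable hδ,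
    fun y => mollify_nonneg (fun z => b.nonneg_normed z) hu0, fun y hy => ?_, h1, h2⟩
  rw [mollify_congr (g := fun _ => 0)]
  · simp [mollify]
  · intro z hz
    refine hus _ fun h => hy ?_
    have h1 := hsmall z (hρs z hz) δ hδ hδ'
    rw [mem_closedBall_iff_norm] at h ⊢
    have h3 : y - y₀ = (y + δ • z - y₀) - δ • z := by abel
    rw [h3]
    refine (norm_sub_le _ _).trans ?_
    have : R₁ + η = (R₁ + R) / 2 := by rw [hη]; ring
    linarith

variable {n : ℕ} {M : Type*} [TopologicalSpace M] [ChartedSpace (EuclideanSpace ℝ (Fin n)) M]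
  [IsManifold (𝓡 n) ∞ M] [MeasurableSpace M] [T2Space M] [SecondCountableTopology M]
  [BorelSpace M]
  {F : Type*} [NormedAddCommGroup F] [NormedSpace ℝ F] [FiniteDimensional ℝ F]
  {U : M → Type*} [TopologicalSpace (TotalSpace F U)] [∀ x, NormedAddCommGroup (U x)]
  [∀ x, InnerProductSpace ℝ (U x)] [FiberBundle F U] [VectorBundle ℝ F U]
  [ContMDiffVectorBundle ∞ F U (𝓡 n)] [IsContMDiffRiemannianBundle (𝓡 n) ∞ F U]

namespace CCSpace

variable (C : CCSpace n M F U)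

/-- Near interior and smooth boundary points, a function which is smooth in `Ω` can be approximated
by functions which are smooth up to the boundary. -/
theorem exists_local_approx {Ω : Set M} (hΩ : IsOpen Ω) {p : M}
    (hp : p ∈ Ω ∨ IsSmoothBoundaryPoint n Ω p) {O : Set M} (hO : IsOpen O) (hpO : p ∈ O) :
    ∃ V : Set M, IsOpen V ∧ p ∈ V ∧ V ⊆ O ∧ ∀ u : M → ℝ, ContMDiffOn (𝓡 n) 𝓘(ℝ, ℝ) ∞ u Ω →
      ∀ B : ℝ, (∀ x ∈ Ω, 0 ≤ u x ∧ u x ≤ B) → ∫⁻ x in Ω, ‖C.hd u x‖ₑ ∂C.μ < ⊤ →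
      ∀ K : Set M, IsCompact K → K ⊆ V → (∀ x ∈ Ω, x ∉ K → u x = 0) → ∀ ε : ℝ≥0∞, 0 < ε →
      ∃ w : M → ℝ, ContMDiff (𝓡 n) 𝓘(ℝ, ℝ) ∞ w ∧ HasCompactSupport w ∧ tsupport w ⊆ V ∧
        (∀ x, 0 ≤ w x) ∧
        ∫⁻ x in Ω, ‖w x - u x‖ₑ ∂C.μ + ∫⁻ x in Ω, ‖C.hd (fun z => w z - u z) x‖ₑ ∂C.μ ≤ ε := by
  obtain ⟨N, d, σ, c, hN, hpN, hc, hσ, hframe⟩ := exists_frame n F U p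
  obtain ⟨R, hR, e, r, hr, hRT, hRO, hcone⟩ := exists_cone hΩ hp (hO.inter hN) ⟨hpO, hpN⟩
  have hT := isOpen_extChartAt_target (I := 𝓡 n) p
  set ψ := extChartAt (𝓡 n) p with hψ
  have hball : Metric.closedBall (ψ p) R ⊆ ψ.target :=
    (Metric.closedBall_subset_closedBall (by linarith)).trans hRT
  refine ⟨ψ.source ∩ ψ ⁻¹' Metric.ball (ψ p) R, isOpen_extChartAt_preimage' p Metric.isOpen_ball,
    ⟨mem_extChartAt_source p, Metric.mem_ball_self hR⟩, fun x hx => ?_,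
    fun u hu B huB hufin K hK hKV huK ε hε => ?_⟩
  · rw [← ψ.left_inv hx.1]
    exact (hRO _ (Metric.ball_subset_closedBall hx.2)).1
  set W : Set (EuclideanSpace ℝ (Fin n)) := (ψ.target ∩ ψ.symm ⁻¹' Ω) ∩ Metric.ball (ψ p) R
    with hWdef
  have hW : IsOpen W :=
    ((continuousOn_extChartAt_symm p).isOpen_inter_preimage hT hΩ).inter Metric.isOpen_ball
  -- the function and the frame in the chart
  have hKc : IsCompact (ψ '' K) :=
    hK.image_of_continuousOn ((continuousOn_extChartAt p).mono fun x hx => (hKV hx).1)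
  obtain ⟨R₁, hR₁, hKR₁⟩ := exists_lt_subset_ball hKc.isClosed
    (image_subset_iff.2 fun x hx => (hKV hx).2)
  have huc : ContDiffOn ℝ ∞ (u ∘ ψ.symm) W :=
    (hu.comp ((contMDiffOn_extChartAt_symm p).mono fun y hy => hy.1.1)
      fun y hy => hy.1.2).contDiffOn
  -- Extension by zero may jump across `∂Ω`. This does no harm: derivatives are compared only on
  -- `W`, where the kernel looks inward.
  set v := W.indicator (u ∘ ψ.symm) with hvdef
  have hvW : ∀ y ∈ W, v =ᶠ[𝓝 y] u ∘ ψ.symm := fun y hy => by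
    filter_upwards [hW.mem_nhds hy] with z hz using indicator_of_mem hz _
  have hvs : ∀ y, y ∉ Metric.closedBall (ψ p) R₁ → v y = 0 := fun y hy => by
    by_cases hyW : y ∈ W
    · rw [hvdef, indicator_of_mem hyW]
      refine huK _ hyW.1.2 fun h => hy (Metric.ball_subset_closedBall (hKR₁ ⟨_, h, ?_⟩))
      exact ψ.right_inv hyW.1.1
    · exact indicator_of_notMem hyW _
  set L := Metric.closedBall (ψ p) ((R₁ + R) / 2) with hL
  have hLR : L ⊆ Metric.ball (ψ p) R := Metric.closedBall_subset_ball (by linarith)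
  have hLT : L ⊆ ψ.target := hLR.trans (Metric.ball_subset_closedBall.trans hball)
  have hLc : IsCompact L := isCompact_closedBall _ _
  have hWL : ψ.symm ⁻¹' Ω ∩ L = W ∩ L := by
    ext y; exact ⟨fun h => ⟨⟨⟨hLT h.2, h.1⟩, hLR h.2⟩, h.2⟩, fun h => ⟨h.1.1.2, h.2⟩⟩
  have hKL : ∀ x ∈ K, x ∈ ψ.symm '' L := fun x hx => by
    refine ⟨ψ x, ?_, ψ.left_inv (hKV hx).1⟩
    exact Metric.ball_subset_closedBall (Metric.ball_subset_ball (by linarith)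
      (hKR₁ (mem_image_of_mem ψ hx)))
  have hsLc : IsClosed (ψ.symm '' L) :=
    (hLc.image_of_continuousOn ((continuousOn_extChartAt_symm p).mono hLT)).isClosed
  -- The bump is `1` on the ball of radius `R`, which contains `W`. The frame fields become globally
  -- smooth with compact support and are unchanged on `W`.
  let b : ContDiffBump (ψ p) := ⟨R, 2 * R, hR, by linarith⟩
  set a : Fin d → EuclideanSpace ℝ (Fin n) → EuclideanSpace ℝ (Fin n) :=
    fun i y => b y • chartField p (fun x => C.anchor x (σ i x)) y with hadef
  have hbT : tsupport b ⊆ ψ.target := by rw [b.tsupport_eq]; exact hRT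
  have ha : ∀ i, ContDiff ℝ ∞ (a i) := fun i => contDiff_smul_of_tsupport_subset hT b.contDiff hbT
    (contDiffOn_chartField p (C.contMDiff_anchor_comp (σ i)))
  have hac : ∀ i, HasCompactSupport (a i) := fun i => b.hasCompactSupport.smul_right
  have haW : ∀ i, ∀ y ∈ Metric.closedBall (ψ p) R, ∀ h : M → ℝ,
      MDifferentiableAt (𝓡 n) 𝓘(ℝ, ℝ) h (ψ.symm y) →
      fderiv ℝ (h ∘ ψ.symm) y (a i y) = C.hd h (ψ.symm y) (σ i (ψ.symm y)) :=
    fun i y hy h hh => by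
      simp only [hadef, b.one_of_mem_closedBall hy, one_smul]
      exact fderiv_comp_extChartAt_symm (hball hy) hh _
  have huD : ∀ y ∈ W, MDifferentiableAt (𝓡 n) 𝓘(ℝ, ℝ) u (ψ.symm y) := fun y hy =>
    (hu.contMDiffAt (hΩ.mem_nhds hy.1.2)).mdifferentiableAt (by simp)
  have hWb : ∀ y ∈ W, y ∈ Metric.closedBall (ψ p) R := fun y hy =>
    Metric.ball_subset_closedBall hy.2
  have hvC : ContDiffOn ℝ 1 v W :=
    (huc.of_le (by simp)).congr fun y hy => indicator_of_mem hy _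
  have hvd : ∀ i, ContinuousOn (fun y => fderiv ℝ v y (a i y)) W := fun i =>
    (hvC.continuousOn_fderiv_of_isOpen hW (by simp)).clm_apply (ha i).continuous.continuousOn
  obtain ⟨D, hD, hcomp⟩ := C.vol.exists_lintegral_comparison p hLc hLT hΩ
  have hf : ∀ i, Integrable (W.indicator fun y => fderiv ℝ v y (a i y)) := fun i => by
    refine ⟨(measurable_indicator_of_continuousOn hW (hvd i)).aestronglyMeasurable, ?_⟩
    have h1 : ∫⁻ y, ‖W.indicator (fun y => fderiv ℝ v y (a i y)) y‖ₑ
        ≤ ∫⁻ y in W ∩ L, ENNReal.ofReal c * ‖C.hd u (ψ.symm y)‖ₑ := by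
      rw [← lintegral_indicator (hW.measurableSet.inter hLc.measurableSet)]
      refine lintegral_mono fun y => ?_
      by_cases hyW : y ∈ W
      · by_cases hyL : y ∈ L
        · rw [indicator_of_mem hyW, indicator_of_mem (show y ∈ W ∩ L from ⟨hyW, hyL⟩),
            (hvW y hyW).fderiv_eq, haW i y (hWb y hyW) u (huD y hyW), mul_comm]
          refine (ContinuousLinearMap.le_opENorm _ _).trans ?_
          gcongr
          rw [← ofReal_norm]
          exact ENNReal.ofReal_le_ofReal (hσ _ (hRO y (hWb y hyW)).2 i)
        · have h0 : v =ᶠ[𝓝 y] fun _ => 0 := by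
            filter_upwards [hLc.isClosed.isOpen_compl.mem_nhds hyL] with z hz
            refine hvs z fun h => hz ?_
            exact Metric.closedBall_subset_closedBall (by linarith) h
          rw [indicator_of_mem hyW, h0.fderiv_eq]
          simp
      · rw [indicator_of_notMem hyW]; simp
    refine h1.trans_lt ?_
    rw [lintegral_const_mul' _ _ ENNReal.ofReal_ne_top, ← hWL]
    refine ENNReal.mul_lt_top ENNReal.ofReal_lt_top ((hcomp (fun x => ‖C.hd u x‖ₑ)
      (by simpa only [enorm_norm] using (C.aemeasurable_norm_hd hΩ hu C.μ).enorm)).2.trans_lt (ENNReal.mul_lt_top hD.lt_top hufin))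
  -- approximation
  set Q : ℝ≥0∞ := D + D * (ENNReal.ofReal c * d) with hQ
  have hQt : Q ≠ ⊤ := by
    rw [hQ]
    exact ENNReal.add_ne_top.2 ⟨hD, ENNReal.mul_ne_top hD
      (ENNReal.mul_ne_top ENNReal.ofReal_ne_top (ENNReal.natCast_ne_top d))⟩
  obtain ⟨ε', hε', hQε⟩ := ENNReal.exists_pos_mul_lt hQt hε.ne'
  obtain ⟨g, hg, hg0, hgs, hgv, hgd⟩ := exists_mollification (u := v) (B := max B 0) (ε := ε') hr hR₁ hW
    (fun y hy z hz δ hδ hyz => ⟨⟨hball (Metric.ball_subset_closedBall hyz),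
      hcone y hy.2 hy.1.2 z hz δ hδ hyz⟩, hyz⟩)
    (measurable_indicator_of_continuousOn hW huc.continuousOn)
    (fun y => indicator_nonneg (fun y hy => (huB _ hy.1.2).1) y)
    (fun y => indicator_le' (fun y hy => le_max_of_le_left (huB _ hy.1.2).2)
      (fun _ _ => le_max_right _ _) y) hvC hvs ha hac hf hε'
  obtain ⟨hw, hws⟩ := contMDiff_source_indicator p hg hLc hLT hgs
  set w := ψ.source.indicator (g ∘ ψ) with hwdef
  have hwc : HasCompactSupport w :=
    (hLc.image_of_continuousOn ((continuousOn_extChartAt_symm p).mono hLT)).of_isClosed_subset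
      (isClosed_tsupport w) hws
  have hwg : ∀ y ∈ ψ.target, w (ψ.symm y) = g y := fun y hy => by
    rw [hwdef, indicator_of_mem (ψ.map_target hy), Function.comp_apply, ψ.right_inv hy]
  refine ⟨w, hw, hwc, hws.trans ?_, fun x => indicator_nonneg (fun x _ => hg0 _) x, ?_⟩
  · rintro - ⟨y, hy, rfl⟩
    exact ⟨ψ.map_target (hLT hy), by rw [mem_preimage, ψ.right_inv (hLT hy)]; exact hLR hy⟩
  have hwuC : ContMDiffOn (𝓡 n) 𝓘(ℝ, ℝ) ∞ (fun z => w z - u z) Ω := hw.contMDiffOn.sub hu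
  have hzero : ∀ x ∈ Ω, x ∉ ψ.symm '' L → w x - u x = 0 := fun x hx hxL => by
    rw [huK x hx fun h => hxL (hKL x h),
      image_eq_zero_of_notMem_tsupport fun h => hxL (hws h), sub_zero]
  have e1 : ∫⁻ x in Ω, ‖w x - u x‖ₑ ∂C.μ ≤ D * ε' := by
    refine ((hcomp (fun x => ‖w x - u x‖ₑ)
      (hwuC.continuousOn.aemeasurable hΩ.measurableSet).enorm).1 fun x hx hxL => ?_).trans ?_
    · rw [hzero x hx hxL, enorm_zero]
    · refine mul_le_mul_right (le_trans ?_ hgv) D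
      rw [hWL]
      refine (setLIntegral_mono' (hW.measurableSet.inter hLc.measurableSet)
        fun y hy => ?_).trans (setLIntegral_le_lintegral (W ∩ L) _)
      rw [hwg y hy.1.1.1, hvdef, indicator_of_mem hy.1]
      rfl
  have e2 : ∫⁻ x in Ω, ‖C.hd (fun z => w z - u z) x‖ₑ ∂C.μ
      ≤ D * (ENNReal.ofReal c * (d * ε')) := by
    refine ((hcomp (fun x => ‖C.hd (fun z => w z - u z) x‖ₑ) (by
      simpa only [enorm_norm] using (C.aemeasurable_norm_hd hΩ hwuC C.μ).enorm)).1
        fun x hx hxL => ?_).trans (mul_le_mul_right ?_ D)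
    · suffices h : C.hd (fun z => w z - u z) x = 0 by
        rw [← ofReal_norm, h, norm_zero, ENNReal.ofReal_zero]
      refine C.hd_eq_zero_of_notMem_tsupport ?_
      rw [notMem_tsupport_iff_eventuallyEq]
      filter_upwards [hΩ.mem_nhds hx, hsLc.isOpen_compl.mem_nhds hxL] with z hz hzL
      exact hzero z hz hzL
    · rw [hWL]
      calc ∫⁻ y in W ∩ L, ‖C.hd (fun z => w z - u z) (ψ.symm y)‖ₑ
          ≤ ∫⁻ y in W ∩ L, ENNReal.ofReal c *
              ∑ i, ‖fderiv ℝ g y (a i y) - fderiv ℝ v y (a i y)‖ₑ := by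
            refine setLIntegral_mono' (hW.measurableSet.inter hLc.measurableSet) fun y hy => ?_
            have hyR := hWb y hy.1
            have hwd : MDifferentiableAt (𝓡 n) 𝓘(ℝ, ℝ) w (ψ.symm y) :=
              hw.mdifferentiable (by simp) _
            have hwgy : w ∘ ψ.symm =ᶠ[𝓝 y] g := by
              filter_upwards [hT.mem_nhds (hLT hy.2)] with z hz using hwg z hz
            have hfr := hframe _ (hRO y hyR).2 (C.hd (fun z => w z - u z) (ψ.symm y))
            rw [← ofReal_norm]
            refine (ENNReal.ofReal_le_ofReal hfr).trans ?_
            rw [ENNReal.ofReal_mul hc.le, ENNReal.ofReal_sum_of_nonneg fun i _ => abs_nonneg _]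
            refine mul_le_mul_right (Finset.sum_le_sum fun i _ => le_of_eq ?_) _
            rw [C.hd_sub hwd (huD y hy.1), _root_.sub_apply, ← haW i y hyR w hwd,
              ← haW i y hyR u (huD y hy.1), hwgy.fderiv_eq, ← (hvW y hy.1).fderiv_eq,
              ← Real.norm_eq_abs, ofReal_norm]
        _ ≤ ENNReal.ofReal c * (d * ε') := by
            rw [lintegral_const_mul' _ _ ENNReal.ofReal_ne_top, lintegral_finsetSum']
            · refine mul_le_mul_right ((Finset.sum_le_sum fun i _ => hgd i).trans ?_) _
              simp
            · intro i _
              refine ((ContinuousOn.sub ?_ (hvd i)).mono inter_subset_left).aemeasurable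
                (hW.measurableSet.inter hLc.measurableSet) |>.enorm
              exact ((hg.continuous_fderiv (by simp)).clm_apply (ha i).continuous).continuousOn
  calc _ ≤ D * ε' + D * (ENNReal.ofReal c * (d * ε')) := add_le_add e1 e2
    _ = ε' * Q := by rw [hQ]; ring
    _ ≤ ε := hQε.le

end CCSpace

end LocalApproximation

end CC

end

noncomputable section

namespace CC

/-! ### Approximation up to the boundary by a partition of unity. -/

section GlobalApproximation

variable {n : ℕ} {M : Type*} [TopologicalSpace M] [ChartedSpace (EuclideanSpace ℝ (Fin n)) M]
  [IsManifold (𝓡 n) ∞ M] [MeasurableSpace M] [T2Space M] [SecondCountableTopology M]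
  [BorelSpace M]
  {F : Type*} [NormedAddCommGroup F] [NormedSpace ℝ F] [FiniteDimensional ℝ F]
  {U : M → Type*} [TopologicalSpace (TotalSpace F U)] [∀ x, NormedAddCommGroup (U x)]
  [∀ x, InnerProductSpace ℝ (U x)] [FiberBundle F U] [VectorBundle ℝ F U]
  [ContMDiffVectorBundle ∞ F U (𝓡 n)] [IsContMDiffRiemannianBundle (𝓡 n) ∞ F U]

namespace CCSpace

variable (C : CCSpace n M F U)

theorem aemeasurable_enorm_hd {O : Set M} (hO : IsOpen O) {u : M → ℝ}
    (hu : ContMDiffOn (𝓡 n) 𝓘(ℝ, ℝ) ∞ u O) :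
    AEMeasurable (fun x => ‖C.hd u x‖ₑ) (C.μ.restrict O) := by
  simpa only [enorm_norm] using (C.aemeasurable_norm_hd hO hu C.μ).enorm

theorem enorm_hd_eq_zero {u : M → ℝ} {x : M} (h : u =ᶠ[𝓝 x] fun _ => 0) : ‖C.hd u x‖ₑ = 0 := by
  rw [← ofReal_norm, C.hd_eq_zero_of_notMem_tsupport (notMem_tsupport_iff_eventuallyEq.2 h),
    norm_zero, ENNReal.ofReal_zero]

/-- Locally a frame dominates the norm by a continuous function; compactness makes the bound global.
-/
theorem exists_bound_norm_hd {f : M → ℝ} (hf : ContMDiff (𝓡 n) 𝓘(ℝ, ℝ) ∞ f) {K : Set M}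
    (hK : IsCompact K) : ∃ B : ℝ, ∀ x ∈ K, ‖C.hd f x‖ ≤ B := by
  refine hK.induction_on (p := fun s => ∃ B : ℝ, ∀ x ∈ s, ‖C.hd f x‖ ≤ B) ⟨0, by simp⟩
    (fun s t hst ⟨B, hB⟩ => ⟨B, fun x hx => hB x (hst hx)⟩)
    (fun s t ⟨B, hB⟩ ⟨B', hB'⟩ => ⟨max B B', fun x hx => ?_⟩) fun x _ => ?_
  · exact hx.elim (fun h => le_max_of_le_left (hB x h)) fun h => le_max_of_le_right (hB' x h)
  · obtain ⟨N, d, σ, c, hN, hpN, hc, -, hframe⟩ := exists_frame n F U x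
    have hcont : ContinuousOn (fun y => c * ∑ i, |C.hd f y (σ i y)|) univ := by
      refine continuousOn_const.mul (continuousOn_finsetSum _ fun i _ => ?_)
      exact (C.continuousOn_hd_apply isOpen_univ hf.contMDiffOn (σ i)).abs
    have hev : ∀ᶠ y in 𝓝 x, c * ∑ i, |C.hd f y (σ i y)| < c * ∑ i, |C.hd f x (σ i x)| + 1 :=
      (continuousOn_univ.1 hcont).continuousAt.eventually (gt_mem_nhds (lt_add_one _))
    refine ⟨_, mem_nhdsWithin_of_mem_nhds (inter_mem (hN.mem_nhds hpN) hev),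
      c * ∑ i, |C.hd f x (σ i x)| + 1, fun y hy => ?_⟩
    exact (hframe y hy.1 _).trans hy.2.le

theorem hd_sum {ι : Type*} (s : Finset ι) {u : ι → M → ℝ} {x : M}
    (hu : ∀ i ∈ s, MDifferentiableAt (𝓡 n) 𝓘(ℝ, ℝ) (u i) x) :
    C.hd (fun z => ∑ i ∈ s, u i z) x = ∑ i ∈ s, C.hd (u i) x := by
  ext v
  rw [hd_apply, (differential_sum s hu).2, _root_.sum_apply, _root_.sum_apply]
  rfl

/-- Leibniz rule and boundedness of `u`: the finite-energy assumption of `exists_local_approx`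
survives multiplication by a partition of unity. -/
theorem lintegral_enorm_hd_mul_lt_top {Ω : Set M} (hΩ : IsOpen Ω) (hΩb : IsCompact (closure Ω))
    {f u : M → ℝ} (hf : ContMDiff (𝓡 n) 𝓘(ℝ, ℝ) ∞ f) (hf0 : ∀ x, 0 ≤ f x) (hf1 : ∀ x, f x ≤ 1)
    (hu : ContMDiffOn (𝓡 n) 𝓘(ℝ, ℝ) ∞ u Ω) {B : ℝ} (huB : ∀ x ∈ Ω, 0 ≤ u x ∧ u x ≤ B)
    (hufin : ∫⁻ x in Ω, ‖C.hd u x‖ₑ ∂C.μ < ⊤) :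
    ∫⁻ x in Ω, ‖C.hd (fun z => f z * u z) x‖ₑ ∂C.μ < ⊤ := by
  obtain ⟨D, hD⟩ := C.exists_bound_norm_hd hf hΩb
  have h1 : ∫⁻ x in Ω, ‖C.hd (fun z => f z * u z) x‖ₑ ∂C.μ
      ≤ ∫⁻ x in Ω, (‖C.hd u x‖ₑ + ENNReal.ofReal (B * D)) ∂C.μ := by
    refine setLIntegral_mono' hΩ.measurableSet fun x hx => ?_
    rw [C.hd_mul (hf.mdifferentiable (by simp) x)
      ((hu.contMDiffAt (hΩ.mem_nhds hx)).mdifferentiableAt (by simp))]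
    simp only [← ofReal_norm]
    rw [← ENNReal.ofReal_add (norm_nonneg _)]
    · refine ENNReal.ofReal_le_ofReal ((norm_add_le _ _).trans (add_le_add ?_ ?_))
      · rw [norm_smul, Real.norm_of_nonneg (hf0 x)]
        exact mul_le_of_le_one_left (norm_nonneg _) (hf1 x)
      · rw [norm_smul, Real.norm_of_nonneg (huB x hx).1]
        exact mul_le_mul (huB x hx).2 (hD x (subset_closure hx)) (norm_nonneg _)
          ((huB x hx).1.trans (huB x hx).2)
    · exact mul_nonneg ((huB x hx).1.trans (huB x hx).2)
        ((norm_nonneg _).trans (hD x (subset_closure hx)))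
  refine h1.trans_lt ?_
  rw [lintegral_add_right _ measurable_const, lintegral_const, Measure.restrict_apply_univ]
  exact ENNReal.add_lt_top.2 ⟨hufin,
    ENNReal.mul_lt_top ENNReal.ofReal_lt_top (C.measure_lt_top_of_isCompact_closure hΩb)⟩

/-- A function which is smooth in `Ω`, and whose support avoids the singular boundary points, can be
approximated by functions which are smooth up to the boundary. -/
theorem exists_global_approx {Ω : Set M} (hΩ : IsOpen Ω) (hΩb : IsCompact (closure Ω))
    {K O : Set M} (hK : IsCompact K) (hO : IsOpen O) (hKO : K ⊆ O)
    (hKs : ∀ p ∈ K, p ∈ Ω ∨ IsSmoothBoundaryPoint n Ω p)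
    {u : M → ℝ} (hu : ContMDiffOn (𝓡 n) 𝓘(ℝ, ℝ) ∞ u Ω) {B : ℝ}
    (huB : ∀ x ∈ Ω, 0 ≤ u x ∧ u x ≤ B) (hufin : ∫⁻ x in Ω, ‖C.hd u x‖ₑ ∂C.μ < ⊤)
    (huK : ∀ x ∈ Ω, x ∉ K → u x = 0) {ε : ℝ≥0∞} (hε : 0 < ε) :
    ∃ w : M → ℝ, ContMDiff (𝓡 n) 𝓘(ℝ, ℝ) ∞ w ∧ tsupport w ⊆ O ∧ (∀ x, 0 ≤ w x) ∧
      ∫⁻ x in Ω, ‖w x - u x‖ₑ ∂C.μ + ∫⁻ x in Ω, ‖C.hd (fun z => w z - u z) x‖ₑ ∂C.μ ≤ ε := by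
  have : SigmaCompactSpace M := sigmaCompactSpace_of_secondCountable n M
  choose! V hVo hpV hVO hV using fun p (hp : p ∈ K) =>
    C.exists_local_approx hΩ (hKs p hp) hO (hKO hp)
  obtain ⟨t, htK, htc⟩ := hK.elim_nhds_subcover V fun p hp => (hVo p hp).mem_nhds (hpV p hp)
  obtain ⟨f, hf⟩ := SmoothPartitionOfUnity.exists_isSubordinate (𝓡 n) hK.isClosed
    (fun i : t => V i) (fun i => hVo i (htK i i.2)) fun x hx => by
      obtain ⟨p, hp, hxp⟩ := mem_iUnion₂.1 (htc hx)
      exact mem_iUnion.2 ⟨⟨p, hp⟩, hxp⟩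
  -- Each of the finitely many patches receives the same share of the error.
  obtain ⟨ε', hε', hεε⟩ := ENNReal.exists_pos_mul_lt (ENNReal.natCast_ne_top (Fintype.card t)) hε.ne'
  have hfs : ∀ i, ContMDiff (𝓡 n) 𝓘(ℝ, ℝ) ∞ (f i) := fun i => (f i).contMDiff
  have hfu : ∀ i, ContMDiffOn (𝓡 n) 𝓘(ℝ, ℝ) ∞ (fun z => f i z * u z) Ω := fun i =>
    (hfs i).contMDiffOn.mul hu
  have hex := fun i : t => hV i (htK i i.2) (fun z => f i z * u z) (hfu i) B
    (fun x hx => ⟨mul_nonneg (f.nonneg i x) (huB x hx).1,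
      (mul_le_of_le_one_left (huB x hx).1 (f.le_one i x)).trans (huB x hx).2⟩)
    (C.lintegral_enorm_hd_mul_lt_top hΩ hΩb (hfs i) (f.nonneg i) (f.le_one i) hu huB hufin)
    (K ∩ tsupport (f i)) (hK.inter_right (isClosed_tsupport _))
    (inter_subset_right.trans (hf i)) (fun x hx hxK => by
      by_cases h : x ∈ K
      · rw [image_eq_zero_of_notMem_tsupport fun h' => hxK ⟨h, h'⟩, zero_mul]
      · rw [huK x hx h, mul_zero]) ε' hε'
  choose w hws hwc hwV hw0 hwε using hex
  have hsum : ∀ x ∈ Ω, (∑ i, w i x) - u x = ∑ i, (w i x - f i x * u x) := fun x hx => by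
    rw [Finset.sum_sub_distrib, ← Finset.sum_mul]
    by_cases h : x ∈ K
    · have := f.sum_eq_one h
      rw [finsum_eq_sum_of_fintype] at this
      rw [this, one_mul]
    · rw [huK x hx h, mul_zero]
  have hwu : ∀ i, ContMDiffOn (𝓡 n) 𝓘(ℝ, ℝ) ∞ (fun z => w i z - f i z * u z) Ω := fun i =>
    (hws i).contMDiffOn.sub (hfu i)
  refine ⟨fun x => ∑ i, w i x, contMDiff_finsetSum fun i _ => hws i, ?_,
    fun x => Finset.sum_nonneg fun i _ => hw0 i x, ?_⟩
  · have hcl : IsClosed (⋃ i, tsupport (w i)) := isClosed_iUnion_of_finite fun i =>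
      isClosed_tsupport _
    refine (closure_minimal (fun x hx => ?_) hcl).trans
      (iUnion_subset fun i => (hwV i).trans (hVO i (htK i i.2)))
    by_contra h
    refine hx (Finset.sum_eq_zero fun i _ => image_eq_zero_of_notMem_tsupport fun h' => h ?_)
    exact mem_iUnion.2 ⟨i, h'⟩
  · have e1 : ∫⁻ x in Ω, ‖(∑ i, w i x) - u x‖ₑ ∂C.μ
        ≤ ∑ i, ∫⁻ x in Ω, ‖w i x - f i x * u x‖ₑ ∂C.μ := by
      rw [← lintegral_finsetSum' _ fun i _ =>
        ((hwu i).continuousOn.aemeasurable hΩ.measurableSet).enorm]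
      refine setLIntegral_mono' hΩ.measurableSet fun x hx => ?_
      rw [hsum x hx]
      exact enorm_sum_le _ _
    have e2 : ∫⁻ x in Ω, ‖C.hd (fun z => (∑ i, w i z) - u z) x‖ₑ ∂C.μ
        ≤ ∑ i, ∫⁻ x in Ω, ‖C.hd (fun z => w i z - f i z * u z) x‖ₑ ∂C.μ := by
      rw [← lintegral_finsetSum' _ fun i _ => C.aemeasurable_enorm_hd hΩ (hwu i)]
      refine setLIntegral_mono' hΩ.measurableSet fun x hx => ?_
      rw [C.hd_congr (v := fun z => ∑ i, (w i z - f i z * u z))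
        (by filter_upwards [hΩ.mem_nhds hx] with z hz using hsum z hz),
        C.hd_sum _ fun i _ => ((hwu i).contMDiffAt (hΩ.mem_nhds hx)).mdifferentiableAt (by simp)]
      simp only [← ofReal_norm]
      rw [← ENNReal.ofReal_sum_of_nonneg fun i _ => norm_nonneg _]
      exact ENNReal.ofReal_le_ofReal (norm_sum_le _ _)
    calc _ ≤ _ := add_le_add e1 e2
      _ ≤ ∑ _i : t, ε' := by
        rw [← Finset.sum_add_distrib]
        exact Finset.sum_le_sum fun i _ => hwε i
      _ = ε' * (Fintype.card t) := by simp [mul_comm]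
      _ ≤ ε := hεε.le

end CCSpace

end GlobalApproximation

end CC

end

noncomputable section

namespace CC

/-! ### Covers of null sets by small balls. -/

section SmallBalls

/-- A compact set of vanishing Hausdorff measure can be covered by finitely many small balls. -/
theorem exists_finite_ball_cover {X : Type*} [MetricSpace X] [MeasurableSpace X] [BorelSpace X]
    {E : Set X} (hE : IsCompact E) {m : ℕ} (h0 : Measure.hausdorffMeasure (m : ℝ) E = 0)
    {r₀ : ℝ} (hr₀ : 0 < r₀) {η : ℝ≥0∞} (hη : 0 < η) :
    ∃ (ι : Type) (s : Finset ι) (y : ι → X) (r : ι → ℝ), (∀ j, y j ∈ E) ∧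
      (∀ j, 0 < r j ∧ r j ≤ r₀) ∧ E ⊆ ⋃ j ∈ s, Metric.ball (y j) (r j) ∧
      ∑ j ∈ s, ENNReal.ofReal (r j ^ m) ≤ η := by
  have hη2 : η / 2 ≠ 0 := (ENNReal.half_pos hη.ne').ne'
  obtain ⟨t, hts, htd, htsum⟩ : ∃ t : ℕ → Set X, E ⊆ ⋃ j, t j ∧
      (∀ j, Metric.ediam (t j) ≤ ENNReal.ofReal (r₀ / 2)) ∧
      ∑' j, ⨆ _ : (t j).Nonempty, Metric.ediam (t j) ^ (m : ℝ) < η / 2 := by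
    rw [Measure.hausdorffMeasure_apply] at h0
    have h1 := (iSup₂_le_iff.1 h0.le) (ENNReal.ofReal (r₀ / 2))
      (ENNReal.ofReal_pos.2 (half_pos hr₀))
    have h2 := h1.trans_lt (pos_iff_ne_zero.2 hη2)
    simp only [iInf_lt_iff] at h2
    obtain ⟨t, h3, h4, h5⟩ := h2
    exact ⟨t, h3, h4, h5⟩
  obtain ⟨ε, hε0, hεsum⟩ := ENNReal.exists_pos_sum_of_countable' hη2 ℕ
  choose y hy using fun j : {j // (t j ∩ E).Nonempty} => j.2
  have hdfin : ∀ j, Metric.ediam (t j) ≠ ⊤ := fun j => ((htd j).trans_lt ENNReal.ofReal_lt_top).ne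
  -- Radii slightly above the diameters, the excess being absorbed by the summable `ε j`, let open
  -- balls centred in `E` cover it. Compactness then leaves finitely many.
  have hr : ∀ j : {j // (t j ∩ E).Nonempty}, ∃ r, (Metric.ediam (t j)).toReal < r ∧ r ≤ r₀ ∧
      ENNReal.ofReal (r ^ m) ≤ (⨆ _ : (t j).Nonempty, Metric.ediam (t j) ^ (m : ℝ)) + ε j := by
    intro j
    have hne : (t j).Nonempty := j.2.mono inter_subset_left
    have hd0 : (Metric.ediam (t j)).toReal < r₀ := by
      have := ENNReal.toReal_mono ENNReal.ofReal_ne_top (htd j)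
      rw [ENNReal.toReal_ofReal (by positivity)] at this
      linarith
    have hc : Continuous fun r : ℝ => ENNReal.ofReal (r ^ m) :=
      ENNReal.continuous_ofReal.comp (continuous_pow m)
    have hval : ENNReal.ofReal ((Metric.ediam (t j)).toReal ^ m)
        = ⨆ _ : (t j).Nonempty, Metric.ediam (t j) ^ (m : ℝ) := by
      rw [iSup_pos hne, ENNReal.rpow_natCast, ENNReal.ofReal_pow ENNReal.toReal_nonneg,
        ENNReal.ofReal_toReal (hdfin j)]
    have hev : ∀ᶠ r in 𝓝 (Metric.ediam (t j)).toReal, ENNReal.ofReal (r ^ m)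
        < (⨆ _ : (t j).Nonempty, Metric.ediam (t j) ^ (m : ℝ)) + ε j := by
      refine hc.continuousAt.eventually (gt_mem_nhds ?_)
      beta_reduce
      rw [hval]
      refine ENNReal.lt_add_right ?_ (hε0 _).ne'
      rw [← hval]
      exact ENNReal.ofReal_ne_top
    obtain ⟨r, ⟨h3, h2⟩, h1⟩ := (((hev.and (gt_mem_nhds hd0)).filter_mono
      (nhdsWithin_le_nhds (s := Ioi (Metric.ediam (t j)).toReal))).and
      self_mem_nhdsWithin).exists
    exact ⟨r, h1, le_of_lt h2, h3.le⟩
  choose r hr1 hr2 hr3 using hr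
  have hcov : E ⊆ ⋃ j, Metric.ball (y j) (r j) := fun x hx => by
    obtain ⟨j, hj⟩ := mem_iUnion.1 (hts hx)
    refine mem_iUnion.2 ⟨⟨j, x, hj, hx⟩, ?_⟩
    refine lt_of_le_of_lt ?_ (hr1 ⟨j, x, hj, hx⟩)
    rw [dist_edist]
    exact ENNReal.toReal_mono (hdfin j) (Metric.edist_le_ediam_of_mem hj (hy ⟨j, x, hj, hx⟩).1)
  obtain ⟨s, hs⟩ := hE.elim_finite_subcover _ (fun j => Metric.isOpen_ball) hcov
  refine ⟨_, s, y, r, fun j => (hy j).2,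
    fun j => ⟨ENNReal.toReal_nonneg.trans_lt (hr1 j), hr2 j⟩, hs, ?_⟩
  calc ∑ j ∈ s, ENNReal.ofReal (r j ^ m)
      ≤ ∑ j ∈ s, ((⨆ _ : (t j).Nonempty, Metric.ediam (t j) ^ (m : ℝ)) + ε j) :=
        Finset.sum_le_sum fun j _ => hr3 j
    _ ≤ ∑' j : {j // (t j ∩ E).Nonempty},
          ((⨆ _ : (t j).Nonempty, Metric.ediam (t j) ^ (m : ℝ)) + ε j) := ENNReal.sum_le_tsum s
    _ ≤ ∑' j, ((⨆ _ : (t j).Nonempty, Metric.ediam (t j) ^ (m : ℝ)) + ε j) :=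
        ENNReal.tsum_comp_le_tsum_of_injective Subtype.val_injective _
    _ ≤ η / 2 + η / 2 := by
        rw [ENNReal.tsum_add]
        exact add_le_add htsum.le hεsum.le
    _ = η := ENNReal.add_halves η

end SmallBalls

/-! ### The singular boundary and the cost of a cutoff. -/

section Cutoff

variable {n : ℕ} {M : Type*} [TopologicalSpace M] [ChartedSpace (EuclideanSpace ℝ (Fin n)) M]
  [IsManifold (𝓡 n) ∞ M] [MeasurableSpace M] [T2Space M] [SecondCountableTopology M]
  [BorelSpace M]
  {F : Type*} [NormedAddCommGroup F] [NormedSpace ℝ F] [FiniteDimensional ℝ F]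
  {U : M → Type*} [TopologicalSpace (TotalSpace F U)] [∀ x, NormedAddCommGroup (U x)]
  [∀ x, InnerProductSpace ℝ (U x)] [FiberBundle F U] [VectorBundle ℝ F U]
  [ContMDiffVectorBundle ∞ F U (𝓡 n)] [IsContMDiffRiemannianBundle (𝓡 n) ∞ F U]

/-- The same defining function serves nearby frontier points. Its differential stays nonzero by
continuity, and it vanishes there: `g ≤ 0` as a limit from `Ω`, `g ≥ 0` because the point is not in
`Ω`. -/
theorem IsSmoothBoundaryPoint.eventually {Ω : Set M} (hΩ : IsOpen Ω) {p : M}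
    (hp : IsSmoothBoundaryPoint n Ω p) :
    ∀ᶠ q in 𝓝 p, q ∈ frontier Ω → IsSmoothBoundaryPoint n Ω q := by
  obtain ⟨V, g, hV, hpV, hg, hgp, hdg, hVg⟩ := hp
  have hps := mem_extChartAt_source (I := 𝓡 n) p
  have hO : IsOpen ((extChartAt (𝓡 n) p).target ∩ (extChartAt (𝓡 n) p).symm ⁻¹' V) :=
    (continuousOn_extChartAt_symm p).isOpen_inter_preimage (isOpen_extChartAt_target p) hV
  have hG : ContDiffOn ℝ ∞ (g ∘ (extChartAt (𝓡 n) p).symm)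
      ((extChartAt (𝓡 n) p).target ∩ (extChartAt (𝓡 n) p).symm ⁻¹' V) :=
    (hg.comp ((contMDiffOn_extChartAt_symm p).mono inter_subset_left) fun y hy => hy.2).contDiffOn
  have hpO : extChartAt (𝓡 n) p p
      ∈ (extChartAt (𝓡 n) p).target ∩ (extChartAt (𝓡 n) p).symm ⁻¹' V :=
    ⟨(extChartAt (𝓡 n) p).map_source hps, by
      rw [mem_preimage, (extChartAt (𝓡 n) p).left_inv hps]; exact hpV⟩
  have hgd : ∀ q ∈ V, MDifferentiableAt (𝓡 n) 𝓘(ℝ, ℝ) g q := fun q hq =>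
    (hg.contMDiffAt (hV.mem_nhds hq)).mdifferentiableAt (by simp)
  have hne : fderiv ℝ (g ∘ (extChartAt (𝓡 n) p).symm) (extChartAt (𝓡 n) p p) ≠ 0 := by
    intro h
    refine hdg (ContinuousLinearMap.ext fun v => ?_)
    have h1 := fderiv_comp_extChartAt_symm hpO.1 (hgd _ hpO.2)
      (fun _ => (v : EuclideanSpace ℝ (Fin n)))
    rw [h, (extChartAt (𝓡 n) p).left_inv hps] at h1
    exact h1.symm
  have hcont : ContinuousAt (fderiv ℝ (g ∘ (extChartAt (𝓡 n) p).symm)) (extChartAt (𝓡 n) p p) :=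
    (hG.continuousOn_fderiv_of_isOpen hO (by simp)).continuousAt (hO.mem_nhds hpO)
  have hev := (continuousAt_extChartAt (I := 𝓡 n) p).eventually (hcont.eventually_ne hne)
  filter_upwards [hev, hV.mem_nhds hpV, extChartAt_source_mem_nhds (I := 𝓡 n) p]
    with q hq hqV hqs hqf
  have hqT := (extChartAt (𝓡 n) p).map_source hqs
  refine ⟨V, g, hV, hqV, hg, le_antisymm ?_ ?_, fun h => hq ?_, hVg⟩
  · by_contra! hlt
    obtain ⟨x, hx, hxΩ⟩ := mem_closure_iff_nhds.1 hqf.1 _ (inter_mem (hV.mem_nhds hqV)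
      ((hgd q hqV).continuousAt.eventually (lt_mem_nhds hlt)))
    exact absurd ((hVg x hx.1).1 hxΩ) (not_lt.2 (le_of_lt hx.2))
  · rw [hΩ.frontier_eq] at hqf
    exact not_lt.1 fun h => hqf.2 ((hVg q hqV).2 h)
  · have hd2 := (contMDiffAt_extChartAt_symm hqT).mdifferentiableAt (by simp)
    have hd1 : MDifferentiableAt (𝓡 n) 𝓘(ℝ, ℝ) g
        ((extChartAt (𝓡 n) p).symm (extChartAt (𝓡 n) p q)) := by
      rw [(extChartAt (𝓡 n) p).left_inv hqs]; exact hgd q hqV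
    rw [← mfderiv_eq_fderiv, mfderiv_comp _ hd1 hd2, (extChartAt (𝓡 n) p).left_inv hqs, h]
    exact ContinuousLinearMap.zero_comp _

/-- Closedness makes the singular set compact when `Ω` is bounded, so that finite covers by balls
exist. -/
theorem isClosed_singular_boundary {Ω : Set M} (hΩ : IsOpen Ω) :
    IsClosed {q ∈ frontier Ω | ¬ IsSmoothBoundaryPoint n Ω q} := by
  rw [← isOpen_compl_iff, isOpen_iff_mem_nhds]
  intro q hq
  by_cases hqf : q ∈ frontier Ω
  · have hs : IsSmoothBoundaryPoint n Ω q := by_contra fun h => hq ⟨hqf, h⟩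
    filter_upwards [hs.eventually hΩ] with x hx hxS using hxS.2 (hx hxS.1)
  · filter_upwards [isClosed_frontier.isOpen_compl.mem_nhds hqf] with x hx hxS using hx hxS.1

namespace CCSpace

variable (C : CCSpace n M F U)

/-- How far `ζ` is from the constant `1` in horizontal `W^{1,1}`. -/
def cutError (Ω : Set M) (ζ : M → ℝ) : ℝ≥0∞ :=
  ∫⁻ x in Ω, ‖C.hd ζ x‖ₑ ∂C.μ + ∫⁻ x in Ω, ENNReal.ofReal (1 - ζ x) ∂C.μ

/-- Smooth functions with values in the unit interval. -/
def IsSmoothUnit (ζ : M → ℝ) : Prop :=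
  ContMDiff (𝓡 n) 𝓘(ℝ, ℝ) ∞ ζ ∧ ∀ x, 0 ≤ ζ x ∧ ζ x ≤ 1

theorem cutError_one (Ω : Set M) : C.cutError Ω (fun _ => 1) = 0 := by
  have h : ∀ x, ‖C.hd (fun _ => (1 : ℝ)) x‖ₑ = 0 := fun x => by
    rw [← ofReal_norm, hd, differential_const, ContinuousLinearMap.zero_comp, norm_zero,
      ENNReal.ofReal_zero]
  simp [cutError, h]

/-- For values in `[0, 1]` one has `1 - ζξ ≤ (1 - ζ) + (1 - ξ)` and `|d(ζξ)| ≤ |dζ| + |dξ|`. Cutoffs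
around finitely many balls can therefore be multiplied, their costs adding up. -/
theorem cutError_mul_le {Ω : Set M} {ζ ξ : M → ℝ} (hζ : IsSmoothUnit (n := n) ζ)
    (hξ : IsSmoothUnit (n := n) ξ) :
    C.cutError Ω (fun x => ζ x * ξ x) ≤ C.cutError Ω ζ + C.cutError Ω ξ := by
  have hm : ∀ {u : M → ℝ}, ContMDiff (𝓡 n) 𝓘(ℝ, ℝ) ∞ u →
      AEMeasurable (fun x => ‖C.hd u x‖ₑ) (C.μ.restrict Ω) := fun hu => by
    have := C.aemeasurable_enorm_hd isOpen_univ hu.contMDiffOn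
    rw [Measure.restrict_univ] at this
    exact this.restrict
  have e1 : ∫⁻ x in Ω, ‖C.hd (fun x => ζ x * ξ x) x‖ₑ ∂C.μ
      ≤ ∫⁻ x in Ω, ‖C.hd ζ x‖ₑ ∂C.μ + ∫⁻ x in Ω, ‖C.hd ξ x‖ₑ ∂C.μ := by
    rw [← lintegral_add_left' (hm hζ.1)]
    refine lintegral_mono fun x => ?_
    rw [C.hd_mul (hζ.1.mdifferentiable (by simp) x) (hξ.1.mdifferentiable (by simp) x)]
    simp only [← ofReal_norm]
    rw [← ENNReal.ofReal_add (norm_nonneg _) (norm_nonneg _)]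
    refine ENNReal.ofReal_le_ofReal ((norm_add_le _ _).trans ?_)
    rw [add_comm, norm_smul, norm_smul, Real.norm_of_nonneg (hζ.2 x).1,
      Real.norm_of_nonneg (hξ.2 x).1]
    exact add_le_add (mul_le_of_le_one_left (norm_nonneg _) (hξ.2 x).2)
      (mul_le_of_le_one_left (norm_nonneg _) (hζ.2 x).2)
  have e2 : ∫⁻ x in Ω, ENNReal.ofReal (1 - ζ x * ξ x) ∂C.μ
      ≤ ∫⁻ x in Ω, ENNReal.ofReal (1 - ζ x) ∂C.μ + ∫⁻ x in Ω, ENNReal.ofReal (1 - ξ x) ∂C.μ := by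
    have hc := hζ.1.continuous
    rw [← lintegral_add_left (by fun_prop)]
    refine lintegral_mono fun x => ?_
    rw [← ENNReal.ofReal_add (by linarith [(hζ.2 x).2]) (by linarith [(hξ.2 x).2])]
    refine ENNReal.ofReal_le_ofReal ?_
    nlinarith [(hζ.2 x).2, (hξ.2 x).2]
  calc _ ≤ _ := add_le_add e1 e2
    _ = _ := by rw [cutError, cutError]; abel

theorem IsSmoothUnit.mul {ζ ξ : M → ℝ} (hζ : IsSmoothUnit (n := n) ζ)
    (hξ : IsSmoothUnit (n := n) ξ) : IsSmoothUnit (n := n) fun x => ζ x * ξ x :=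
  ⟨hζ.1.mul hξ.1, fun x => ⟨mul_nonneg (hζ.2 x).1 (hξ.2 x).1,
    mul_le_one₀ (hζ.2 x).2 (hξ.2 x).1 (hξ.2 x).2⟩⟩

theorem cutError_prod_le {Ω : Set M} {ι : Type*} (s : Finset ι) {ζ : ι → M → ℝ}
    (hζ : ∀ i ∈ s, IsSmoothUnit (n := n) (ζ i)) :
    IsSmoothUnit (n := n) (fun x => ∏ i ∈ s, ζ i x) ∧
      C.cutError Ω (fun x => ∏ i ∈ s, ζ i x) ≤ ∑ i ∈ s, C.cutError Ω (ζ i) := by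
  classical
  induction s using Finset.induction_on with
  | empty =>
    simp only [Finset.prod_empty, Finset.sum_empty, cutError_one, le_refl, and_true]
    exact ⟨contMDiff_const, fun _ => ⟨zero_le_one, le_rfl⟩⟩
  | insert i s hi ih =>
    obtain ⟨h1, h2⟩ := ih fun j hj => hζ j (Finset.mem_insert_of_mem hj)
    have h3 := hζ i (Finset.mem_insert_self i s)
    simp only [Finset.prod_insert hi, Finset.sum_insert hi]
    exact ⟨h3.mul h1, (C.cutError_mul_le h3 h1).trans (by gcongr)⟩

end CCSpace

end Cutoff

end CC

end

noncomputable section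

namespace CC

/-! ### Cutting off a small ball. -/

section BallCutoff

variable {n : ℕ} {M : Type*} [TopologicalSpace M] [ChartedSpace (EuclideanSpace ℝ (Fin n)) M]
  [IsManifold (𝓡 n) ∞ M] [MeasurableSpace M] [T2Space M] [SecondCountableTopology M]
  [BorelSpace M]
  {F : Type*} [NormedAddCommGroup F] [NormedSpace ℝ F] [FiniteDimensional ℝ F]
  {U : M → Type*} [TopologicalSpace (TotalSpace F U)] [∀ x, NormedAddCommGroup (U x)]
  [∀ x, InnerProductSpace ℝ (U x)] [FiberBundle F U] [VectorBundle ℝ F U]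
  [ContMDiffVectorBundle ∞ F U (𝓡 n)] [IsContMDiffRiemannianBundle (𝓡 n) ∞ F U]

namespace CCSpace

variable (C : CCSpace n M F U)

/-- Scaling: a bump rescaled to radius `r` has differential of size `1 / r` on a set of volume of
order `r ^ n`. The factor `D` depends on the chart, the frame and `L`, not on the ball. -/
theorem exists_ball_cutoff (hn : 1 ≤ n) {Ω : Set M} (hΩ : IsOpen Ω) (p : M) {N : Set M} {d : ℕ}
    {σ : Fin d → Cₛ^∞⟮𝓡 n; F, U⟯} {c : ℝ} (hc : 0 < c)
    (hframe : ∀ x ∈ N, ∀ L : U x →L[ℝ] ℝ, ‖L‖ ≤ c * ∑ i, |L (σ i x)|)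
    {L : Set (EuclideanSpace ℝ (Fin n))} (hL : IsCompact L)
    (hLT : L ⊆ (extChartAt (𝓡 n) p).target) (hLN : ∀ y ∈ L, (extChartAt (𝓡 n) p).symm y ∈ N) :
    ∃ D : ℝ≥0∞, D ≠ ⊤ ∧ ∀ (y : EuclideanSpace ℝ (Fin n)) (r : ℝ), 0 < r → r ≤ 1 →
      Metric.closedBall y (2 * r) ⊆ L →
      ∃ ζ : M → ℝ, IsSmoothUnit (n := n) ζ ∧
        (∀ x ∈ (extChartAt (𝓡 n) p).source, extChartAt (𝓡 n) p x ∈ Metric.ball y r →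
          ζ =ᶠ[𝓝 x] fun _ => 0) ∧
        C.cutError Ω ζ ≤ D * ENNReal.ofReal (r ^ (n - 1)) := by
  have hT := isOpen_extChartAt_target (I := 𝓡 n) p
  obtain ⟨D₁, hD₁, hcomp⟩ := C.vol.exists_lintegral_comparison p hL hLT hΩ
  obtain ⟨β, hβs, hβc, hβ0, hβ1, hβ2, hβ3⟩ : ∃ β : EuclideanSpace ℝ (Fin n) → ℝ,
      ContDiff ℝ ∞ β ∧ HasCompactSupport β ∧ (∀ z, 0 ≤ β z) ∧ (∀ z, β z ≤ 1) ∧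
      (∀ z, ‖z‖ ≤ 1 → β z = 1) ∧ ∀ z, 2 ≤ ‖z‖ → β z = 0 :=
    let β : ContDiffBump (0 : EuclideanSpace ℝ (Fin n)) := ⟨1, 2, one_pos, one_lt_two⟩
    ⟨β, β.contDiff, β.hasCompactSupport, fun _ => β.nonneg, fun _ => β.le_one,
      fun z hz => β.one_of_mem_closedBall (mem_closedBall_zero_iff.2 hz),
      fun z hz => β.zero_of_le_dist (by rw [dist_zero_right]; exact hz)⟩
  obtain ⟨A, hA⟩ := (hβc.fderiv ℝ).exists_bound_of_continuous
    (hβs.continuous_fderiv (by simp))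
  have hA0 : 0 ≤ A := (norm_nonneg _).trans (hA 0)
  have hcf : ContinuousOn (fun y => ∑ i, ‖chartField p (fun x => C.anchor x (σ i x)) y‖) L :=
    continuousOn_finsetSum _ fun i _ =>
      ((contDiffOn_chartField p (C.contMDiff_anchor_comp (σ i))).continuousOn.mono hLT).norm
  obtain ⟨A', hA'⟩ := hL.exists_bound_of_continuousOn hcf
  set Q : ℝ := c * (A * |A'|) with hQ
  have hQ0 : 0 ≤ Q := by positivity
  refine ⟨D₁ * (ENNReal.ofReal ((Q + 1) * 2 ^ n) * volume (Metric.ball (0 : EuclideanSpace ℝ (Fin n)) 1)),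
    ENNReal.mul_ne_top hD₁ (ENNReal.mul_ne_top ENNReal.ofReal_ne_top measure_ball_lt_top.ne),
    fun y r hr hr1 hyL => ?_⟩
  -- the rescaled bump function
  set g : EuclideanSpace ℝ (Fin n) → ℝ := fun z => β (r⁻¹ • (z - y)) with hg
  have hgs : ContDiff ℝ ∞ g := hβs.comp (contDiff_const_smul _ |>.comp (contDiff_id.sub contDiff_const))
  have hnorm : ∀ z, ‖r⁻¹ • (z - y)‖ = r⁻¹ * dist z y := fun z => by
    rw [norm_smul, norm_inv, Real.norm_of_nonneg hr.le, dist_eq_norm]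
  have hg0 : ∀ z, z ∉ Metric.closedBall y (2 * r) → g z = 0 := fun z hz => by
    refine hβ3 _ ?_
    rw [Metric.mem_closedBall, not_le] at hz
    rw [hnorm, inv_mul_eq_div, le_div_iff₀ hr]
    exact hz.le
  have hg1 : ∀ z ∈ Metric.ball y r, g z = 1 := fun z hz => by
    refine hβ2 _ ?_
    rw [hnorm, inv_mul_eq_div, div_le_iff₀ hr, one_mul]
    exact (Metric.mem_ball.1 hz).le
  have hgd : ∀ z, ‖fderiv ℝ g z‖ ≤ A / r := fun z => by
    have h1 : HasFDerivAt (fun z : EuclideanSpace ℝ (Fin n) => r⁻¹ • (z - y))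
        (r⁻¹ • ContinuousLinearMap.id ℝ (EuclideanSpace ℝ (Fin n))) z :=
      ((hasFDerivAt_id z).sub_const y).const_smul r⁻¹
    have h2 : HasFDerivAt g _ z :=
      ((hβs.differentiable (by simp)) (r⁻¹ • (z - y))).hasFDerivAt.comp z h1
    rw [h2.fderiv, ContinuousLinearMap.comp_smul, ContinuousLinearMap.comp_id, norm_smul, norm_inv,
      Real.norm_of_nonneg hr.le, inv_mul_eq_div]
    exact div_le_div_of_nonneg_right (hA _) hr.le
  set Bc := Metric.closedBall y (2 * r) with hBc
  have hBcc : IsCompact Bc := isCompact_closedBall _ _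
  obtain ⟨hb, hbs⟩ := contMDiff_source_indicator p hgs hBcc (hyL.trans hLT) hg0
  set b := (extChartAt (𝓡 n) p).source.indicator (g ∘ extChartAt (𝓡 n) p) with hbdef
  have hb0 : ∀ x, 0 ≤ b x := fun x => indicator_nonneg (fun x _ => hβ0 _) x
  have hb1 : ∀ x, b x ≤ 1 := fun x =>
    indicator_le' (fun x _ => hβ1 _) (fun _ _ => zero_le_one) x
  have hbg : ∀ z ∈ (extChartAt (𝓡 n) p).target, b ((extChartAt (𝓡 n) p).symm z) = g z := fun z hz => by
    rw [hbdef, indicator_of_mem ((extChartAt (𝓡 n) p).map_target hz), Function.comp_apply,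
      (extChartAt (𝓡 n) p).right_inv hz]
  have hζ : ContMDiff (𝓡 n) 𝓘(ℝ, ℝ) ∞ fun x => 1 - b x := contMDiff_const.sub hb
  have hhd : ∀ x, ‖C.hd (fun x => 1 - b x) x‖ₑ = ‖C.hd b x‖ₑ := fun x => by
    simp only [← ofReal_norm]
    rw [C.hd_sub mdifferentiableAt_const (hb.mdifferentiable (by simp) x), hd, differential_const,
      ContinuousLinearMap.zero_comp, zero_sub, norm_neg]
  refine ⟨fun x => 1 - b x, ⟨hζ, fun x => ⟨by linarith [hb1 x], by linarith [hb0 x]⟩⟩,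
    fun x hx hxb => ?_, ?_⟩
  · filter_upwards [extChartAt_source_mem_nhds' hx,
      (continuousAt_extChartAt' hx).eventually (Metric.isOpen_ball.mem_nhds hxb)] with z hz hzb
    rw [hbdef, indicator_of_mem hz, Function.comp_apply, hg1 _ hzb, sub_self]
  have hxB : ∀ {x}, x ∉ (extChartAt (𝓡 n) p).symm '' Bc → x ∉ tsupport b := fun hx h => hx (hbs h)
  have hLB : ∀ {x}, x ∉ (extChartAt (𝓡 n) p).symm '' L → x ∉ (extChartAt (𝓡 n) p).symm '' Bc :=
    fun hx h => hx (image_mono hyL h)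
  have hsymB : ∀ z ∈ L, z ∉ Bc → (extChartAt (𝓡 n) p).symm z ∉ tsupport b := fun z hz hzB h => by
    obtain ⟨z', hz', he⟩ := hbs h
    rw [(extChartAt (𝓡 n) p).symm.injOn (hLT (hyL hz')) (hLT hz) he] at hz'
    exact hzB hz'
  have hvol : volume Bc = ENNReal.ofReal ((2 * r) ^ n) *
      volume (Metric.ball (0 : EuclideanSpace ℝ (Fin n)) 1) := by
    rw [hBc, Measure.addHaar_closedBall _ _ (by positivity), finrank_euclideanSpace_fin]
  have hmeas : MeasurableSet ((extChartAt (𝓡 n) p).symm ⁻¹' Ω ∩ L) := by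
    have h1 := (continuousOn_extChartAt_symm (I := 𝓡 n) p).isOpen_inter_preimage hT hΩ
    have h2 : (extChartAt (𝓡 n) p).symm ⁻¹' Ω ∩ L
        = ((extChartAt (𝓡 n) p).target ∩ (extChartAt (𝓡 n) p).symm ⁻¹' Ω) ∩ L := by
      ext y; exact ⟨fun h => ⟨⟨hLT h.2, h.1⟩, h.2⟩, fun h => ⟨h.1.2, h.2⟩⟩
    rw [h2]
    exact h1.measurableSet.inter hL.measurableSet
  have hint : ∀ (k : M → ℝ≥0∞) (κ : ℝ≥0∞), AEMeasurable k (C.vol.toMeasure.restrict Ω) →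
      (∀ x, x ∉ tsupport b → k x = 0) →
      (∀ z ∈ Bc, k ((extChartAt (𝓡 n) p).symm z) ≤ κ) →
      ∫⁻ x in Ω, k x ∂C.μ ≤ D₁ * (κ * volume Bc) := by
    intro k κ hk hk0 hkκ
    refine ((hcomp k hk).1 fun x _ hx => hk0 x (hxB (hLB hx))).trans (mul_le_mul_right ?_ D₁)
    calc ∫⁻ z in (extChartAt (𝓡 n) p).symm ⁻¹' Ω ∩ L, k ((extChartAt (𝓡 n) p).symm z)
        ≤ ∫⁻ z in (extChartAt (𝓡 n) p).symm ⁻¹' Ω ∩ L, Bc.indicator (fun _ => κ) z := by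
          refine setLIntegral_mono' hmeas fun z hz => ?_
          by_cases hzB : z ∈ Bc
          · rw [indicator_of_mem hzB]; exact hkκ z hzB
          · rw [hk0 _ (hsymB z hz.2 hzB)]; exact bot_le
      _ ≤ ∫⁻ z, Bc.indicator (fun _ => κ) z := setLIntegral_le_lintegral _ _
      _ = κ * volume Bc := by
          rw [lintegral_indicator measurableSet_closedBall, lintegral_const,
            Measure.restrict_apply_univ]
  have i1 := hint (fun x => ‖C.hd (fun x => 1 - b x) x‖ₑ) (ENNReal.ofReal (Q / r))
    (C.aemeasurable_enorm_hd hΩ hζ.contMDiffOn)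
    (fun x hx => by
      rw [hhd, C.enorm_hd_eq_zero (notMem_tsupport_iff_eventuallyEq.1 hx)])
    (fun z hz => by
      have hzL := hyL hz
      rw [hhd, ← ofReal_norm]
      refine ENNReal.ofReal_le_ofReal ((hframe _ (hLN z hzL) _).trans ?_)
      rw [hQ, mul_div_assoc]
      refine mul_le_mul_of_nonneg_left ?_ hc.le
      have hbe : b ∘ (extChartAt (𝓡 n) p).symm =ᶠ[𝓝 z] g := by
        filter_upwards [hT.mem_nhds (hLT hzL)] with z hz using hbg z hz
      calc ∑ i, |C.hd b ((extChartAt (𝓡 n) p).symm z) (σ i ((extChartAt (𝓡 n) p).symm z))|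
          ≤ ∑ i, A / r * ‖chartField p (fun x => C.anchor x (σ i x)) z‖ := by
            refine Finset.sum_le_sum fun i _ => ?_
            rw [hd_apply, ← fderiv_comp_extChartAt_symm (hLT hzL) (hb.mdifferentiable (by simp) _)
              (fun x => C.anchor x (σ i x)), hbe.fderiv_eq]
            exact ((fderiv ℝ g z).le_opNorm _).trans
              (mul_le_mul_of_nonneg_right (hgd z) (norm_nonneg _))
        _ = A / r * ∑ i, ‖chartField p (fun x => C.anchor x (σ i x)) z‖ := by rw [Finset.mul_sum]
        _ ≤ A / r * |A'| := by
            refine mul_le_mul_of_nonneg_left ?_ (by positivity)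
            exact (le_abs_self _).trans ((hA' z hzL).trans (le_abs_self _))
        _ = A * |A'| / r := by ring)
  have i2 := hint (fun x => ENNReal.ofReal (1 - (1 - b x))) 1
    (by
      have hcb := hb.continuous
      exact (ENNReal.continuous_ofReal.comp (by fun_prop : Continuous fun x => 1 - (1 - b x))).aemeasurable)
    (fun x hx => by simp [image_eq_zero_of_notMem_tsupport hx])
    (fun z hz => by simpa using hb1 _)
  calc C.cutError Ω (fun x => 1 - b x)
      ≤ D₁ * (ENNReal.ofReal (Q / r) * volume Bc) + D₁ * (1 * volume Bc) := add_le_add i1 i2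
    _ = D₁ * (ENNReal.ofReal ((Q / r + 1) * (2 * r) ^ n) *
          volume (Metric.ball (0 : EuclideanSpace ℝ (Fin n)) 1)) := by
        rw [hvol, ENNReal.ofReal_mul (by positivity), ENNReal.ofReal_add (by positivity) zero_le_one,
          ENNReal.ofReal_one]
        ring
    _ ≤ D₁ * (ENNReal.ofReal ((Q + 1) * 2 ^ n * r ^ (n - 1)) *
          volume (Metric.ball (0 : EuclideanSpace ℝ (Fin n)) 1)) := by
        refine mul_le_mul_right (mul_le_mul_left (ENNReal.ofReal_le_ofReal ?_) _) _
        -- Here `r ≤ 1` absorbs the zeroth-order part of the cost, of order `r ^ n`, into the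
        -- gradient part.
        obtain ⟨m, rfl⟩ : ∃ m, n = m + 1 := ⟨n - 1, by omega⟩
        rw [add_tsub_cancel_right]
        have : (Q / r + 1) * (2 * r) ^ (m + 1) = (Q + r) * 2 ^ (m + 1) * r ^ m := by
          field_simp
          ring
        rw [this]
        gcongr
    _ = _ := by
        rw [ENNReal.ofReal_mul (by positivity)]
        ring

end CCSpace

end BallCutoff

end CC

end

noncomputable section

namespace CC

/-! ### Cutting off the singular part of the boundary. -/

section SingularCutoff

variable {n : ℕ} {M : Type*} [TopologicalSpace M] [ChartedSpace (EuclideanSpace ℝ (Fin n)) M]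
  [IsManifold (𝓡 n) ∞ M] [MeasurableSpace M] [T2Space M] [SecondCountableTopology M]
  [BorelSpace M]
  {F : Type*} [NormedAddCommGroup F] [NormedSpace ℝ F] [FiniteDimensional ℝ F]
  {U : M → Type*} [TopologicalSpace (TotalSpace F U)] [∀ x, NormedAddCommGroup (U x)]
  [∀ x, InnerProductSpace ℝ (U x)] [FiberBundle F U] [VectorBundle ℝ F U]
  [ContMDiffVectorBundle ∞ F U (𝓡 n)] [IsContMDiffRiemannianBundle (𝓡 n) ∞ F U]


namespace CCSpace

variable (C : CCSpace n M F U)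

/-- A compact set of vanishing `(n-1)`-dimensional measure has zero `W^{1,1}` capacity: it is
covered by finitely many balls with small `∑ r ^ (n - 1)`, and the product of their cutoffs costs at
most a constant times this sum. -/
theorem exists_local_singular_cutoff (hn : 1 ≤ n) {Ω : Set M} (hΩ : IsOpen Ω)
    (hΩs : HasPiecewiseSmoothBoundary n Ω) (p : M) :
    ∃ K ∈ 𝓝 p, ∀ ε : ℝ≥0∞, 0 < ε → ∃ ζ : M → ℝ, IsSmoothUnit (n := n) ζ ∧
      (∀ x ∈ K, x ∈ frontier Ω → ¬ IsSmoothBoundaryPoint n Ω x → ζ =ᶠ[𝓝 x] fun _ => 0) ∧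
      C.cutError Ω ζ ≤ ε := by
  have : LocallyCompactSpace M := Manifold.locallyCompact_of_finiteDimensional (𝓡 n)
  obtain ⟨N, d, σ, c, hN, hpN, hc, -, hframe⟩ := exists_frame n F U p
  obtain ⟨K, hK, hKN, hKc⟩ := local_compact_nhds (inter_mem (hN.mem_nhds hpN)
    (extChartAt_source_mem_nhds (I := 𝓡 n) p))
  refine ⟨K, hK, fun ε hε => ?_⟩
  set S := {q ∈ frontier Ω | ¬ IsSmoothBoundaryPoint n Ω q} with hS
  set E := extChartAt (𝓡 n) p '' (S ∩ K) with hE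
  have hEc : IsCompact E :=
    (hKc.inter_left (isClosed_singular_boundary hΩ)).image_of_continuousOn
      ((continuousOn_extChartAt p).mono fun x hx => (hKN hx.2).2)
  have hE0 : Measure.hausdorffMeasure ((n - 1 : ℕ) : ℝ) E = 0 := by
    rw [Nat.cast_sub hn, Nat.cast_one]
    exact measure_mono_null (image_mono (inter_subset_inter_right _ fun x hx => (hKN hx).2))
      (hΩs.singular_null p)
  have hO : IsOpen ((extChartAt (𝓡 n) p).target ∩ (extChartAt (𝓡 n) p).symm ⁻¹' N) :=
    (continuousOn_extChartAt_symm p).isOpen_inter_preimage (isOpen_extChartAt_target p) hN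
  have hEO : E ⊆ (extChartAt (𝓡 n) p).target ∩ (extChartAt (𝓡 n) p).symm ⁻¹' N := by
    rintro _ ⟨x, hx, rfl⟩
    refine ⟨(extChartAt (𝓡 n) p).map_source (hKN hx.2).2, ?_⟩
    rw [mem_preimage, (extChartAt (𝓡 n) p).left_inv (hKN hx.2).2]
    exact (hKN hx.2).1
  obtain ⟨δ, hδ, hδO⟩ := hEc.exists_cthickening_subset_open hO hEO
  obtain ⟨D, hD, hball⟩ := C.exists_ball_cutoff hn hΩ p hc hframe hEc.cthickening
    (fun y hy => (hδO hy).1) (fun y hy => (hδO hy).2)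
  obtain ⟨η, hη, hDη⟩ := ENNReal.exists_pos_mul_lt hD hε.ne'
  -- Radii at most `δ / 2` keep the doubled balls in the `δ`-thickening of `E`; radii at most `1`
  -- are required by the ball cutoffs.
  obtain ⟨ι, s, y, r, hyE, hr, hcov, hsum⟩ :=
    exists_finite_ball_cover hEc hE0 (lt_min one_pos (half_pos hδ)) hη
  choose ζ h1 h2 h3 using fun j => hball (y j) (r j) (hr j).1 ((hr j).2.trans (min_le_left _ _))
    ((Metric.closedBall_subset_closedBall
      (by linarith [(hr j).2.trans (min_le_right _ _)])).trans
      (Metric.closedBall_subset_cthickening (hyE j) δ))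
  obtain ⟨h4, h5⟩ := C.cutError_prod_le (Ω := Ω) s fun j _ => h1 j
  refine ⟨_, h4, fun x hxK hxf hxs => ?_, h5.trans ?_⟩
  · obtain ⟨j, hj, hxj⟩ := mem_iUnion₂.1 (hcov ⟨x, ⟨⟨hxf, hxs⟩, hxK⟩, rfl⟩)
    filter_upwards [h2 j x (hKN hxK).2 hxj] with z hz using Finset.prod_eq_zero hj hz
  · calc ∑ j ∈ s, C.cutError Ω (ζ j) ≤ ∑ j ∈ s, D * ENNReal.ofReal (r j ^ (n - 1)) :=
          Finset.sum_le_sum fun j _ => h3 j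
      _ = D * ∑ j ∈ s, ENNReal.ofReal (r j ^ (n - 1)) := by rw [Finset.mul_sum]
      _ ≤ D * η := mul_le_mul_right hsum D
      _ ≤ ε := by rw [mul_comm]; exact hDη.le

/-- The singular part of a piecewise smooth boundary can be cut off at small cost. -/
theorem exists_singular_cutoff {Ω : Set M} (hΩ : IsOpen Ω) (hΩb : IsCompact (closure Ω))
    (hΩs : HasPiecewiseSmoothBoundary n Ω) {ε : ℝ≥0∞} (hε : 0 < ε) :
    ∃ ζ : M → ℝ, IsSmoothUnit (n := n) ζ ∧
      (∀ x ∈ frontier Ω, ¬ IsSmoothBoundaryPoint n Ω x → ζ =ᶠ[𝓝 x] fun _ => 0) ∧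
      C.cutError Ω ζ ≤ ε := by
  rcases Nat.eq_zero_or_pos n with rfl | hn
  -- In dimension zero the boundary of an open set is empty, so nothing has to be cut off.
  · refine ⟨fun _ => 1, ⟨contMDiff_const, fun _ => ⟨zero_le_one, le_rfl⟩⟩, fun x hx _ => ?_,
      by rw [cutError_one]; exact hε.le⟩
    exfalso
    rw [hΩ.frontier_eq] at hx
    obtain ⟨z, hz, hzΩ⟩ := mem_closure_iff_nhds.1 hx.1 _ (extChartAt_source_mem_nhds (I := 𝓡 0) x)
    have : z = x := (extChartAt (𝓡 0) x).injOn hz (mem_extChartAt_source x)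
      (Subsingleton.elim (α := EuclideanSpace ℝ (Fin 0)) _ _)
    exact hx.2 (this ▸ hzΩ)
  set S := {q ∈ frontier Ω | ¬ IsSmoothBoundaryPoint n Ω q} with hS
  have hSc : IsCompact S := hΩb.of_isClosed_subset (isClosed_singular_boundary hΩ)
    fun x hx => frontier_subset_closure hx.1
  choose K hK hcut using C.exists_local_singular_cutoff hn hΩ hΩs
  obtain ⟨t, -, ht⟩ := hSc.elim_nhds_subcover K fun x _ => hK x
  obtain ⟨η, hη, htη⟩ := ENNReal.exists_pos_mul_lt (ENNReal.natCast_ne_top t.card) hε.ne'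
  choose ζ h1 h2 h3 using fun p => hcut p η hη
  obtain ⟨h4, h5⟩ := C.cutError_prod_le (Ω := Ω) t fun j _ => h1 j
  refine ⟨_, h4, fun x hxf hxs => ?_, h5.trans ?_⟩
  · obtain ⟨j, hj, hxj⟩ := mem_iUnion₂.1 (ht ⟨hxf, hxs⟩)
    filter_upwards [h2 j x hxj hxf hxs] with z hz using Finset.prod_eq_zero hj hz
  · calc ∑ j ∈ t, C.cutError Ω (ζ j) ≤ ∑ _j ∈ t, η := Finset.sum_le_sum fun j _ => h3 j
      _ = η * t.card := by rw [Finset.sum_const, nsmul_eq_mul, mul_comm]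
      _ ≤ ε := htη.le

end CCSpace

end SingularCutoff

end CC

end

noncomputable section

namespace CC

/-! ### `L²` norms of nonnegative functions. -/

section L2

variable {α : Type*} [MeasurableSpace α] {ν : Measure α} {f g : α → ℝ≥0∞}

/-- The `L²` norm of a nonnegative function. -/
def l2Norm (ν : Measure α) (f : α → ℝ≥0∞) : ℝ≥0∞ := (∫⁻ x, f x ^ 2 ∂ν) ^ (1 / 2 : ℝ)

theorem l2Norm_sq (ν : Measure α) (f : α → ℝ≥0∞) : l2Norm ν f ^ 2 = ∫⁻ x, f x ^ 2 ∂ν := by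
  rw [l2Norm, ← ENNReal.rpow_natCast, ← ENNReal.rpow_mul]
  norm_num

theorem l2Norm_mono_ae (h : ∀ᵐ x ∂ν, f x ≤ g x) : l2Norm ν f ≤ l2Norm ν g :=
  ENNReal.rpow_le_rpow (lintegral_mono_ae (h.mono fun _ hx => pow_le_pow_left' hx 2)) (by norm_num)

theorem l2Norm_add_le (hf : AEMeasurable f ν) (hg : AEMeasurable g ν) :
    l2Norm ν (fun x => f x + g x) ≤ l2Norm ν f + l2Norm ν g := by
  have h := ENNReal.lintegral_Lp_add_le hf hg one_le_two
  simpa only [l2Norm, Pi.add_apply, ENNReal.rpow_two] using h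

theorem lintegral_mul_le_l2Norm (hf : AEMeasurable f ν) (hg : AEMeasurable g ν) :
    ∫⁻ x, f x * g x ∂ν ≤ l2Norm ν f * l2Norm ν g := by
  have h := ENNReal.lintegral_mul_le_Lp_mul_Lq ν Real.HolderConjugate.two_two hf hg
  simpa only [l2Norm, Pi.mul_apply, ENNReal.rpow_two] using h

theorem le_of_forall_pos_le_add_mul {a b k : ℝ≥0∞} (hk : k ≠ ⊤)
    (h : ∀ ε : ℝ≥0∞, 0 < ε → ε ≠ ⊤ → a ≤ b + k * ε) : a ≤ b := by
  refine ENNReal.le_of_forall_pos_le_add fun ε hε _ => ?_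
  obtain ⟨η, hη, hkη⟩ := ENNReal.exists_pos_mul_lt hk (ENNReal.coe_pos.2 hε).ne'
  refine (h (min η 1) (lt_min hη one_pos)
    ((min_le_right _ _).trans_lt ENNReal.one_lt_top).ne).trans (add_le_add le_rfl ?_)
  rw [mul_comm]
  exact (mul_le_mul_left (min_le_left _ _) k).trans hkη.le

theorem lintegral_enorm_sq_eq_ofReal_integral {f : α → ℝ} (hf : AEMeasurable f ν)
    (hfin : ∫⁻ x, ‖f x‖ₑ ^ 2 ∂ν < ⊤) :
    ∫⁻ x, ‖f x‖ₑ ^ 2 ∂ν = ENNReal.ofReal (∫ x, f x ^ 2 ∂ν) := by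
  have hi : Integrable (fun x => f x ^ 2) ν :=
    ⟨(hf.pow_const 2).aestronglyMeasurable, by
      simpa only [HasFiniteIntegral, enorm_pow] using hfin⟩
  rw [ofReal_integral_eq_lintegral_ofReal hi (.of_forall fun x => sq_nonneg (f x))]
  refine lintegral_congr fun x => ?_
  rw [← ofReal_norm, ← ENNReal.ofReal_pow (norm_nonneg _), Real.norm_eq_abs, sq_abs]

end L2

/-! ### Cheeger's argument on the form domain. -/

section Cheeger

variable {n : ℕ} {M : Type*} [TopologicalSpace M] [ChartedSpace (EuclideanSpace ℝ (Fin n)) M]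
  [IsManifold (𝓡 n) ∞ M] [MeasurableSpace M] [T2Space M] [SecondCountableTopology M]
  [BorelSpace M]
  {F : Type*} [NormedAddCommGroup F] [NormedSpace ℝ F] [FiniteDimensional ℝ F]
  {U : M → Type*} [TopologicalSpace (TotalSpace F U)] [∀ x, NormedAddCommGroup (U x)]
  [∀ x, InnerProductSpace ℝ (U x)] [FiberBundle F U] [VectorBundle ℝ F U]
  [ContMDiffVectorBundle ∞ F U (𝓡 n)] [IsContMDiffRiemannianBundle (𝓡 n) ∞ F U]


namespace CCSpace

variable {C : CCSpace n M F U} {Ω Γ : Set M} {c : ℝ≥0∞}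

/-- The closed support of `u` avoids the singular boundary points and `closure Γ`, so
`exists_global_approx` provides functions smooth on `M`, still supported off `Γ`, for which the
inequality is known. Both sides are continuous under this approximation. -/
theorem IsCheegerBound.mul_lintegral_le_of_smooth_support (hc : C.IsCheegerBound Ω Γ c)
    (hct : c ≠ ⊤) (hΩ : IsOpen Ω) (hΩb : IsCompact (closure Ω))
    (hΩs : HasPiecewiseSmoothBoundary n Ω) {u : M → ℝ} (hu : SmoothVanishingNear n Ω Γ u)
    {B : ℝ} (huB : ∀ x ∈ Ω, 0 ≤ u x ∧ u x ≤ B)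
    (hus : ∀ x ∈ frontier Ω, ¬ IsSmoothBoundaryPoint n Ω x → u =ᶠ[𝓝 x] fun _ => 0)
    (hufin : ∫⁻ x in Ω, ‖C.hd u x‖ₑ ∂C.μ < ⊤) :
    c * ∫⁻ x in Ω, ENNReal.ofReal (u x) ∂C.μ ≤ ∫⁻ x in Ω, ‖C.hd u x‖ₑ ∂C.μ := by
  set K := closure {x ∈ Ω | u x ≠ 0} with hK
  have hKΩ : K ⊆ closure Ω := closure_mono fun x hx => hx.1
  have hKΓ : K ⊆ (closure Γ)ᶜ := fun x hx hxΓ => by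
    have : x ∈ K ∩ closure Γ := ⟨hx, hxΓ⟩
    rw [hu.2] at this
    exact this
  have hKs : ∀ p ∈ K, p ∈ Ω ∨ IsSmoothBoundaryPoint n Ω p := fun p hp => by
    by_contra! h
    have hpf : p ∈ frontier Ω := by
      rw [hΩ.frontier_eq]
      exact ⟨hKΩ hp, h.1⟩
    obtain ⟨z, hz, hzK⟩ := mem_closure_iff_nhds.1 hp _ (hus p hpf h.2)
    exact hzK.2 hz
  -- The approximation error enters once through the gradient and once, multiplied by `c`, through
  -- the function.
  refine le_of_forall_pos_le_add_mul (k := 1 + c) (by finiteness) fun ε hε _ => ?_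
  obtain ⟨w, hw, hwO, hw0, hwε⟩ := C.exists_global_approx hΩ hΩb
    (hΩb.of_isClosed_subset isClosed_closure hKΩ) isClosed_closure.isOpen_compl hKΓ hKs hu.1 huB
    hufin (fun x hx hxK => by_contra fun h => hxK (subset_closure ⟨hx, h⟩)) hε
  have h1 := hc.mul_lintegral_le hΩ hΩb hΩs hw hw0
    (disjoint_iff_inter_eq_empty.1 (disjoint_left.2 fun x hx hxΓ => hwO hx (subset_closure hxΓ)))
  have hwc := hw.continuous
  have h2 : ∫⁻ x in Ω, ENNReal.ofReal (u x) ∂C.μ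
      ≤ ∫⁻ x in Ω, ENNReal.ofReal (w x) ∂C.μ + ∫⁻ x in Ω, ‖w x - u x‖ₑ ∂C.μ := by
    rw [← lintegral_add_left (by fun_prop)]
    refine lintegral_mono fun x => ?_
    rw [← ofReal_norm, ← ENNReal.ofReal_add (hw0 x) (norm_nonneg _)]
    refine ENNReal.ofReal_le_ofReal ?_
    rw [Real.norm_eq_abs]
    linarith [le_abs_self (w x - u x), neg_le_abs (w x - u x)]
  have h3 : ∫⁻ x in Ω, ‖C.hd w x‖ₑ ∂C.μ ≤ ∫⁻ x in Ω, ‖C.hd u x‖ₑ ∂C.μ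
      + ∫⁻ x in Ω, ‖C.hd (fun z => w z - u z) x‖ₑ ∂C.μ := by
    rw [← lintegral_add_left' (C.aemeasurable_enorm_hd hΩ hu.1)]
    refine setLIntegral_mono_ae' hΩ.measurableSet (.of_forall fun x hx => ?_)
    rw [C.hd_sub (hw.mdifferentiable (by simp) x)
      ((hu.1.contMDiffAt (hΩ.mem_nhds hx)).mdifferentiableAt (by simp))]
    simp only [← ofReal_norm]
    rw [← ENNReal.ofReal_add (norm_nonneg _) (norm_nonneg _)]
    refine ENNReal.ofReal_le_ofReal ?_
    calc ‖C.hd w x‖ = ‖C.hd u x + (C.hd w x - C.hd u x)‖ := by rw [add_sub_cancel]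
      _ ≤ _ := norm_add_le _ _
  calc c * ∫⁻ x in Ω, ENNReal.ofReal (u x) ∂C.μ
      ≤ c * (∫⁻ x in Ω, ENNReal.ofReal (w x) ∂C.μ + ε) :=
        mul_le_mul_right (h2.trans (add_le_add le_rfl (le_self_add.trans hwε))) c
    _ = c * ∫⁻ x in Ω, ENNReal.ofReal (w x) ∂C.μ + c * ε := mul_add _ _ _
    _ ≤ (∫⁻ x in Ω, ‖C.hd u x‖ₑ ∂C.μ + ε) + c * ε := by
        refine add_le_add (h1.trans (h3.trans (add_le_add le_rfl (le_add_self.trans hwε)))) le_rfl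
    _ = ∫⁻ x in Ω, ‖C.hd u x‖ₑ ∂C.μ + (1 + c) * ε := by ring

/-- Multiplying `u` by a cutoff `ζ` of the singular boundary reduces to the previous case.
Boundedness matters here: `u dζ` and `(1 - ζ) u` cost at most `B` times the error of `ζ`. -/
theorem IsCheegerBound.mul_lintegral_le_of_bounded (hc : C.IsCheegerBound Ω Γ c)
    (hct : c ≠ ⊤) (hΩ : IsOpen Ω) (hΩb : IsCompact (closure Ω))
    (hΩs : HasPiecewiseSmoothBoundary n Ω) {u : M → ℝ} (hu : SmoothVanishingNear n Ω Γ u)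
    {B : ℝ} (huB : ∀ x ∈ Ω, 0 ≤ u x ∧ u x ≤ B) :
    c * ∫⁻ x in Ω, ENNReal.ofReal (u x) ∂C.μ ≤ ∫⁻ x in Ω, ‖C.hd u x‖ₑ ∂C.μ := by
  rcases eq_top_or_lt_top (∫⁻ x in Ω, ‖C.hd u x‖ₑ ∂C.μ) with h | hufin
  · rw [h]; exact le_top
  refine le_of_forall_pos_le_add_mul (k := ENNReal.ofReal B + c * ENNReal.ofReal B)
    (by finiteness) fun ε hε hεt => ?_
  obtain ⟨ζ, hζ, hζs, hζε⟩ := C.exists_singular_cutoff hΩ hΩb hΩs hε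
  have hud : ∀ x ∈ Ω, MDifferentiableAt (𝓡 n) 𝓘(ℝ, ℝ) u x := fun x hx =>
    (hu.1.contMDiffAt (hΩ.mem_nhds hx)).mdifferentiableAt (by simp)
  have hcu := hu.1.continuousOn
  have hum : AEMeasurable (fun x => ENNReal.ofReal (u x)) (C.μ.restrict Ω) :=
    (hcu.aemeasurable hΩ.measurableSet).ennreal_ofReal
  have hζm : AEMeasurable (fun x => ‖C.hd ζ x‖ₑ) (C.μ.restrict Ω) :=
    C.aemeasurable_enorm_hd hΩ hζ.1.contMDiffOn
  have hζc := hζ.1.continuous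
  have h1 : ∫⁻ x in Ω, ‖C.hd (fun x => ζ x * u x) x‖ₑ ∂C.μ
      ≤ ∫⁻ x in Ω, ‖C.hd u x‖ₑ ∂C.μ + ENNReal.ofReal B * ∫⁻ x in Ω, ‖C.hd ζ x‖ₑ ∂C.μ := by
    rw [← lintegral_const_mul'' _ hζm, ← lintegral_add_left' (C.aemeasurable_enorm_hd hΩ hu.1)]
    refine setLIntegral_mono_ae' hΩ.measurableSet (.of_forall fun x hx => ?_)
    rw [C.hd_mul (hζ.1.mdifferentiable (by simp) x) (hud x hx)]
    simp only [← ofReal_norm]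
    rw [← ENNReal.ofReal_mul ((huB x hx).1.trans (huB x hx).2),
      ← ENNReal.ofReal_add (norm_nonneg _)
        (mul_nonneg ((huB x hx).1.trans (huB x hx).2) (norm_nonneg _))]
    refine ENNReal.ofReal_le_ofReal ((norm_add_le _ _).trans ?_)
    rw [norm_smul, norm_smul, Real.norm_of_nonneg (hζ.2 x).1, Real.norm_of_nonneg (huB x hx).1]
    exact add_le_add (mul_le_of_le_one_left (norm_nonneg _) (hζ.2 x).2)
      (mul_le_mul_of_nonneg_right (huB x hx).2 (norm_nonneg _))
  have h2 : ∫⁻ x in Ω, ENNReal.ofReal (u x) ∂C.μ ≤ ∫⁻ x in Ω, ENNReal.ofReal (ζ x * u x) ∂C.μ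
      + ENNReal.ofReal B * ∫⁻ x in Ω, ENNReal.ofReal (1 - ζ x) ∂C.μ := by
    rw [← lintegral_const_mul _ (by fun_prop), ← lintegral_add_right _ (by fun_prop)]
    refine setLIntegral_mono_ae' hΩ.measurableSet (.of_forall fun x hx => ?_)
    have hB := huB x hx
    have hz := hζ.2 x
    rw [← ENNReal.ofReal_mul (hB.1.trans hB.2), ← ENNReal.ofReal_add (mul_nonneg hz.1 hB.1)
      (mul_nonneg (hB.1.trans hB.2) (by linarith [hz.2]))]
    refine ENNReal.ofReal_le_ofReal ?_
    nlinarith [hz.2, hB.2]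
  have hfin : ENNReal.ofReal B * ∫⁻ x in Ω, ‖C.hd ζ x‖ₑ ∂C.μ ≤ ENNReal.ofReal B * ε :=
    mul_le_mul_right (le_self_add.trans hζε) _
  have h3 : c * ∫⁻ x in Ω, ENNReal.ofReal (ζ x * u x) ∂C.μ
      ≤ ∫⁻ x in Ω, ‖C.hd (fun x => ζ x * u x) x‖ₑ ∂C.μ := by
    refine hc.mul_lintegral_le_of_smooth_support hct hΩ hΩb hΩs (B := B)
      ⟨hζ.1.contMDiffOn.mul hu.1, ?_⟩ (fun x hx => ?_) (fun x hx hxs => ?_) ?_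
    · refine subset_empty_iff.1 ((inter_subset_inter_left _ (closure_mono ?_)).trans hu.2.subset)
      exact fun x hx => ⟨hx.1, right_ne_zero_of_mul hx.2⟩
    · exact ⟨mul_nonneg (hζ.2 x).1 (huB x hx).1,
        (mul_le_of_le_one_left (huB x hx).1 (hζ.2 x).2).trans (huB x hx).2⟩
    · filter_upwards [hζs x hx hxs] with z hz
      rw [hz, zero_mul]
    · refine h1.trans_lt (ENNReal.add_lt_top.2 ⟨hufin, hfin.trans_lt ?_⟩)
      exact ENNReal.mul_lt_top ENNReal.ofReal_lt_top hεt.lt_top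
  calc c * ∫⁻ x in Ω, ENNReal.ofReal (u x) ∂C.μ
      ≤ c * (∫⁻ x in Ω, ENNReal.ofReal (ζ x * u x) ∂C.μ + ENNReal.ofReal B * ε) :=
        mul_le_mul_right (h2.trans
          (add_le_add le_rfl (mul_le_mul_right (le_add_self.trans hζε) _))) c
    _ = c * ∫⁻ x in Ω, ENNReal.ofReal (ζ x * u x) ∂C.μ + c * (ENNReal.ofReal B * ε) :=
        mul_add _ _ _
    _ ≤ (∫⁻ x in Ω, ‖C.hd u x‖ₑ ∂C.μ + ENNReal.ofReal B * ε) + c * (ENNReal.ofReal B * ε) :=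
        add_le_add (h3.trans (h1.trans (add_le_add le_rfl hfin))) le_rfl
    _ = _ := by ring

/-- Cheeger's argument: apply the coarea estimate to (truncations of) the square. -/
theorem IsCheegerBound.mul_lintegral_sq_le (hc : C.IsCheegerBound Ω Γ c)
    (hct : c ≠ ⊤) (hΩ : IsOpen Ω) (hΩb : IsCompact (closure Ω))
    (hΩs : HasPiecewiseSmoothBoundary n Ω) {v : M → ℝ} (hv : SmoothVanishingNear n Ω Γ v) :
    c * ∫⁻ x in Ω, ‖v x‖ₑ ^ 2 ∂C.μ ≤ 2 * ∫⁻ x in Ω, ‖v x‖ₑ * ‖C.hd v x‖ₑ ∂C.μ := by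
  -- Smooth bounded truncations increasing to `t ^ 2`. They vanish at `0`, which preserves the
  -- support condition, and satisfy `|φ'| ≤ 2 |t|`, so the right side needs no truncation.
  set φ : ℕ → ℝ → ℝ := fun k t => t ^ 2 / (1 + (1 / ((k : ℝ) + 1)) * t ^ 2) with hφ
  have hpos : ∀ (k : ℕ) (t : ℝ), 0 < 1 + (1 / ((k : ℝ) + 1)) * t ^ 2 := fun k t => by positivity
  have hφs : ∀ k, ContDiff ℝ ∞ (φ k) := fun k =>
    ContDiff.div (by fun_prop) (by fun_prop) fun t => (hpos k t).ne'
  have hφ0 : ∀ k t, 0 ≤ φ k t := fun k t => div_nonneg (sq_nonneg t) (hpos k t).le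
  have hφ1 : ∀ k t, φ k t ≤ (k : ℝ) + 1 := fun k t => by
    rw [hφ]
    beta_reduce
    rw [div_le_iff₀ (hpos k t)]
    have : ((k : ℝ) + 1) * (1 + 1 / ((k : ℝ) + 1) * t ^ 2) = (k : ℝ) + 1 + t ^ 2 := by field_simp
    rw [this]
    linarith [(k.cast_nonneg : (0 : ℝ) ≤ k)]
  have hφd : ∀ k t, |deriv (φ k) t| ≤ 2 * |t| := fun k t => by
    have h1 : HasDerivAt (φ k) _ t := ((hasDerivAt_id t).pow 2).div
      ((((hasDerivAt_id t).pow 2).const_mul (1 / ((k : ℝ) + 1))).const_add 1) (hpos k t).ne'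
    have h2 : deriv (φ k) t = 2 * t / (1 + (1 / ((k : ℝ) + 1)) * t ^ 2) ^ 2 := by
      rw [h1.deriv]
      congr 1
      simp
      ring
    rw [h2, abs_div, abs_mul, abs_two, abs_of_pos (pow_pos (hpos k t) 2)]
    refine div_le_self (by positivity) (one_le_pow₀ ?_)
    exact le_add_of_nonneg_right (by positivity)
  have hφm : ∀ t, Monotone fun k => φ k t := fun t k l hkl => by
    refine div_le_div_of_nonneg_left (sq_nonneg t) (hpos l t) ?_
    have : (1 : ℝ) / (l + 1) ≤ 1 / (k + 1) :=
      one_div_le_one_div_of_le (by positivity) (by exact_mod_cast Nat.succ_le_succ hkl)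
    gcongr
  have hφt : ∀ t, Tendsto (fun k => φ k t) atTop (𝓝 (t ^ 2)) := fun t => by
    have h1 := ((tendsto_one_div_add_atTop_nhds_zero_nat (𝕜 := ℝ)).mul_const (t ^ 2)).const_add 1
    have h2 := (tendsto_const_nhds (x := t ^ 2)).div h1 (by simp)
    simp only [zero_mul, add_zero, div_one] at h2
    exact h2
  have hvd : ∀ x ∈ Ω, MDifferentiableAt (𝓡 n) 𝓘(ℝ, ℝ) v x := fun x hx =>
    (hv.1.contMDiffAt (hΩ.mem_nhds hx)).mdifferentiableAt (by simp)
  have hφv : ∀ k, ContMDiffOn (𝓡 n) 𝓘(ℝ, ℝ) ∞ (fun x => φ k (v x)) Ω := fun k =>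
    (hφs k).contMDiff.comp_contMDiffOn hv.1
  have hk : ∀ k, c * ∫⁻ x in Ω, ENNReal.ofReal (φ k (v x)) ∂C.μ
      ≤ 2 * ∫⁻ x in Ω, ‖v x‖ₑ * ‖C.hd v x‖ₑ ∂C.μ := fun k => by
    refine (hc.mul_lintegral_le_of_bounded hct hΩ hΩb hΩs ⟨hφv k, ?_⟩
      fun x _ => ⟨hφ0 k _, hφ1 k _⟩).trans ?_
    · refine subset_empty_iff.1 ((inter_subset_inter_left _ (closure_mono ?_)).trans hv.2.subset)
      exact fun x hx => ⟨hx.1, fun h => hx.2 (by simp [hφ, h])⟩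
    · rw [← lintegral_const_mul' _ _ ENNReal.ofNat_ne_top]
      refine setLIntegral_mono_ae' hΩ.measurableSet (.of_forall fun x hx => ?_)
      rw [C.hd_comp ((hφs k).differentiable (by simp) _) (hvd x hx)]
      simp only [← ofReal_norm]
      rw [← ENNReal.ofReal_mul (norm_nonneg _), ← ENNReal.ofReal_ofNat,
        ← ENNReal.ofReal_mul zero_le_two]
      refine ENNReal.ofReal_le_ofReal ?_
      rw [norm_smul, ← mul_assoc]
      exact mul_le_mul_of_nonneg_right (hφd k _) (norm_nonneg _)
  have hlim : Tendsto (fun k => ∫⁻ x in Ω, ENNReal.ofReal (φ k (v x)) ∂C.μ) atTop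
      (𝓝 (∫⁻ x in Ω, ‖v x‖ₑ ^ 2 ∂C.μ)) := by
    refine lintegral_tendsto_of_tendsto_of_monotone
      (fun k => ((hφv k).continuousOn.aemeasurable hΩ.measurableSet).ennreal_ofReal)
      (.of_forall fun x k l hkl => ENNReal.ofReal_le_ofReal (hφm _ hkl))
      (.of_forall fun x => ?_)
    rw [← ofReal_norm, ← ENNReal.ofReal_pow (norm_nonneg _), Real.norm_eq_abs, sq_abs]
    exact (ENNReal.continuous_ofReal.tendsto _).comp (hφt (v x))
  exact le_of_tendsto' (ENNReal.Tendsto.const_mul hlim (Or.inr hct)) hk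

/-- Cauchy–Schwarz gives `c ‖v‖² ≤ 2 ‖v‖ ‖H‖`, and one factor `‖v‖` is cancelled; this requires it
to be finite and nonzero. -/
theorem IsCheegerBound.mul_l2Norm_le_of_smooth (hc : C.IsCheegerBound Ω Γ c)
    (hct : c ≠ ⊤) (hΩ : IsOpen Ω) (hΩb : IsCompact (closure Ω))
    (hΩs : HasPiecewiseSmoothBoundary n Ω) {v : M → ℝ} {H : ∀ x, U x}
    (hv : SmoothVanishingNear n Ω Γ v) (hvH : C.MemS1 Ω v H) :
    c * l2Norm (C.μ.restrict Ω) (fun x => ‖v x‖ₑ)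
      ≤ 2 * l2Norm (C.μ.restrict Ω) (fun x => ‖H x‖ₑ) := by
  have h1 := hc.mul_lintegral_sq_le hct hΩ hΩb hΩs hv
  have h2 := lintegral_mul_le_l2Norm (hvH.1.1.enorm) (C.aemeasurable_enorm_hd hΩ hv.1)
  have h3 : l2Norm (C.μ.restrict Ω) (fun x => ‖C.hd v x‖ₑ)
      ≤ l2Norm (C.μ.restrict Ω) (fun x => ‖H x‖ₑ) := l2Norm_mono_ae (by
    filter_upwards [hvH.2.ae_norm_eq_norm_hd hΩ hv.1] with x hx
    rw [← ofReal_norm, ← ofReal_norm, hx])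
  set a := l2Norm (C.μ.restrict Ω) (fun x => ‖v x‖ₑ) with ha
  rw [← l2Norm_sq, ← ha] at h1
  have hat : a ≠ ⊤ := fun h => by
    have h4 := l2Norm_sq (C.μ.restrict Ω) (fun x => ‖v x‖ₑ)
    rw [← ha, h] at h4
    have h5 := lintegral_rpow_enorm_lt_top_of_eLpNorm_lt_top two_ne_zero ENNReal.ofNat_ne_top hvH.1.2
    simp only [ENNReal.toReal_ofNat, ENNReal.rpow_two] at h5
    rw [← h4] at h5
    simp at h5
  rcases eq_or_ne a 0 with ha0 | ha0
  · rw [ha0, mul_zero]; exact bot_le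
  · refine (ENNReal.mul_le_mul_iff_right ha0 hat).1 ?_
    calc a * (c * a) = c * a ^ 2 := by ring
      _ ≤ 2 * (a * l2Norm (C.μ.restrict Ω) (fun x => ‖H x‖ₑ)) :=
        h1.trans (mul_le_mul_right (h2.trans (mul_le_mul_right h3 a)) 2)
      _ = _ := by ring

theorem IsCheegerBound.mul_l2Norm_le (hc : C.IsCheegerBound Ω Γ c)
    (hct : c ≠ ⊤) (hΩ : IsOpen Ω) (hΩb : IsCompact (closure Ω))
    (hΩs : HasPiecewiseSmoothBoundary n Ω) {u : M → ℝ} {G : ∀ x, U x}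
    (hu : C.MemS1Zero Ω Γ u G) :
    c * l2Norm (C.μ.restrict Ω) (fun x => ‖u x‖ₑ)
      ≤ 2 * l2Norm (C.μ.restrict Ω) (fun x => ‖G x‖ₑ) := by
  refine le_of_forall_pos_le_add_mul (k := 2 + c) (by finiteness) fun ε hε _ => ?_
  -- The closure condition measures squared norms, hence the tolerance `ε ^ 2`.
  obtain ⟨v, H, hv, hvH, hε⟩ := hu.2 (ε ^ 2) (by positivity)
  have hsq : ∀ {f : M → ℝ≥0∞}, ∫⁻ x in Ω, f x ^ 2 ∂C.μ ≤ ε ^ 2 → l2Norm (C.μ.restrict Ω) f ≤ ε :=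
    fun h => by
      rw [← l2Norm_sq] at h
      exact (ENNReal.pow_le_pow_left_iff two_ne_zero).1 h
  have h1 := hsq (le_self_add.trans hε.le)
  have h2 := hsq (le_add_self.trans hε.le)
  have hGm : AEMeasurable (fun x => ‖G x‖ₑ) (C.μ.restrict Ω) := by
    simpa only [← ofReal_norm] using hu.1.2.aemeasurable_norm.ennreal_ofReal
  have hHm : AEMeasurable (fun x => ‖H x‖ₑ) (C.μ.restrict Ω) := by
    simpa only [← ofReal_norm] using hvH.2.aemeasurable_norm.ennreal_ofReal
  have h3 : l2Norm (C.μ.restrict Ω) (fun x => ‖u x‖ₑ)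
      ≤ l2Norm (C.μ.restrict Ω) (fun x => ‖v x‖ₑ) + ε := by
    refine (l2Norm_mono_ae (.of_forall fun x => ?_)).trans
      ((l2Norm_add_le hvH.1.1.enorm (hu.1.1.1.sub hvH.1.1).enorm).trans (add_le_add le_rfl h1))
    calc ‖u x‖ₑ = ‖v x + (u x - v x)‖ₑ := by rw [add_sub_cancel]
      _ ≤ _ := enorm_add_le _ _
  have h4 : l2Norm (C.μ.restrict Ω) (fun x => ‖H x‖ₑ)
      ≤ l2Norm (C.μ.restrict Ω) (fun x => ‖G x‖ₑ) + ε := by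
    -- The truncated difference of norms stands in for `‖G x - H x‖ₑ`: its measurability follows
    -- from that of the two norms, and it is bounded by it pointwise.
    refine (l2Norm_mono_ae (g := fun x => ‖G x‖ₑ + (‖H x‖ₑ - ‖G x‖ₑ))
      (.of_forall fun x => le_add_tsub)).trans ((l2Norm_add_le hGm (hHm.sub hGm)).trans
        (add_le_add le_rfl ((l2Norm_mono_ae (.of_forall fun x => ?_)).trans h2)))
    change ‖H x‖ₑ - ‖G x‖ₑ ≤ _
    rw [tsub_le_iff_right]
    calc ‖H x‖ₑ = ‖G x - (G x - H x)‖ₑ := by rw [sub_sub_cancel]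
      _ ≤ ‖G x‖ₑ + ‖G x - H x‖ₑ := enorm_sub_le
      _ = _ := add_comm _ _
  calc c * l2Norm (C.μ.restrict Ω) (fun x => ‖u x‖ₑ)
      ≤ c * l2Norm (C.μ.restrict Ω) (fun x => ‖v x‖ₑ) + c * ε :=
        (mul_le_mul_right h3 c).trans (mul_add _ _ _).le
    _ ≤ 2 * (l2Norm (C.μ.restrict Ω) (fun x => ‖G x‖ₑ) + ε) + c * ε :=
        add_le_add ((hc.mul_l2Norm_le_of_smooth hct hΩ hΩb hΩs hv hvH).trans
          (mul_le_mul_right h4 2)) le_rfl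
    _ = _ := by ring

theorem isCheegerBound_of_le (h : c ≤ C.mixedCheegerConstant Ω Γ) : C.IsCheegerBound Ω Γ c :=
  fun A h1 h2 h3 h4 h5 => ENNReal.mul_le_of_le_div (h.trans (iInf₂_le A ⟨h1, h2, h3, h4, h5⟩))

theorem lintegral_enorm_sq_ne_zero_and_ne_top {u : M → ℝ} (hu : MemLp u 2 (C.μ.restrict Ω))
    (hu0 : ¬ ∀ᵐ x ∂(C.μ.restrict Ω), u x = 0) :
    ∫⁻ x in Ω, ‖u x‖ₑ ^ 2 ∂C.μ ≠ 0 ∧ ∫⁻ x in Ω, ‖u x‖ₑ ^ 2 ∂C.μ ≠ ⊤ := by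
  refine ⟨fun h => hu0 ?_, ?_⟩
  · rw [lintegral_eq_zero_iff' (hu.1.enorm.pow_const 2)] at h
    filter_upwards [h] with x hx
    simpa using hx
  · have h := lintegral_rpow_enorm_lt_top_of_eLpNorm_lt_top two_ne_zero ENNReal.ofNat_ne_top hu.2
    simpa only [ENNReal.toReal_ofNat, ENNReal.rpow_two] using h.ne

theorem sq_mixedCheegerConstant_le (hΩ : IsOpen Ω) (hΩb : IsCompact (closure Ω))
    (hΩs : HasPiecewiseSmoothBoundary n Ω) :
    C.mixedCheegerConstant Ω Γ ^ 2 / 4 ≤ C.mixedRayleighInf Ω Γ := by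
  refine le_iInf fun u => le_iInf fun G => le_iInf fun h => ?_
  obtain ⟨h0, ht⟩ := lintegral_enorm_sq_ne_zero_and_ne_top h.1.1.1 h.2
  rw [← l2Norm_sq, ← l2Norm_sq]
  rw [← l2Norm_sq] at h0 ht
  set a := l2Norm (C.μ.restrict Ω) fun x => ‖u x‖ₑ
  set b := l2Norm (C.μ.restrict Ω) fun x => ‖G x‖ₑ
  have ha0 : a ≠ 0 := fun h => h0 (by rw [h, zero_pow two_ne_zero])
  have hat : a ≠ ⊤ := fun h => ht (by rw [h, ENNReal.top_pow two_ne_zero])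
  -- Bounds `c` strictly below the Cheeger constant are finite even if that constant is not, as
  -- happens when there is no admissible set.
  have hle : C.mixedCheegerConstant Ω Γ ≤ 2 * b / a :=
    le_of_forall_lt_imp_le_of_dense fun c hc => by
      rw [ENNReal.le_div_iff_mul_le (Or.inl ha0) (Or.inl hat)]
      exact (isCheegerBound_of_le hc.le).mul_l2Norm_le hc.ne_top hΩ hΩb hΩs h.1
  have hle' : C.mixedCheegerConstant Ω Γ * a ≤ 2 * b := by
    rwa [ENNReal.le_div_iff_mul_le (Or.inl ha0) (Or.inl hat)] at hle
  rw [ENNReal.le_div_iff_mul_le (Or.inl h0) (Or.inl ht)]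
  calc C.mixedCheegerConstant Ω Γ ^ 2 / 4 * a ^ 2
      = (C.mixedCheegerConstant Ω Γ * a) ^ 2 / 4 := by
        rw [mul_pow, div_eq_mul_inv, div_eq_mul_inv]; ring
    _ ≤ (2 * b) ^ 2 / 4 := by gcongr
    _ = b ^ 2 := by
        have : (2 : ℝ≥0∞) ^ 2 = 4 := by norm_num
        rw [mul_pow, this, mul_comm, ENNReal.mul_div_cancel_right (by norm_num) (by norm_num)]

/-- Testing the eigenvalue equation with the eigenfunction itself gives `‖∇_H u‖² = l ‖u‖²`, so `l`
is the Rayleigh quotient of `u`. -/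
theorem mixedRayleighInf_le_firstMixedEigenvalue :
    C.mixedRayleighInf Ω Γ ≤ C.firstMixedEigenvalue Ω Γ := by
  refine le_iInf₂ fun l ⟨u, hu0, _, G, hG, hw⟩ => ?_
  refine (iInf_le_of_le u (iInf₂_le_of_le G ⟨hG, hu0⟩ le_rfl)).trans ?_
  obtain ⟨h0, ht⟩ := lintegral_enorm_sq_ne_zero_and_ne_top hG.1.1 hu0
  have h1 := hw u G hG
  have e1 : ∫⁻ x in Ω, ‖G x‖ₑ ^ 2 ∂C.μ
      = ENNReal.ofReal (∫ x in Ω, (inner ℝ (G x) (G x) : ℝ) ∂C.μ) := by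
    have hGm := hG.1.2.aemeasurable_norm
    have := lintegral_enorm_sq_eq_ofReal_integral hGm
      (by simpa only [enorm_norm] using hG.1.2.sq_integrable)
    simpa only [enorm_norm, real_inner_self_eq_norm_sq] using this
  have e2 := lintegral_enorm_sq_eq_ofReal_integral hG.1.1.1.aemeasurable ht.lt_top
  have e3 : ∫ x in Ω, u x * (l * u x) ∂C.μ = l * ∫ x in Ω, u x ^ 2 ∂C.μ := by
    rw [← integral_const_mul]
    exact integral_congr_ae (.of_forall fun x => by ring)
  rw [e1, h1, e3, ENNReal.ofReal_mul' (integral_nonneg fun x => sq_nonneg (u x)), ← e2,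
    ENNReal.mul_div_cancel_right h0 ht]

end CCSpace

end Cheeger

end CC

end

theorem mainTheorem4 {n : ℕ} {M : Type*} [TopologicalSpace M] [T2Space M]
    [SecondCountableTopology M] [ChartedSpace (EuclideanSpace ℝ (Fin n)) M]
    [IsManifold (𝓡 n) ∞ M] [MeasurableSpace M] [BorelSpace M]
    {F : Type*} [NormedAddCommGroup F] [NormedSpace ℝ F] [FiniteDimensional ℝ F]
    {U : M → Type*} [TopologicalSpace (TotalSpace F U)] [∀ x, NormedAddCommGroup (U x)]
    [∀ x, InnerProductSpace ℝ (U x)] [FiberBundle F U] [VectorBundle ℝ F U]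
    [ContMDiffVectorBundle ∞ F U (𝓡 n)] [IsContMDiffRiemannianBundle (𝓡 n) ∞ F U]
    (C : CC.CCSpace n M F U)
    (Ω Γ : Set M) (hΩ : IsOpen Ω) (hΩb : IsCompact (closure Ω))
    (hΩs : CC.HasPiecewiseSmoothBoundary n Ω)
    (hΓ : Γ ⊆ frontier Ω) (hΓc : Finite (ConnectedComponents Γ)) :
    C.mixedCheegerConstant Ω Γ ^ 2 / 4 ≤ C.firstMixedEigenvalue Ω Γ ∧
      C.mixedCheegerConstant Ω Γ ^ 2 / 4 ≤ C.mixedRayleighInf Ω Γ :=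
  ⟨(CC.CCSpace.sq_mixedCheegerConstant_le hΩ hΩb hΩs).trans
      CC.CCSpace.mixedRayleighInf_le_firstMixedEigenvalue,
    CC.CCSpace.sq_mixedCheegerConstant_le hΩ hΩb hΩs⟩
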